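/- Let $d,k\ge 1$ be integers and let $\mathbb{T}_{k,d}$ be the infinite $(k+1)$-uniform $(d+1)$-regular hypertree: the hypergraph in which every hyperedge has $k+1$ vertices, every vertex lies in $d+1$ hyperedges, and whose incidence graph is a tree. An independent set is a set of vertices meeting every hyperedge in at most one vertex. For $\lambda>0$, a Gibbs measure with activity $\lambda$ is a probability measure $\mu$ on independent sets $I$ such that, for every finite vertex set $W$ and every independent $A\subseteq W$, conditionally on no vertex outside $W$ adjacent to $W$ being in $I$, one has $I\cap W=A$ with probability $\lambda^{|A|}/Z_W$, where $Z_W=\sum_{B}\lambda^{|B|}$ over the independent sets $B\subseteq W$. The measure $\mu$ is simple if, for every set $\Lambda$ of vertices, conditionally on $I\cap\Lambda$ the restrictions of $I$ to the connected components of the hypertree with $\Lambda$ removed are mutually independent. For a group $G$ of automorphisms of $\mathbb{T}_{k,d}$, $\mu$ is $G$-translation-invariant if it is invariant under every element of $G$, and translation-invariant if $G$ is the full automorphism group. Put $$\lambda_c=\frac{d^d}{k(d-1)^{d+1}},\qquad \lambda_c=\infty\ \text{ if } d=1.$$ Then: 1. For every $\lambda>0$ there is exactly one simple translation-invariant Gibbs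 measure on independent sets of $\mathbb{T}_{k,d}$ with activity $\lambda$. 2. For every $\lambda>0$, there is exactly one Gibbs measure on independent sets of $\mathbb{T}_{k,d}$ with activity $\lambda$ if and only if $\lambda\le\lambda_c$. 3. There is a group $\widehat{G}$ of automorphisms of $\mathbb{T}_{k,d}$, not depending on $\lambda$, with exactly two orbits on the vertices, such that for every $\lambda>0$ there is exactly one $\widehat{G}$-translation-invariant Gibbs measure with activity $\lambda$ if and only if $\lambda\le\lambda_c$. 4. (Matchings.) Let $\mathbb{T}_{d,k}$ be the infinite $(d+1)$-uniform $(k+1)$-regular hypertree, and define Gibbs measures on its matchings (sets of pairwise disjoint hyperedges) in the same way, a finite set of hyperedges being conditioned on no hyperedge outside it that meets one of its hyperedges being chosen. The dual hypergraph of $\mathbb{T}_{d,k}$ is a $(k+1)$-uniform $(d+1)$-regular hypertree, and for every $\lambda>0$ the Gibbs measures on matchings of $\mathbb{T}_{d,k}$ are exactly the Gibbs measures on independent sets of this dual. For every $\lambda>0$ there is exactly one Gibbs measure on matchings of $\mathbb{T}_{d,k}$ if and only if $\lambda\le\lambda_c$. -/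

import Mathlib

open MeasureTheory ProbabilityTheory
open scoped ENNReal Finset
universe u


noncomputable section

namespace Hypergraph

variable {V : Type*}

/-- The incidence graph of `H`: the bipartite graph between vertices and hyperedges. -/
def incidenceGraph (H : Hypergraph V) : SimpleGraph (V ⊕ H.edgeSet) where
  Adj
    | .inl v, .inr e => v ∈ (e : Set V)
    | .inr e, .inl v => v ∈ (e : Set V)
    | _, _ => False
  symm := ⟨by rintro (v | e) (w | f) h <;> exact h⟩
  loopless := ⟨by rintro (v | e) h <;> exact h⟩

/-- `H` is the infinite `(k+1)`-uniform `(d+1)`-regular hypertree (on the vertex type `V`): its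
incidence graph is a tree, every hyperedge has size `k + 1`, every vertex has degree `d + 1`.
For `k, d ≥ 1` these properties determine `H` up to isomorphism. -/
structure IsRegularHypertree (k d : ℕ) (H : Hypergraph V) : Prop where
  vertexSet_eq : H.vertexSet = Set.univ
  isTree : H.incidenceGraph.IsTree
  uniform : ∀ e ∈ H.edgeSet, e.ncard = k + 1
  regular : ∀ v : V, {e ∈ H.edgeSet | v ∈ e}.ncard = d + 1

/-- The dual hypergraph: its vertices are the hyperedges of `H`, and its hyperedges are the sets
of all hyperedges containing a given vertex of `H`. -/
def dual (H : Hypergraph V) : Hypergraph H.edgeSet where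
  vertexSet := Set.univ
  edgeSet := {s | ∃ v ∈ H.vertexSet, s = {e : H.edgeSet | v ∈ (e : Set V)}}
  subset_vertexSet_of_mem_edgeSet' := fun _ _ => Set.subset_univ _

/-- The automorphism group of `H`, as a group of permutations of the vertices. -/
def aut (H : Hypergraph V) : Subgroup (Equiv.Perm V) where
  carrier := {g | (∀ v, g v ∈ H.vertexSet ↔ v ∈ H.vertexSet) ∧
    ∀ e : Set V, g '' e ∈ H.edgeSet ↔ e ∈ H.edgeSet}
  one_mem' := by simp
  mul_mem' := by
    rintro a b ⟨ha, ha'⟩ ⟨hb, hb'⟩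
    refine ⟨fun v => by rw [Equiv.Perm.mul_apply, ha, hb], fun e => ?_⟩
    rw [Equiv.Perm.coe_mul, Set.image_comp, ha', hb']
  inv_mem' := by
    rintro a ⟨ha, ha'⟩
    refine ⟨fun v => by simpa using (ha (a⁻¹ v)).symm, fun e => ?_⟩
    rw [← ha', ← Set.image_comp, ← Equiv.Perm.coe_mul, mul_inv_cancel, Equiv.Perm.coe_one,
      Set.image_id]

/-- Independent sets: sets of vertices that meet every hyperedge in at most one vertex. -/
def IsIndep (H : Hypergraph V) (I : Set V) : Prop :=
  I ⊆ H.vertexSet ∧ ∀ e ∈ H.edgeSet, (I ∩ e).Subsingleton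

open Classical in
/-- The partition function `Z = ∑ λ ^ |A|` of the finite sub-hypergraph of `H` induced by the
vertex set `W` (with hyperedges `e ∩ W`); its independent sets are those of `H` contained
in `W`. -/
def indepPartition (H : Hypergraph V) (lam : ℝ) (W : Finset V) : ℝ :=
  ∑ A ∈ W.powerset.filter (fun A : Finset V => H.IsIndep (A : Set V)), lam ^ #A

/-- The outer boundary of `W`: the vertices outside `W` adjacent to a vertex of `W`. -/
def outerBoundary (H : Hypergraph V) (W : Set V) : Set V :=
  {u | u ∉ W ∧ ∃ w ∈ W, H.Adj u w}

/-- `μ` is a Gibbs measure on the independent sets of `H` with activity `lam`: it is a probability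
measure on independent sets such that, for every finite `W`, given that the outer boundary of `W`
is unoccupied, the occupied part of `W` has the finite-volume Gibbs distribution
`λ ^ |A| / Z`. -/
structure IsGibbs (H : Hypergraph V) (lam : ℝ) (μ : Measure (Set V)) : Prop where
  isProbabilityMeasure : IsProbabilityMeasure μ
  ae_isIndep : ∀ᵐ I ∂μ, H.IsIndep I
  cond_eq : ∀ W A : Finset V, A ⊆ W → H.IsIndep (A : Set V) →
    μ[|{I | I ∩ H.outerBoundary W = ∅}].real {I | I ∩ W = A} =
      lam ^ #A / H.indepPartition lam W

/-- The σ-algebra generated by the configuration `I ∩ S` on the set `S` of vertices. -/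
abbrev configSigma (S : Set V) : MeasurableSpace (Set V) :=
  MeasurableSpace.comap (fun I : Set V => I ∩ S) inferInstance

/-- The connected components of `H` after removal of the vertices in `Λ`. -/
abbrev ComponentsOff (H : Hypergraph V) (Λ : Set V) : Type _ :=
  ((SimpleGraph.fromRel H.Adj).induce Λᶜ).ConnectedComponent

/-- Conditional independence: for every set `Λ` of vertices, conditionally on the configuration
on `Λ`, the configurations on the components separated by `Λ` are mutually independent. -/
def IsSimple (H : Hypergraph V) (μ : Measure (Set V)) : Prop :=
  ∀ (Λ : Set V) (s : Finset (H.ComponentsOff Λ)) (A : H.ComponentsOff Λ → Set (Set V)),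
    (∀ C ∈ s, MeasurableSet[configSigma (Subtype.val '' C.supp)] (A C)) →
      μ⟦⋂ C ∈ s, A C | configSigma Λ⟧ =ᵐ[μ] ∏ C ∈ s, μ⟦A C | configSigma Λ⟧

/-- Invariance of a law of random vertex sets under a group of permutations of the vertices. -/
def IsInvariant (G : Subgroup (Equiv.Perm V)) (μ : Measure (Set V)) : Prop :=
  ∀ g ∈ G, μ.map (fun I : Set V => g '' I) = μ

/-- Matchings: sets of pairwise disjoint hyperedges. -/
def IsMatching (H : Hypergraph V) (M : Set H.edgeSet) : Prop :=
  M.Pairwise fun e f => Disjoint (e : Set V) (f : Set V)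

open Classical in
/-- The partition function `Z = ∑ λ ^ |A|` over the matchings `A ⊆ F`, for a finite set `F`
of hyperedges. -/
def matchingPartition (H : Hypergraph V) (lam : ℝ) (F : Finset H.edgeSet) : ℝ :=
  ∑ A ∈ F.powerset.filter (fun A : Finset H.edgeSet => H.IsMatching (A : Set H.edgeSet)),
    lam ^ #A

/-- The hyperedges outside `F` that meet a hyperedge of `F`. -/
def edgeBoundary (H : Hypergraph V) (F : Set H.edgeSet) : Set H.edgeSet :=
  {f | f ∉ F ∧ ∃ e ∈ F, ¬ Disjoint (e : Set V) (f : Set V)}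

/-- `μ` is a Gibbs measure on the matchings of `H` with activity `lam`. -/
structure IsMatchingGibbs (H : Hypergraph V) (lam : ℝ) (μ : Measure (Set H.edgeSet)) : Prop where
  isProbabilityMeasure : IsProbabilityMeasure μ
  ae_isMatching : ∀ᵐ M ∂μ, H.IsMatching M
  cond_eq : ∀ F A : Finset H.edgeSet, A ⊆ F → H.IsMatching (A : Set H.edgeSet) →
    μ[|{M | M ∩ H.edgeBoundary F = ∅}].real {M | M ∩ F = A} =
      lam ^ #A / H.matchingPartition lam F

end Hypergraph

/-- The critical activity `λ_c = d ^ d / (k (d - 1) ^ (d + 1))`, which is `∞` for `d = 1`. -/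
def criticalActivity (k d : ℕ) : ℝ≥0∞ :=
  (d : ℝ≥0∞) ^ d / ((k : ℝ≥0∞) * ((d : ℝ≥0∞) - 1) ^ (d + 1))

end

/-! Fixing an end of the incidence tree gives every vertex a parent, `d` downward hyperedges with
`k` children each, and an integer height. Finite subtrees can then be built up or peeled off one
hyperedge at a time.

On a finite subtree, take a hard-core measure with vertex activities `w`. Summing out the `k` outer
vertices `u` of a pendant hyperedge at `v` leaves a hard-core measure in which `w v` has been
divided by `1 + ∑ w u` (`IsHardCore.of_union_edge`). A family of effective activities consistent
with this rule (`IsBoundaryLaw`) gives consistent finite-volume measures, hence by compactness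
exactly one probability measure on the whole tree (`IsBoundaryLaw.exists_hasLaw`, `HasLaw.unique`).
That measure is Gibbs and simple, and it is invariant under the automorphisms that preserve the
family (`HasLaw.isGibbs`, `HasLaw.isSimple`, `HasLaw.isInvariant`).

A fixed point `t * (1 + k * lam * t ^ d) = 1` yields a constant family, hence a simple
translation-invariant Gibbs measure for every activity. Conversely, simplicity makes each vertex a
Markov cutset. The common density then satisfies an equation with only one solution
(`IsGibbs.density_eq`), and the hyperedge marginals glue to all subtree marginals
(`IsSimple.unique`).

For the threshold, the map `t ↦ 1 / (1 + k * lam * t ^ d)` is decreasing, and every boundary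
condition at distance `n` gives activities between those obtained from the extreme starts 0 and 1
(`IsGibbs.cylMass_bounds`). These bounds meet in the limit when the map has no proper two-cycle.
Parametrised by `s = (1 + y) / (1 + x)`, a two-cycle determines `k * lam` as an explicit function of
`s`. This function equals `d ^ d / (d - 1) ^ (d + 1)` at `s = 1` and is larger for `s > 1`
(`geom_sum_pow_lt`), so proper cycles occur exactly above the critical activity (`cycle_eq`,
`exists_cycle`).

Above the threshold a cycle, alternated along the levels of the height, is a boundary law
(`isBoundaryLaw_cycleLaw`), and exchanging its two values gives a second Gibbs measure. Both are
invariant under the automorphisms that fix the end and preserve the parity of the height; this group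
does not depend on the activity and has two vertex orbits. Matchings reduce to independent sets
because duality exchanges the two sides of the incidence graph. -/

namespace SimpleGraph

/-! ### Trees and their ends. -/

variable {X : Type*} {G : SimpleGraph X}

/-- Geodesics from `r` to `y` and to `z`, prolonged to `x`, are still geodesics, hence paths; a tree
has only one path from `r` to `x`. -/
theorem IsTree.eq_of_adj_of_dist_lt (hG : G.IsTree) {r x y z : X} (hy : G.Adj x y) (hz : G.Adj x z)
    (hxy : G.dist r x = G.dist r y + 1) (hxz : G.dist r x = G.dist r z + 1) : y = z := by
  obtain ⟨p, hp⟩ := hG.connected.exists_walk_length_eq_dist r y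
  obtain ⟨q, hq⟩ := hG.connected.exists_walk_length_eq_dist r z
  have key : ∀ {a : X} (p : G.Walk r a) (ha : G.Adj a x), G.dist r x = G.dist r a + 1 →
      p.length = G.dist r a → (p.concat ha).IsPath := by
    intro a p ha h1 h2
    apply Walk.isPath_of_length_eq_dist
    rw [Walk.length_concat, h1, h2]
  have h1 := key p hy.symm hxy hp
  have h2 := key q hz.symm hxz hq
  have := congrArg Walk.penultimate ((hG.existsUnique_path r x).unique h1 h2)
  simpa using this

theorem IsTree.exists_adj_dist (hG : G.IsTree) {r x : X} (hx : x ≠ r) :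
    ∃ y, G.Adj x y ∧ G.dist r x = G.dist r y + 1 := by
  obtain ⟨p, hp⟩ := hG.connected.exists_walk_length_eq_dist x r
  cases p with
  | nil => exact absurd rfl hx
  | cons h q =>
    rename_i v
    refine ⟨v, h, ?_⟩
    have h1 : G.dist v r ≤ q.length := dist_le q
    simp only [Walk.length_cons] at hp
    rcases hG.dist_eq_dist_add_one_of_adj r h with h2 | h2
    · exact h2
    · rw [dist_comm (u := r) (v := v), dist_comm (u := r) (v := x)] at h2
      omega

/-- A tree without leaves carries a map that moves every vertex one step towards a fixed end,
together with a height function that decreases along it. -/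
theorem IsTree.exists_end (hG : G.IsTree) (hdeg : ∀ x, ∃ y z, y ≠ z ∧ G.Adj x y ∧ G.Adj x z) :
    ∃ (nx : X → X) (h : X → ℤ), (∀ x, G.Adj x (nx x)) ∧
      (∀ x y, G.Adj x y → nx x = y ∨ nx y = x) ∧ (∀ x, h (nx x) = h x - 1) ∧
      ∀ x y, ∃ m n, nx^[m] x = nx^[n] y := by
  classical
  obtain ⟨r⟩ := hG.connected.nonempty
  have hpar : ∀ x, ∃ y, x ≠ r → G.Adj x y ∧ G.dist r x = G.dist r y + 1 := by
    intro x
    by_cases hx : x = r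
    · exact ⟨x, fun h => absurd hx h⟩
    · obtain ⟨y, hy⟩ := hG.exists_adj_dist hx
      exact ⟨y, fun _ => hy⟩
  choose par hpar using hpar
  -- At most one neighbour is closer to `r`, so of two distinct neighbours one is farther away.
  have hch : ∀ x, ∃ y, G.Adj x y ∧ G.dist r y = G.dist r x + 1 := by
    intro x
    obtain ⟨y, z, hyz, hy, hz⟩ := hdeg x
    rcases hG.dist_eq_dist_add_one_of_adj r hy with h1 | h1
    · rcases hG.dist_eq_dist_add_one_of_adj r hz with h2 | h2
      · exact absurd (hG.eq_of_adj_of_dist_lt hy hz h1 h2) hyz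
      · exact ⟨z, hz, h2⟩
    · exact ⟨y, hy, h1⟩
  choose ch hch hchd using hch
  have hne : ∀ {x y}, G.dist r x = G.dist r y + 1 → x ≠ r := by
    rintro x y h rfl
    simp at h
  have hparch : ∀ {x y}, G.Adj x y → G.dist r x = G.dist r y + 1 → par x = y := by
    intro x y hxy h
    have := hpar x (hne h)
    exact hG.eq_of_adj_of_dist_lt this.1 hxy this.2 h
  have hdistr : ∀ n, G.dist r (ch^[n] r) = n := by
    intro n
    induction n with
    | zero => simp
    | succ n ih => rw [Function.iterate_succ_apply', hchd, ih]
  -- The geodesic ray from `r` along `ch` represents the end: its vertices step outward along it,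
  -- all others step back towards `r`.
  set ray : X → Prop := fun x => ch^[G.dist r x] r = x with hray
  have hrayr : ray r := by simp [hray]
  have hraych : ∀ {x}, ray x → ray (ch x) := by
    intro x hx
    simp only [hray, hchd, Function.iterate_succ_apply'] at hx ⊢
    rw [hx]
  have hparray : ∀ {x}, ray x → par (ch x) = x := fun {x} _ => hparch (hch x).symm (hchd x)
  set nx : X → X := fun x => if ray x then ch x else par x with hnx
  -- Along the path from `x` back to `r`, ray vertices count -1 and the others +1, which makes `h` a
  -- Busemann function of the end.
  set h : X → ℤ := fun x => ∑ i ∈ Finset.range (G.dist r x), if ray (par^[i] x) then (-1) else 1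
    with hh
  have hstep : ∀ {x}, x ≠ r → h x = h (par x) + if ray x then -1 else 1 := by
    intro x hx
    simp only [hh]
    rw [(hpar x hx).2, Finset.sum_range_succ']
    simp only [Function.iterate_succ_apply, Function.iterate_zero, id]
    rfl
  have hadj : ∀ x, G.Adj x (nx x) := by
    intro x
    by_cases hx : ray x
    · simp only [hnx, hx, if_true]; exact hch x
    · have : x ≠ r := by rintro rfl; exact hx hrayr
      simp only [hnx, hx, if_false]; exact (hpar x this).1
  have hor : ∀ x y, G.Adj x y → nx x = y ∨ nx y = x := by
    have aux : ∀ x y, G.Adj x y → G.dist r y = G.dist r x + 1 → nx x = y ∨ nx y = x := by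
      intro x y hxy hd
      have hp := hparch hxy.symm hd
      by_cases hy : ray y
      · left
        have h1 : ch (ch^[G.dist r x] r) = y := by
          rw [← Function.iterate_succ_apply' ch, Nat.succ_eq_add_one, ← hd]; exact hy
        have h2 : par y = ch^[G.dist r x] r := by
          apply hparch
          · rw [← h1]; exact (hch _).symm
          · rw [hd, hdistr]
        have h3 : ray x := by simp only [hray]; rw [← h2, hp]
        simp only [hnx, h3, if_true]
        rw [← h1, ← h2, hp]
      · right
        simp only [hnx, hy, if_false]
        exact hp
    intro x y hxy
    rcases hG.dist_eq_dist_add_one_of_adj r hxy with h1 | h1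
    · exact (aux y x hxy.symm h1).symm
    · exact aux x y hxy h1
  refine ⟨nx, h, hadj, hor, ?_, ?_⟩
  · intro x
    by_cases hx : ray x
    · simp only [hnx, hx, if_true]
      rw [hstep (hne (hchd x)), if_pos (hraych hx), hparray hx]
      ring
    · have hr : x ≠ r := by rintro rfl; exact hx hrayr
      simp only [hnx, hx, if_false]
      rw [hstep hr, if_neg hx]
      ring
  · intro x y
    obtain ⟨p⟩ := hG.connected.preconnected x y
    induction p with
    | nil => exact ⟨0, 0, rfl⟩
    | cons hab q ih =>
      rename_i a b c
      obtain ⟨m, n, hmn⟩ := ih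
      rcases hor a b hab with h1 | h1
      · exact ⟨m + 1, n, by rw [Function.iterate_succ_apply, h1, hmn]⟩
      · refine ⟨m, n + 1, ?_⟩
        rw [← h1, ← Function.iterate_succ_apply, Function.iterate_succ_apply',
          Function.iterate_succ_apply', hmn]

end SimpleGraph

/-! ### The end structure of a regular hypertree. -/

namespace Hypergraph

variable {V : Type*} {H : Hypergraph V} {k d : ℕ}

/-- A regular hypertree seen from one of its ends: every vertex has a parent vertex and `d`
downward hyperedges with `k` children each. -/
structure EndStructure (H : Hypergraph V) (k d : ℕ) where
  par : V → V
  child : V → Fin d → Fin k → V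
  ht : V → ℤ
  par_child : ∀ v i j, par (child v i j) = v
  child_inj : ∀ v i j i' j', child v i j = child v i' j' → i = i' ∧ j = j'
  exists_child : ∀ w, ∃ i j, child (par w) i j = w
  ht_par : ∀ v, ht (par v) = ht v - 1
  confluent : ∀ v w, ∃ m n, par^[m] v = par^[n] w
  mem_edgeSet : ∀ e : Set V, e ∈ H.edgeSet ↔ ∃ v i, e = insert v (Set.range (child v i))

/-- The incidence graph has no leaves, so `exists_end` applies. One step towards the end leads from
a vertex to its upward hyperedge `up v`, and from a hyperedge to its top vertex `top e`. -/
theorem IsRegularHypertree.nonempty_endStructure (hH : H.IsRegularHypertree k d) (hk : 1 ≤ k)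
    (hd : 1 ≤ d) : Nonempty (H.EndStructure k d) := by
  classical
  have hfin : ∀ e ∈ H.edgeSet, e.Finite := fun e he =>
    Set.finite_of_ncard_ne_zero (by rw [hH.uniform e he]; omega)
  have hfin' : ∀ v : V, {e ∈ H.edgeSet | v ∈ e}.Finite := fun v =>
    Set.finite_of_ncard_ne_zero (by rw [hH.regular v]; omega)
  obtain ⟨nx, h, hadj, hor, hht, hconf⟩ := hH.isTree.exists_end (by
    rintro (v | e)
    · obtain ⟨e, he, f, hf, hef⟩ := (Set.one_lt_ncard (hfin' v)).1 (by rw [hH.regular v]; omega)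
      exact ⟨.inr ⟨e, he.1⟩, .inr ⟨f, hf.1⟩, by simpa using hef, he.2, hf.2⟩
    · obtain ⟨u, hu, w, hw, huw⟩ := (Set.one_lt_ncard (hfin e e.2)).1
        (by rw [hH.uniform e e.2]; omega)
      exact ⟨.inl u, .inl w, by simpa using huw, hu, hw⟩)
  have h1 : ∀ v : V, ∃ e : H.edgeSet, nx (.inl v) = .inr e ∧ v ∈ (e : Set V) := by
    intro v
    have := hadj (.inl v)
    rcases hx : nx (.inl v) with u | e
    · rw [hx] at this; exact this.elim
    · rw [hx] at this; exact ⟨e, rfl, this⟩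
  have h2 : ∀ e : H.edgeSet, ∃ v : V, nx (.inr e) = .inl v ∧ v ∈ (e : Set V) := by
    intro e
    have := hadj (.inr e)
    rcases hx : nx (.inr e) with u | f
    · rw [hx] at this; exact ⟨u, rfl, this⟩
    · rw [hx] at this; exact this.elim
  choose up hup hupm using h1
  choose top htop htopm using h2
  have hinc : ∀ (v : V) (e : H.edgeSet), v ∈ (e : Set V) → up v = e ∨ top e = v := by
    intro v e hve
    rcases hor (.inl v) (.inr e) hve with h3 | h3
    · left; rw [hup] at h3; exact Sum.inr_injective h3
    · right; rw [htop] at h3; exact Sum.inl_injective h3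
  have hh1 : ∀ v, h (.inr (up v)) = h (.inl v) - 1 := fun v => by rw [← hup, hht]
  have hh2 : ∀ e, h (.inl (top e)) = h (.inr e) - 1 := fun e => by rw [← htop, hht]
  have hne1 : ∀ v, top (up v) ≠ v := by
    intro v hv
    have := hh1 v
    have := hh2 (up v)
    rw [hv] at this
    omega
  have hne2 : ∀ e, up (top e) ≠ e := by
    intro e he
    have := hh1 (top e)
    have := hh2 e
    rw [he] at *
    omega
  have hcard1 : ∀ v : V, Nat.card {e : H.edgeSet // v ∈ (e : Set V) ∧ e ≠ up v} = d := by
    intro v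
    have : ({e ∈ H.edgeSet | v ∈ e} \ {(up v : Set V)}).ncard = d := by
      rw [Set.ncard_sdiff_singleton_of_mem (show (up v : Set V) ∈ {e ∈ H.edgeSet | v ∈ e} from
        ⟨(up v).2, hupm v⟩), hH.regular]; rfl
    rw [← this, ← Nat.card_coe_set_eq]
    refine Nat.card_congr ⟨fun e => ⟨e.1, ⟨e.1.2, e.2.1⟩, fun h => e.2.2 (Subtype.ext h)⟩,
      fun e => ⟨⟨e.1, e.2.1.1⟩, e.2.1.2, fun h => e.2.2 (congrArg Subtype.val h)⟩,
      fun _ => rfl, fun _ => rfl⟩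
  have hcard2 : ∀ e : H.edgeSet, Nat.card {w : V // w ∈ (e : Set V) ∧ w ≠ top e} = k := by
    intro e
    have : ((e : Set V) \ {top e}).ncard = k := by
      rw [Set.ncard_sdiff_singleton_of_mem (htopm e), hH.uniform _ e.2]; rfl
    rw [← this, ← Nat.card_coe_set_eq]
    rfl
  have a1 : ∀ v, Nonempty (Fin d ≃ {e : H.edgeSet // v ∈ (e : Set V) ∧ e ≠ up v}) := by
    intro v
    have : Finite {e : H.edgeSet // v ∈ (e : Set V) ∧ e ≠ up v} :=
      Nat.finite_of_card_ne_zero (by rw [hcard1]; omega)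
    exact ⟨(Finite.equivFinOfCardEq (hcard1 v)).symm⟩
  have a2 : ∀ e : H.edgeSet, Nonempty (Fin k ≃ {w : V // w ∈ (e : Set V) ∧ w ≠ top e}) := by
    intro e
    have : Finite {w : V // w ∈ (e : Set V) ∧ w ≠ top e} :=
      Nat.finite_of_card_ne_zero (by rw [hcard2]; omega)
    exact ⟨(Finite.equivFinOfCardEq (hcard2 e)).symm⟩
  let α := fun v => (a1 v).some
  let β := fun e => (a2 e).some
  have hup_child : ∀ v i j, up (β (α v i).1 j).1 = (α v i).1 := fun v i j =>
    (hinc _ _ (β (α v i).1 j).2.1).resolve_right (β (α v i).1 j).2.2.symm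
  have htop_α : ∀ v i, top (α v i).1 = v := fun v i =>
    (hinc _ _ (α v i).2.1).resolve_left (α v i).2.2.symm
  have hnx2 : ∀ v, nx (nx (.inl v)) = .inl (top (up v)) := fun v => by rw [hup, htop]
  have hiter : ∀ n v, nx^[2 * n] (.inl v) = .inl ((fun v => top (up v))^[n] v) := by
    intro n
    induction n with
    | zero => intro v; rfl
    | succ n ih =>
      intro v
      rw [show 2 * (n + 1) = 2 * n + 1 + 1 by ring, Function.iterate_succ_apply,
        Function.iterate_succ_apply, hnx2, ih, Function.iterate_succ_apply]
  -- A parent is two steps away in the incidence graph, so `h` drops by 2. Floor division by 2 turns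
  -- this into a drop by 1 whatever the parity of `h`.
  refine ⟨⟨fun v => top (up v), fun v i j => (β (α v i).1 j).1, fun v => h (.inl v) / 2,
    ?_, ?_, ?_, ?_, ?_, ?_⟩⟩
  · intro v i j
    simp only [hup_child, htop_α]
  · intro v i j i' j' hij
    have h3 := hup_child v i j
    have h4 := hup_child v i' j'
    rw [hij] at h3
    have : i = i' := (α v).injective (Subtype.ext (h3.symm.trans h4))
    subst this
    exact ⟨rfl, (β _).injective (Subtype.ext hij)⟩
  · intro w
    obtain ⟨i, hi⟩ := (α (top (up w))).surjective ⟨up w, htopm _, (hne2 _).symm⟩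
    obtain ⟨j, hj⟩ := (β (up w)).surjective ⟨w, hupm _, (hne1 _).symm⟩
    refine ⟨i, j, ?_⟩
    have : (α (top (up w)) i).1 = up w := by rw [hi]
    rw [this, hj]
  · intro v
    simp only [hh2, hh1]
    omega
  · intro v w
    have hpar : ∀ n v, h (nx^[n] v) = h v - n := by
      intro n
      induction n with
      | zero => intro v; simp
      | succ n ih => intro v; rw [Function.iterate_succ_apply, ih, hht]; push_cast; ring
    obtain ⟨m, n, hmn⟩ := hconf (.inl v) (.inl w)
    -- Steps alternate between vertices and hyperedges, so two orbits started at vertices meet after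
    -- step counts of equal parity. If both are odd, one further step brings the meeting point to a
    -- vertex.
    have hside : ∀ (n : ℕ) (x : V ⊕ H.edgeSet), (nx^[n] x).isLeft = (x.isLeft ^^ (n % 2 == 1)) := by
      intro n
      induction n with
      | zero => intro x; simp
      | succ n ih =>
        rintro (x | x)
        · rw [Function.iterate_succ_apply, ih, hup]
          rcases Nat.mod_two_eq_zero_or_one n with h | h <;> simp [h, Nat.add_mod]
        · rw [Function.iterate_succ_apply, ih, htop]
          rcases Nat.mod_two_eq_zero_or_one n with h | h <;> simp [h, Nat.add_mod]
    have hmn2 : m % 2 = n % 2 := by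
      have h3 := hside m (.inl v)
      rw [hmn, hside] at h3
      rcases Nat.mod_two_eq_zero_or_one n with h | h <;>
        rcases Nat.mod_two_eq_zero_or_one m with h' | h' <;> simp [h, h'] at h3 ⊢
    have hex : ∃ a b, nx^[2 * a] (.inl v) = nx^[2 * b] (.inl w) := by
      rcases Nat.mod_two_eq_zero_or_one m with h | h
      · refine ⟨m / 2, n / 2, ?_⟩
        rw [show 2 * (m / 2) = m by omega, show 2 * (n / 2) = n by omega, hmn]
      · refine ⟨(m + 1) / 2, (n + 1) / 2, ?_⟩
        rw [show 2 * ((m + 1) / 2) = m + 1 by omega, show 2 * ((n + 1) / 2) = n + 1 by omega,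
          Function.iterate_succ_apply', hmn, Function.iterate_succ_apply']
    obtain ⟨a, b, hab⟩ := hex
    rw [hiter, hiter] at hab
    exact ⟨a, b, Sum.inl_injective hab⟩
  · have hedge : ∀ v i, insert v (Set.range fun j => (β (α v i).1 j).1) = ((α v i).1 : Set V) := by
      intro v i
      ext x
      constructor
      · rintro (rfl | ⟨j, rfl⟩)
        · exact (α x i).2.1
        · exact (β (α v i).1 j).2.1
      · intro hx
        by_cases hxv : x = v
        · exact Or.inl hxv
        · obtain ⟨j, hj⟩ := (β (α v i).1).surjective ⟨x, hx, by rw [htop_α]; exact hxv⟩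
          exact Or.inr ⟨j, by simp only [hj]⟩
    intro e
    constructor
    · intro he
      obtain ⟨i, hi⟩ := (α (top ⟨e, he⟩)).surjective ⟨⟨e, he⟩, htopm _, (hne2 _).symm⟩
      exact ⟨top ⟨e, he⟩, i, by rw [hedge, hi]⟩
    · rintro ⟨v, i, rfl⟩
      rw [hedge]
      exact (α v i).1.2

end Hypergraph

/-! ### Hyperedges and finite subtrees in terms of parents and heights. -/

noncomputable section

/-- A finite set of vertices that is a hyperedge. -/
def Hypergraph.IsEdge {V : Type*} (H : Hypergraph V) (e : Finset V) : Prop :=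
  (e : Set V) ∈ H.edgeSet

namespace Hypergraph.EndStructure

open scoped Classical

variable {V : Type*} {H : Hypergraph V} {k d : ℕ} (S : H.EndStructure k d)

/-- The `i`-th downward hyperedge at `v`. -/
def edge (v : V) (i : Fin d) : Finset V := insert v (Finset.univ.image (S.child v i))

/-- The index of the hyperedge joining `w` to its parent. -/
def idx (w : V) : Fin d := (S.exists_child w).choose

/-- The index of `w` among its siblings in the hyperedge joining it to its parent. -/
def jdx (w : V) : Fin k := (S.exists_child w).choose_spec.choose

@[simp] theorem child_idx (w : V) : S.child (S.par w) (S.idx w) (S.jdx w) = w :=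
  (S.exists_child w).choose_spec.choose_spec

@[simp] theorem par_child' (v : V) (i : Fin d) (j : Fin k) : S.par (S.child v i j) = v :=
  S.par_child v i j

theorem idx_jdx_child (v : V) (i : Fin d) (j : Fin k) :
    S.idx (S.child v i j) = i ∧ S.jdx (S.child v i j) = j := by
  have h := S.child_idx (S.child v i j)
  rw [par_child'] at h
  exact S.child_inj _ _ _ _ _ h

@[simp] theorem idx_child (v : V) (i : Fin d) (j : Fin k) : S.idx (S.child v i j) = i :=
  (S.idx_jdx_child v i j).1

@[simp] theorem jdx_child (v : V) (i : Fin d) (j : Fin k) : S.jdx (S.child v i j) = j :=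
  (S.idx_jdx_child v i j).2

theorem ext_of_par {w w' : V} (h : S.par w = S.par w') (hi : S.idx w = S.idx w')
    (hj : S.jdx w = S.jdx w') : w = w' := by
  rw [← S.child_idx w, ← S.child_idx w', h, hi, hj]

theorem mem_edge {x v : V} {i : Fin d} :
    x ∈ S.edge v i ↔ x = v ∨ (S.par x = v ∧ S.idx x = i) := by
  simp only [edge, Finset.mem_insert, Finset.mem_image, Finset.mem_univ, true_and]
  constructor
  · rintro (h | ⟨j, rfl⟩)
    · exact Or.inl h
    · exact Or.inr ⟨by simp, by simp⟩
  · rintro (h | ⟨rfl, rfl⟩)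
    · exact Or.inl h
    · exact Or.inr ⟨S.jdx x, by simp⟩

theorem isEdge_iff {e : Finset V} : H.IsEdge e ↔ ∃ v i, e = S.edge v i := by
  simp only [IsEdge, S.mem_edgeSet, ← Finset.coe_inj (s₁ := e), edge, Finset.coe_insert,
    Finset.coe_image, Finset.coe_univ, Set.image_univ]

theorem isEdge_edge (v : V) (i : Fin d) : H.IsEdge (S.edge v i) := S.isEdge_iff.2 ⟨v, i, rfl⟩

include S in
theorem mem_edgeSet_iff {e : Set V} : e ∈ H.edgeSet ↔ ∃ f : Finset V, H.IsEdge f ∧ (f : Set V) = e := by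
  constructor
  · intro he
    obtain ⟨v, i, rfl⟩ := (S.mem_edgeSet e).1 he
    exact ⟨S.edge v i, S.isEdge_edge v i, by simp [edge]⟩
  · rintro ⟨f, hf, rfl⟩
    exact hf

include S in
theorem adj_iff {x y : V} : H.Adj x y ↔ ∃ e, H.IsEdge e ∧ x ∈ e ∧ y ∈ e := by
  constructor
  · rintro ⟨e, he, hx, hy⟩
    obtain ⟨f, hf, rfl⟩ := S.mem_edgeSet_iff.1 he
    exact ⟨f, hf, hx, hy⟩
  · rintro ⟨e, he, hx, hy⟩
    exact ⟨e, he, hx, hy⟩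

/-- The hyperedge joining `w` to its parent. -/
def up (w : V) : Finset V := S.edge (S.par w) (S.idx w)

theorem mem_up (w : V) : w ∈ S.up w := S.mem_edge.2 (Or.inr ⟨rfl, rfl⟩)

theorem par_mem_up (w : V) : S.par w ∈ S.up w := S.mem_edge.2 (Or.inl rfl)

theorem isEdge_up (w : V) : H.IsEdge (S.up w) := S.isEdge_edge _ _

theorem par_ne (w : V) : S.par w ≠ w := by
  intro h
  have := S.ht_par w
  rw [h] at this
  omega

theorem edge_inj (hk : 1 ≤ k) {v v' : V} {i i' : Fin d} (h : S.edge v i = S.edge v' i') :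
    v = v' ∧ i = i' := by
  have h1 : S.child v i ⟨0, hk⟩ ∈ S.edge v' i' := h ▸ S.mem_edge.2 (by simp)
  have h2 : S.child v' i' ⟨0, hk⟩ ∈ S.edge v i := h ▸ S.mem_edge.2 (by simp)
  have e1 := S.ht_par (S.child v i ⟨0, hk⟩)
  have e2 := S.ht_par (S.child v' i' ⟨0, hk⟩)
  rw [mem_edge] at h1 h2
  simp only [par_child', idx_child] at h1 h2 e1 e2
  rcases h1 with h1 | h1
  · rcases h2 with h2 | h2
    · rw [h1] at e1; rw [h2] at e2; omega
    · exact ⟨h2.1.symm, h2.2.symm⟩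
  · exact h1

/-- The hyperedges at `v`. -/
def edgesAt (v : V) : Finset (Finset V) := insert (S.up v) (Finset.univ.image (S.edge v))

theorem mem_edgesAt {v : V} {e : Finset V} : e ∈ S.edgesAt v ↔ H.IsEdge e ∧ v ∈ e := by
  simp only [edgesAt, Finset.mem_insert, Finset.mem_image, Finset.mem_univ, true_and]
  constructor
  · rintro (rfl | ⟨i, rfl⟩)
    · exact ⟨S.isEdge_up v, S.mem_up v⟩
    · exact ⟨S.isEdge_edge v i, S.mem_edge.2 (Or.inl rfl)⟩
  · rintro ⟨he, hv⟩
    obtain ⟨a, i, rfl⟩ := S.isEdge_iff.1 he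
    rcases S.mem_edge.1 hv with rfl | ⟨rfl, rfl⟩
    · exact Or.inr ⟨i, rfl⟩
    · exact Or.inl rfl

theorem up_ne_edge (hk : 1 ≤ k) (v : V) (i : Fin d) : S.up v ≠ S.edge v i := fun h =>
  S.par_ne v (S.edge_inj hk h).1

theorem prod_edgesAt {M : Type*} [CommMonoid M] (hk : 1 ≤ k) (v : V) (f : Finset V → M) :
    ∏ e ∈ S.edgesAt v, f e = f (S.up v) * ∏ i, f (S.edge v i) := by
  rw [edgesAt, Finset.prod_insert, Finset.prod_image]
  · intro i _ j _ h
    exact (S.edge_inj hk h).2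
  · simp only [Finset.mem_image, Finset.mem_univ, true_and, not_exists]
    exact fun i h => S.up_ne_edge hk v i h.symm

theorem card_edgesAt (hk : 1 ≤ k) (v : V) : #(S.edgesAt v) = d + 1 := by
  have := S.prod_edgesAt hk v (fun _ => Multiplicative.ofAdd 1)
  have h2 := congrArg Multiplicative.toAdd this
  simpa [add_comm] using h2

include S in
theorem card_edge_erase {e : Finset V} {v : V} (he : H.IsEdge e) (hv : v ∈ e) :
    #(e.erase v) = k := by
  obtain ⟨a, i, rfl⟩ := S.isEdge_iff.1 he
  rw [Finset.card_erase_of_mem hv, edge, Finset.card_insert_of_notMem, Finset.card_image_of_injective]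
  · simp
  · intro j j' h
    exact (S.child_inj _ _ _ _ _ h).2
  · simp only [Finset.mem_image, Finset.mem_univ, true_and, not_exists]
    intro j hj
    apply S.par_ne a
    conv_lhs => rw [← hj]
    simp

include S in
-- Of two vertices in a hyperedge, either one is the parent of the other or they are siblings with
-- the same index. In both cases the pair determines the top and the index of the hyperedge.
theorem isEdge_eq_of_mem {e f : Finset V} (he : H.IsEdge e) (hf : H.IsEdge f) {x y : V}
    (hxy : x ≠ y) (hx : x ∈ e) (hy : y ∈ e) (hx' : x ∈ f) (hy' : y ∈ f) : e = f := by
  obtain ⟨a, i, rfl⟩ := S.isEdge_iff.1 he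
  obtain ⟨b, j, rfl⟩ := S.isEdge_iff.1 hf
  rw [mem_edge] at *
  have e1 := S.ht_par x
  have e2 := S.ht_par y
  grind

/-- `T` is a finite subtree with topmost vertex `t`: it contains the whole upward hyperedge of each
of its vertices other than `t`. -/
def IsTop (T : Finset V) (t : V) : Prop := t ∈ T ∧ ∀ w ∈ T, w ≠ t → S.up w ⊆ T

/-- Finite subtrees: nonempty connected unions of hyperedges, and single vertices. -/
def IsSubtree (T : Finset V) : Prop := ∃ t, S.IsTop T t

variable {S}

/-- A vertex of least height in `T` other than `t` would have its parent, which is lower still, in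
`T`. -/
theorem IsTop.ht_le {T : Finset V} {t : V} (hT : S.IsTop T t) {w : V} (hw : w ∈ T) :
    S.ht t ≤ S.ht w := by
  obtain ⟨m, hm, hmin⟩ := T.exists_min_image S.ht ⟨t, hT.1⟩
  by_cases h : m = t
  · rw [← h]; exact hmin w hw
  · have h1 := hT.2 m hm h (S.par_mem_up m)
    have h2 := hmin _ h1
    rw [S.ht_par] at h2
    omega

theorem IsTop.par_notMem {T : Finset V} {t : V} (hT : S.IsTop T t) : S.par t ∉ T := by
  intro h
  have := hT.ht_le h
  rw [S.ht_par] at this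
  omega

theorem isTop_singleton (v : V) : S.IsTop {v} v := by
  refine ⟨by simp, fun w hw h => absurd (by simpa using hw) h⟩

theorem isSubtree_singleton (v : V) : S.IsSubtree {v} := ⟨v, isTop_singleton v⟩

/-- One of the two vertices is neither the top of the hyperedge nor the top `t` of `T`, so the
hyperedge is its upward one. The delicate case is `t` lying below the top `a` of the hyperedge; then
`a` is the parent of `t` and is not in `T`. -/
theorem IsSubtree.edge_subset {T : Finset V} (hT : S.IsSubtree T) {e : Finset V}
    (he : H.IsEdge e) {x y : V} (hxy : x ≠ y) (hx : x ∈ e) (hy : y ∈ e) (hx' : x ∈ T)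
    (hy' : y ∈ T) : e ⊆ T := by
  obtain ⟨t, ht⟩ := hT
  obtain ⟨a, i, rfl⟩ := S.isEdge_iff.1 he
  have key : ∀ z, z ∈ S.edge a i → z ∈ T → z ≠ a → z ≠ t → S.edge a i ⊆ T := by
    intro z hz hzT hza hzt
    rcases S.mem_edge.1 hz with h | ⟨rfl, rfl⟩
    · exact absurd h hza
    · exact ht.2 z hzT hzt
  have hta : t ∈ S.edge a i → t ≠ a → a ∉ T := by
    intro h1 h2 h3
    rcases S.mem_edge.1 h1 with h | ⟨rfl, rfl⟩
    · exact h2 h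
    · exact ht.par_notMem h3
  by_cases h1 : x = a
  · subst h1
    refine key y hy hy' (Ne.symm hxy) ?_
    rintro rfl
    exact hta hy (Ne.symm hxy) hx'
  · by_cases h2 : x = t
    · subst h2
      have hya : y ≠ a := by rintro rfl; exact hta hx h1 hy'
      exact key y hy hy' hya (Ne.symm hxy)
    · exact key x hx hx' h1 h2

theorem IsSubtree.inter_eq {T : Finset V} (hT : S.IsSubtree T) {e : Finset V}
    (he : H.IsEdge e) {v : V} (hv : v ∈ e) (hvT : v ∈ T) (h : ¬ e ⊆ T) : e ∩ T = {v} := by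
  ext x
  simp only [Finset.mem_inter, Finset.mem_singleton]
  constructor
  · rintro ⟨h1, h2⟩
    by_contra hx
    exact h (hT.edge_subset he hx h1 hv h2 hvT)
  · rintro rfl
    exact ⟨hv, hvT⟩

/-- Acyclicity: having left `T` through `e`, one cannot return through another hyperedge `f` at the
outer vertex `u`. This is what makes the branches hanging off a subtree independent of each other.
-/
theorem IsSubtree.notMem_of_mem {T : Finset V} (hT : S.IsSubtree T) {e f : Finset V}
    (he : H.IsEdge e) (hf : H.IsEdge f) {v u y : V} (hv : v ∈ e) (hvT : v ∈ T) (hu : u ∈ e)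
    (huT : u ∉ T) (huf : u ∈ f) (hef : f ≠ e) (hy : y ∈ f) : y ∉ T := by
  intro hyT
  obtain ⟨t, ht⟩ := hT
  obtain ⟨a, i, rfl⟩ := S.isEdge_iff.1 he
  obtain ⟨b, j, rfl⟩ := S.isEdge_iff.1 hf
  have e1 := S.ht_par v
  have e2 := S.ht_par u
  have e3 := S.ht_par y
  have e4 := S.ht_par t
  have i1 := ht.ht_le hvT
  have i2 := ht.ht_le hyT
  have key : ∀ z ∈ T, S.par z ∉ T → z = t := by
    intro z hz hz'
    by_contra hzt
    exact hz' (ht.2 z hz hzt (S.par_mem_up z))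
  have k1 := key v hvT
  have k2 := key y hyT
  rw [mem_edge] at *
  grind

/-- If `e` hangs below its attaching vertex, the top of `T` remains the top. Otherwise the attaching
vertex has to be the top of `T`, and the top of `e` becomes the new one. -/
theorem IsSubtree.union_edge {T : Finset V} (hT : S.IsSubtree T) {e : Finset V}
    (he : H.IsEdge e) {v : V} (h : e ∩ T = {v}) : S.IsSubtree (T ∪ e) := by
  obtain ⟨t, ht⟩ := hT
  have hve : v ∈ e ∧ v ∈ T := by
    have : v ∈ e ∩ T := by simp [h]
    simpa using this
  obtain ⟨a, i, rfl⟩ := S.isEdge_iff.1 he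
  have hup : ∀ w ∈ S.edge a i, w ≠ a → S.up w = S.edge a i := by
    intro w hw hwa
    rcases S.mem_edge.1 hw with h | ⟨rfl, rfl⟩
    · exact absurd h hwa
    · rfl
  by_cases hva : v = a
  · refine ⟨t, by simp [ht.1], fun w hw hwt => ?_⟩
    by_cases hwT : w ∈ T
    · exact (ht.2 w hwT hwt).trans Finset.subset_union_left
    · have hwe : w ∈ S.edge a i := by simpa [hwT] using hw
      rw [hup w hwe (by rintro rfl; exact hwT (hva ▸ hve.2))]
      exact Finset.subset_union_right
  · have hae : a ∈ S.edge a i := S.mem_edge.2 (Or.inl rfl)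
    have haT : a ∉ T := by
      intro haT
      have : a ∈ S.edge a i ∩ T := by simp [hae, haT]
      rw [h] at this
      rw [Finset.mem_singleton] at this
      exact hva this.symm
    have hvt : v = t := by
      by_contra hvt
      have := ht.2 v hve.2 hvt
      rw [hup v hve.1 hva] at this
      exact haT (this hae)
    refine ⟨a, by simp [hae], fun w hw hwa => ?_⟩
    by_cases hwe : w ∈ S.edge a i
    · rw [hup w hwe hwa]
      exact Finset.subset_union_right
    · have hwT : w ∈ T := by simpa [hwe] using hw
      refine (ht.2 w hwT ?_).trans Finset.subset_union_left
      rintro rfl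
      exact hwe (hvt ▸ hve.1)

theorem IsTop.exists_edge {T T' : Finset V} {t : V} (hT : S.IsTop T t) (hT' : S.IsTop T' t)
    (h : T ⊂ T') : ∃ v i, S.edge v i ∩ T = {v} ∧ S.edge v i ⊆ T' := by
  have hne : (T' \ T).Nonempty := Finset.sdiff_nonempty.2 h.2
  -- A vertex of least height among the missing ones has its parent in `T`.
  obtain ⟨w, hw, hmin⟩ := (T' \ T).exists_min_image S.ht hne
  rw [Finset.mem_sdiff] at hw
  have hwt : w ≠ t := by rintro rfl; exact hw.2 hT.1
  have hup := hT'.2 w hw.1 hwt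
  have hpar : S.par w ∈ T := by
    by_contra hp
    have := hmin (S.par w) (Finset.mem_sdiff.2 ⟨hup (S.par_mem_up w), hp⟩)
    rw [S.ht_par] at this
    omega
  refine ⟨S.par w, S.idx w, ?_, hup⟩
  exact IsSubtree.inter_eq ⟨t, hT⟩ (S.isEdge_up w) (S.par_mem_up w) hpar
    fun h => hw.2 (h (S.mem_up w))

theorem IsSubtree.exists_edge {T T' : Finset V} (hT : S.IsSubtree T) (hT' : S.IsSubtree T')
    (h : T ⊂ T') : ∃ e v, H.IsEdge e ∧ e ∩ T = {v} ∧ e ⊆ T' := by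
  obtain ⟨t, ht⟩ := hT
  obtain ⟨t', ht'⟩ := hT'
  by_cases htt : t = t'
  · subst htt
    obtain ⟨v, i, h1, h2⟩ := ht.exists_edge ht' h
    exact ⟨_, v, S.isEdge_edge v i, h1, h2⟩
  · refine ⟨S.up t, t, S.isEdge_up t, ?_, ht'.2 t (h.1 ht.1) htt⟩
    exact IsSubtree.inter_eq ⟨t, ht⟩ (S.isEdge_up t) (S.mem_up t) ht.1
      fun h => ht.par_notMem (h (S.par_mem_up t))

include S in
theorem card_sdiff_union_lt {T T' e : Finset V} {v : V} (hk : 1 ≤ k) (he : H.IsEdge e)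
    (h : e ∩ T = {v}) (h' : e ⊆ T') : #(T' \ (T ∪ e)) < #(T' \ T) := by
  have hve : v ∈ e := by
    have : v ∈ e ∩ T := by simp [h]
    exact (Finset.mem_inter.1 this).1
  have hc := S.card_edge_erase he hve
  obtain ⟨u, hu⟩ : (e.erase v).Nonempty := by rw [← Finset.card_pos]; omega
  rw [Finset.mem_erase] at hu
  apply Finset.card_lt_card
  refine ⟨Finset.sdiff_subset_sdiff le_rfl Finset.subset_union_left, fun hsub => ?_⟩
  have huT : u ∉ T := by
    intro huT
    have : u ∈ e ∩ T := by simp [hu.2, huT]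
    rw [h] at this
    exact hu.1 (by simpa using this)
  have := hsub (Finset.mem_sdiff.2 ⟨h' hu.2, huT⟩)
  simp [hu.2] at this

/-- Downward induction along subtrees, removing one hyperedge at a time. -/
theorem IsSubtree.down_induction (hk : 1 ≤ k) {Q : Finset V → Prop} {T' : Finset V}
    (hT' : S.IsSubtree T') (h0 : Q T')
    (hstep : ∀ T e v, S.IsSubtree T → H.IsEdge e → e ∩ T = {v} → T ∪ e ⊆ T' → Q (T ∪ e) → Q T)
    {T : Finset V} (hT : S.IsSubtree T) (h : T ⊆ T') : Q T := by
  induction hn : #(T' \ T) using Nat.strong_induction_on generalizing T with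
  | _ n ih =>
    rcases h.eq_or_ssubset with rfl | hss
    · exact h0
    · obtain ⟨e, v, he, hev, heT⟩ := hT.exists_edge hT' hss
      have hsub := Finset.union_subset h heT
      refine hstep T e v hT he hev hsub (ih _ ?_ (hT.union_edge he hev) hsub rfl)
      rw [← hn]
      exact card_sdiff_union_lt (S := S) hk he hev heT

/-- Upward induction along subtrees, adding one downward hyperedge at a time. -/
theorem IsTop.up_induction (hk : 1 ≤ k) {Q : Finset V → Prop} {t : V} (h0 : Q {t})
    (hstep : ∀ T v i, S.IsSubtree T → S.edge v i ∩ T = {v} → Q T → Q (T ∪ S.edge v i))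
    {T' : Finset V} (hT' : S.IsTop T' t) : Q T' := by
  suffices h : ∀ n T, S.IsTop T t → T ⊆ T' → #(T' \ T) = n → Q T → Q T' from
    h _ {t} (isTop_singleton t) (by simpa using hT'.1) rfl h0
  intro n
  induction n using Nat.strong_induction_on with
  | _ n ih =>
    intro T hT hsub hn hQ
    rcases hsub.eq_or_ssubset with rfl | hss
    · exact hQ
    · obtain ⟨v, i, hv, he⟩ := hT.exists_edge hT' hss
      have hve : v ∈ T := by
        have : v ∈ S.edge v i ∩ T := by simp [hv]
        exact (Finset.mem_inter.1 this).2
      have htop : S.IsTop (T ∪ S.edge v i) t := by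
        refine ⟨by simp [hT.1], fun w hw hwt => ?_⟩
        by_cases hwT : w ∈ T
        · exact (hT.2 w hwT hwt).trans Finset.subset_union_left
        · have hwe : w ∈ S.edge v i := by simpa [hwT] using hw
          rcases S.mem_edge.1 hwe with rfl | ⟨rfl, rfl⟩
          · exact absurd hve hwT
          · exact Finset.subset_union_right
      refine ih _ ?_ _ htop (Finset.union_subset hsub he) rfl (hstep T v i ⟨t, hT⟩ hv hQ)
      rw [← hn]
      exact card_sdiff_union_lt (S := S) hk (S.isEdge_edge v i) hv he

variable (S) in
/-- The union of all hyperedges that meet `T`. -/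
def hull (T : Finset V) : Finset V := T.biUnion fun v => (S.edgesAt v).biUnion id

theorem mem_hull {T : Finset V} {x : V} :
    x ∈ S.hull T ↔ ∃ v ∈ T, ∃ e, H.IsEdge e ∧ v ∈ e ∧ x ∈ e := by
  simp only [hull, Finset.mem_biUnion, mem_edgesAt, id, and_assoc]

theorem subset_hull (T : Finset V) : T ⊆ S.hull T := fun v hv =>
  mem_hull.2 ⟨v, hv, S.up v, S.isEdge_up v, S.mem_up v, S.mem_up v⟩

theorem edge_subset_hull {T : Finset V} {v : V} (hv : v ∈ T) {e : Finset V} (he : H.IsEdge e)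
    (hve : v ∈ e) : e ⊆ S.hull T := fun _ hx => mem_hull.2 ⟨v, hv, e, he, hve, hx⟩

theorem hull_mono {T T' : Finset V} (h : T ⊆ T') : S.hull T ⊆ S.hull T' := fun x hx => by
  obtain ⟨v, hv, e, he⟩ := mem_hull.1 hx
  exact mem_hull.2 ⟨v, h hv, e, he⟩

theorem IsSubtree.hull {T : Finset V} (hT : S.IsSubtree T) : S.IsSubtree (S.hull T) := by
  obtain ⟨t, ht⟩ := hT
  refine ⟨S.par t, edge_subset_hull ht.1 (S.isEdge_up t) (S.mem_up t) (S.par_mem_up t),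
    fun w hw hwt => ?_⟩
  obtain ⟨v, hv, e, he, hve, hwe⟩ := mem_hull.1 hw
  by_cases hwT : w ∈ T
  · exact edge_subset_hull hwT (S.isEdge_up w) (S.mem_up w)
  obtain ⟨a, i, rfl⟩ := S.isEdge_iff.1 he
  rcases S.mem_edge.1 hwe with rfl | ⟨rfl, rfl⟩
  · exfalso
    rcases S.mem_edge.1 hve with rfl | ⟨rfl, rfl⟩
    · exact hwT hv
    · have hvt : v ≠ t := by rintro rfl; exact hwt rfl
      exact hwT (ht.2 v hv hvt (S.par_mem_up v))
  · exact edge_subset_hull hv he hve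

variable (S) in
/-- An exhausting sequence of finite subtrees. -/
def ballAt (o : V) (n : ℕ) : Finset V := S.hull^[n] {o}

theorem ballAt_succ (o : V) (n : ℕ) : S.ballAt o (n + 1) = S.hull (S.ballAt o n) :=
  Function.iterate_succ_apply' _ _ _

theorem isSubtree_ballAt (o : V) (n : ℕ) : S.IsSubtree (S.ballAt o n) := by
  induction n with
  | zero => exact isSubtree_singleton o
  | succ n ih => rw [ballAt_succ]; exact ih.hull

theorem ballAt_mono (o : V) : Monotone (S.ballAt o) :=
  monotone_nat_of_le_succ fun n => by rw [ballAt_succ]; exact subset_hull _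

/-- Climb from `o` to a common ancestor with `v`, then descend; each level costs one application of
`hull`. -/
theorem exists_mem_ballAt (o v : V) : ∃ n, v ∈ S.ballAt o n := by
  have h1 : ∀ m, S.par^[m] o ∈ S.ballAt o m := by
    intro m
    induction m with
    | zero => simp [ballAt]
    | succ m ih =>
      rw [ballAt_succ, Function.iterate_succ_apply']
      exact edge_subset_hull ih (S.isEdge_up _) (S.mem_up _) (S.par_mem_up _)
  obtain ⟨m, n, hmn⟩ := S.confluent v o
  have h2 : ∀ m v, S.par^[m] v ∈ S.ballAt o n → v ∈ S.ballAt o (n + m) := by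
    intro m
    induction m with
    | zero => intro v h; simpa using h
    | succ m ih =>
      intro v hv
      rw [Function.iterate_succ_apply] at hv
      rw [← add_assoc, ballAt_succ]
      exact edge_subset_hull (ih _ hv) (S.isEdge_up v) (S.par_mem_up v) (S.mem_up v)
  exact ⟨n + m, h2 m v (hmn ▸ h1 n)⟩

theorem exists_subset_ballAt (o : V) (F : Finset V) : ∃ n, F ⊆ S.ballAt o n := by
  choose n hn using S.exists_mem_ballAt o
  refine ⟨F.sup n, fun v hv => ballAt_mono o (Finset.le_sup hv) (hn v)⟩

variable (S) in
include S in
theorem countable : Countable V := by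
  rcases isEmpty_or_nonempty V with h | ⟨⟨o⟩⟩
  · infer_instance
  · rw [← Set.countable_univ_iff]
    have : (Set.univ : Set V) = ⋃ n, (S.ballAt o n : Set V) := by
      ext v
      simpa using S.exists_mem_ballAt o v
    rw [this]
    exact Set.countable_iUnion fun n => (S.ballAt o n).countable_toSet

end Hypergraph.EndStructure

end

/-! ### Automorphisms that fix the end. -/

noncomputable section

namespace Hypergraph.EndStructure

open scoped Classical

variable {V : Type*} {H : Hypergraph V} {k d : ℕ} {S : H.EndStructure k d}

theorem ht_iterate (n : ℕ) (v : V) : S.ht (S.par^[n] v) = S.ht v - n := by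
  induction n with
  | zero => simp
  | succ n ih => rw [Function.iterate_succ_apply', S.ht_par, ih]; push_cast; ring

/-- The ancestral line of `u` is carried to that of `v`. Every other vertex follows by climbing to
this line and descending again with child labels permuted in a way that depends only on the height;
`hσ` and `hρ` make the labels on the two lines match. -/
theorem exists_translation_aux (u v : V) (σ : ℤ → Equiv.Perm (Fin d)) (ρ : ℤ → Equiv.Perm (Fin k))
    (hσ : ∀ m : ℕ, σ (S.ht u - m) (S.idx (S.par^[m] u)) = S.idx (S.par^[m] v))
    (hρ : ∀ m : ℕ, ρ (S.ht u - m) (S.jdx (S.par^[m] u)) = S.jdx (S.par^[m] v)) :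
    ∃ g : V → V, g u = v ∧ ∀ w, S.par (g w) = g (S.par w) ∧ S.idx (g w) = σ (S.ht w) (S.idx w) ∧
      S.jdx (g w) = ρ (S.ht w) (S.jdx w) := by
  -- `F m n w` is the image of `w` computed from the assumption that its `n`-th ancestor is the
  -- `m`-th ancestor of `u`. By `hadd` the answer is the same for higher common ancestors.
  let F : ℕ → ℕ → V → V := fun m n => Nat.rec (motive := fun _ => V → V) (fun _ => S.par^[m] v)
    (fun _ f w => S.child (f (S.par w)) (σ (S.ht w) (S.idx w)) (ρ (S.ht w) (S.jdx w))) n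
  have hF0 : ∀ m w, F m 0 w = S.par^[m] v := fun _ _ => rfl
  have hFs : ∀ m n w, F m (n + 1) w =
      S.child (F m n (S.par w)) (σ (S.ht w) (S.idx w)) (ρ (S.ht w) (S.jdx w)) := fun _ _ _ => rfl
  clear_value F
  have hsucc : ∀ n m w, S.par^[n] w = S.par^[m] u → F (m + 1) (n + 1) w = F m n w := by
    intro n
    induction n with
    | zero =>
      intro m w h
      rw [Function.iterate_zero, id] at h
      rw [hFs, hF0, hF0, h, ht_iterate, hσ, hρ, Function.iterate_succ_apply', child_idx]
    | succ n ih =>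
      intro m w h
      rw [hFs (m + 1), ih m (S.par w) (by rw [← h, Function.iterate_succ_apply]), hFs]
  have hadd : ∀ j n m w, S.par^[n] w = S.par^[m] u → F (m + j) (n + j) w = F m n w := by
    intro j
    induction j with
    | zero => intros; rfl
    | succ j ih =>
      intro n m w h
      rw [← add_assoc, ← add_assoc, hsucc, ih n m w h]
      rw [add_comm n, add_comm m, Function.iterate_add_apply, h, Function.iterate_add_apply]
  choose n m hnm using fun w => S.confluent w u
  have hg : ∀ w n' m', S.par^[n'] w = S.par^[m'] u → F (m w) (n w) w = F m' n' w := by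
    intro w n' m' h
    have h1 := congrArg S.ht h
    have h2 := congrArg S.ht (hnm w)
    simp only [ht_iterate] at h1 h2
    rcases le_total (m w) m' with hm | hm
    · obtain ⟨j, hj⟩ := Nat.exists_eq_add_of_le hm
      rw [hj, show n' = n w + j by omega, hadd _ _ _ _ (hnm w)]
    · obtain ⟨j, hj⟩ := Nat.exists_eq_add_of_le hm
      rw [hj, show n w = n' + j by omega, hadd _ _ _ _ h]
  refine ⟨fun w => F (m w) (n w) w, ?_, ?_⟩
  · exact (hg u 0 0 rfl).trans (hF0 _ _)
  · intro w
    have h1 : S.par^[n w + 1] w = S.par^[m w + 1] u := by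
      rw [Function.iterate_succ_apply', hnm, Function.iterate_succ_apply']
    simp only
    rw [hg w _ _ h1, hFs, hg (S.par w) (n w) (m w + 1) (by rw [← Function.iterate_succ_apply, h1])]
    simp

/-- All ancestors of `u` are fixed, and a vertex is recovered from its parent and labels. This is
used to see that two translations are inverse to each other. -/
theorem eq_self_of_commute {g : V → V} {u : V} (hu : g u = u) (hg : ∀ w, S.par (g w) = g (S.par w) ∧
    S.idx (g w) = S.idx w ∧ S.jdx (g w) = S.jdx w) (w : V) : g w = w := by
  obtain ⟨n, m, hnm⟩ := S.confluent w u
  have hm : g (S.par^[m] u) = S.par^[m] u := by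
    clear hnm
    induction m with
    | zero => exact hu
    | succ m ih => rw [Function.iterate_succ_apply', ← (hg _).1, ih]
  induction n generalizing w with
  | zero =>
    have h : w = S.par^[m] u := hnm
    rw [h]; exact hm
  | succ n ih =>
    rw [Function.iterate_succ_apply] at hnm
    refine S.ext_of_par ?_ (hg w).2.1 (hg w).2.2
    rw [(hg w).1, ih _ hnm]

theorem ht_sub_eq_of_commute {g : V → V} (hg : ∀ w, S.par (g w) = g (S.par w)) (v w : V) :
    S.ht (g w) - S.ht w = S.ht (g v) - S.ht v := by
  have hit : ∀ n w, S.par^[n] (g w) = g (S.par^[n] w) := by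
    intro n
    induction n with
    | zero => intro w; rfl
    | succ n ih => intro w; rw [Function.iterate_succ_apply, hg, ih, Function.iterate_succ_apply]
  obtain ⟨n, m, hnm⟩ := S.confluent w v
  have h1 := congrArg S.ht hnm
  have h2 := congrArg S.ht (congrArg g hnm)
  rw [← hit, ← hit] at h2
  simp only [ht_iterate] at h1 h2
  omega

variable (S) in
/-- Any vertex can be moved to any other by an automorphism that fixes the end. -/
theorem exists_translation (u v : V) :
    ∃ g ∈ H.aut, g u = v ∧ ∀ w, S.par (g w) = g (S.par w) := by
  -- At each height, transpose the label on the line of `u` with the one on the line of `v`; `toNat`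
  -- recovers `m` from the height `S.ht u - m`.
  obtain ⟨σ, hσ⟩ : ∃ σ : ℤ → Equiv.Perm (Fin d),
      ∀ m : ℕ, σ (S.ht u - m) (S.idx (S.par^[m] u)) = S.idx (S.par^[m] v) :=
    ⟨fun h => Equiv.swap (S.idx (S.par^[(S.ht u - h).toNat] u))
      (S.idx (S.par^[(S.ht u - h).toNat] v)), fun m => by simp⟩
  obtain ⟨ρ, hρ⟩ : ∃ ρ : ℤ → Equiv.Perm (Fin k),
      ∀ m : ℕ, ρ (S.ht u - m) (S.jdx (S.par^[m] u)) = S.jdx (S.par^[m] v) :=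
    ⟨fun h => Equiv.swap (S.jdx (S.par^[(S.ht u - h).toNat] u))
      (S.jdx (S.par^[(S.ht u - h).toNat] v)), fun m => by simp⟩
  obtain ⟨g, hgu, hg⟩ := exists_translation_aux u v σ ρ hσ hρ
  -- Since `g` shifts heights by `S.ht v - S.ht u`, the inverse applies the inverse permutations at
  -- heights shifted back.
  obtain ⟨g', hgu', hg'⟩ := exists_translation_aux v u
    (fun h => (σ (h - S.ht v + S.ht u))⁻¹) (fun h => (ρ (h - S.ht v + S.ht u))⁻¹)
    (fun m => by
      rw [Equiv.Perm.inv_eq_iff_eq, show S.ht v - m - S.ht v + S.ht u = S.ht u - m by ring, hσ])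
    (fun m => by
      rw [Equiv.Perm.inv_eq_iff_eq, show S.ht v - m - S.ht v + S.ht u = S.ht u - m by ring, hρ])
  have hht : ∀ w, S.ht (g w) = S.ht w - S.ht u + S.ht v := by
    intro w
    have := ht_sub_eq_of_commute (fun w => (hg w).1) u w
    rw [hgu] at this
    omega
  have hht' : ∀ w, S.ht (g' w) = S.ht w - S.ht v + S.ht u := by
    intro w
    have := ht_sub_eq_of_commute (fun w => (hg' w).1) v w
    rw [hgu'] at this
    omega
  have hl : Function.LeftInverse g' g := by
    refine eq_self_of_commute (S := S) (g := fun w => g' (g w)) (u := u) (by simp [hgu, hgu']) fun w => ?_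
    simp only [(hg' _).1, (hg' _).2.1, (hg' _).2.2, (hg _).1, (hg _).2.1, (hg _).2.2, hht, true_and]
    rw [show S.ht w - S.ht u + S.ht v - S.ht v + S.ht u = S.ht w by ring]
    simp
  have hr : Function.RightInverse g' g := by
    refine eq_self_of_commute (S := S) (g := fun w => g (g' w)) (u := v) (by simp [hgu, hgu']) fun w => ?_
    simp only [(hg' _).1, (hg' _).2.1, (hg' _).2.2, (hg _).1, (hg _).2.1, (hg _).2.2, hht', true_and]
    simp
  have himg : ∀ v i, g '' (S.edge v i) = S.edge (g v) (σ (S.ht v + 1) i) := by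
    intro v i
    have hmem : ∀ x, g x ∈ S.edge (g v) (σ (S.ht v + 1) i) ↔ x ∈ S.edge v i := by
      intro x
      rw [mem_edge, mem_edge, (hg x).1, (hg x).2.1, hl.injective.eq_iff, hl.injective.eq_iff]
      refine or_congr_right (and_congr_right fun h => ?_)
      have := S.ht_par x
      rw [h] at this
      rw [show S.ht x = S.ht v + 1 by omega, (σ _).injective.eq_iff]
    ext x
    constructor
    · rintro ⟨y, hy, rfl⟩
      exact (hmem y).2 hy
    · intro hx
      refine ⟨g' x, (hmem _).1 ?_, hr x⟩
      rw [hr x]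
      exact hx
  have huniv : ∀ v : V, v ∈ H.vertexSet := fun v =>
    H.subset_vertexSet_of_mem_edgeSet' (S.isEdge_up v) (S.mem_up v)
  refine ⟨⟨g, g', hl, hr⟩, ⟨fun v => by simp [huniv], fun e => ⟨fun he => ?_, fun he => ?_⟩⟩, hgu,
    fun w => (hg w).1⟩
  · obtain ⟨f, hf, hfe⟩ := S.mem_edgeSet_iff.1 he
    obtain ⟨a, i, rfl⟩ := S.isEdge_iff.1 hf
    have : e = S.edge (g' a) ((σ (S.ht (g' a) + 1))⁻¹ i) := by
      apply hl.injective.image_injective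
      rw [himg, hr]
      simpa using hfe.symm
    rw [this]
    exact S.isEdge_edge _ _
  · obtain ⟨f, hf, rfl⟩ := S.mem_edgeSet_iff.1 he
    obtain ⟨a, i, rfl⟩ := S.isEdge_iff.1 hf
    simp only [Equiv.coe_fn_mk]
    rw [himg]
    exact S.isEdge_edge _ _

theorem isEdge_image_iff {g : Equiv.Perm V} (hg : g ∈ H.aut) {e : Finset V} :
    H.IsEdge (e.image g) ↔ H.IsEdge e := by
  rw [IsEdge, Finset.coe_image, hg.2]
  rfl

/-- An automorphism need not fix the end, so it need not carry tops to tops. Subtrees are instead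
generated from a single vertex by attaching hyperedges, which every automorphism respects. -/
theorem IsSubtree.image (hk : 1 ≤ k) {g : Equiv.Perm V} (hg : g ∈ H.aut) {T : Finset V}
    (hT : S.IsSubtree T) : S.IsSubtree (T.image g) := by
  obtain ⟨t, ht⟩ := hT
  refine IsTop.up_induction (S := S) hk (Q := fun T => S.IsSubtree (T.image g)) ?_ ?_ ht
  · rw [Finset.image_singleton]
    exact isSubtree_singleton _
  · intro T v i _ hv hT
    rw [Finset.image_union]
    refine hT.union_edge (v := g v) ((isEdge_image_iff hg).2 (S.isEdge_edge v i)) ?_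
    rw [← Finset.image_inter _ _ g.injective, hv, Finset.image_singleton]

variable (S) in
/-- The automorphisms that fix the end and preserve the parity of the height. -/
def parityGroup : Subgroup (Equiv.Perm V) where
  carrier := {g | g ∈ H.aut ∧ ∀ w, S.par (g w) = g (S.par w) ∧ (Even (S.ht (g w)) ↔ Even (S.ht w))}
  one_mem' := ⟨one_mem _, by simp⟩
  mul_mem' := by
    rintro a b ⟨ha, ha'⟩ ⟨hb, hb'⟩
    refine ⟨mul_mem ha hb, fun w => ⟨?_, ?_⟩⟩
    · rw [Equiv.Perm.mul_apply, (ha' _).1, (hb' _).1, Equiv.Perm.mul_apply]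
    · rw [Equiv.Perm.mul_apply, (ha' _).2, (hb' _).2]
  inv_mem' := by
    rintro a ⟨ha, ha'⟩
    refine ⟨inv_mem ha, fun w => ⟨?_, ?_⟩⟩
    · apply a.injective
      rw [← (ha' _).1]
      simp
    · rw [← (ha' _).2]
      simp

theorem parityGroup_le : S.parityGroup ≤ H.aut := fun _ hg => hg.1

/-- A translation changes all heights by the same amount, so one carrying `u` to `v` preserves every
parity as soon as `u` and `v` have the same parity. -/
theorem exists_parityGroup_iff {u v : V} :
    (∃ g ∈ S.parityGroup, g u = v) ↔ (Even (S.ht u) ↔ Even (S.ht v)) := by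
  constructor
  · rintro ⟨g, hg, rfl⟩
    exact (hg.2 u).2.symm
  · intro h
    obtain ⟨g, hg, hgu, hgp⟩ := S.exists_translation u v
    refine ⟨g, ⟨hg, fun w => ⟨hgp w, ?_⟩⟩, hgu⟩
    have := ht_sub_eq_of_commute hgp u w
    rw [hgu] at this
    rw [show S.ht (g w) = S.ht w + (S.ht v - S.ht u) by omega, Int.even_add, Int.even_sub]
    tauto

theorem card_orbits_parityGroup [Nonempty V] :
    Nat.card (MulAction.orbitRel.Quotient S.parityGroup V) = 2 := by
  have hrel : ∀ u v : V, MulAction.orbitRel S.parityGroup V u v ↔ (Even (S.ht u) ↔ Even (S.ht v)) := by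
    intro u v
    rw [MulAction.orbitRel_apply, MulAction.mem_orbit_iff, iff_comm (a := Even (S.ht u)),
      ← exists_parityGroup_iff]
    exact ⟨fun ⟨g, hg⟩ => ⟨g, g.2, hg⟩, fun ⟨g, hg, h⟩ => ⟨⟨g, hg⟩, h⟩⟩
  let f : MulAction.orbitRel.Quotient S.parityGroup V → Bool :=
    Quotient.lift (fun v => decide (Even (S.ht v))) fun u v h => by
      simpa using (hrel u v).1 h
  have hf : Function.Bijective f := by
    constructor
    · intro a b
      induction a using Quotient.inductionOn with | _ a
      induction b using Quotient.inductionOn with | _ b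
      intro h
      apply Quotient.sound
      exact (hrel a b).2 (by simpa [f] using h)
    · obtain ⟨v⟩ := ‹Nonempty V›
      have hpar := S.ht_par v
      intro b
      have key : ∀ w, decide (Even (S.ht w)) = b → ∃ a, f a = b := fun w hw => ⟨Quotient.mk _ w, hw⟩
      by_cases hv : decide (Even (S.ht v)) = b
      · exact key v hv
      · apply key (S.par v)
        rw [hpar]
        rcases b <;> simp_all
  rw [Nat.card_eq_of_bijective f hf]
  simp

end Hypergraph.EndStructure

end

/-! ### The critical activity and the scalar recursion. -/

noncomputable section

/-- The threshold without division. For `d = 1` the denominator vanishes, the quotient in `ℝ≥0∞` is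
`∞`, and the real inequality reads `0 ≤ 1`. -/
theorem ofReal_le_criticalActivity_iff {k d : ℕ} (hk : 1 ≤ k) (hd : 1 ≤ d) {lam : ℝ}
    (hlam : 0 < lam) : ENNReal.ofReal lam ≤ criticalActivity k d ↔
      (k : ℝ) * lam * ((d : ℝ) - 1) ^ (d + 1) ≤ (d : ℝ) ^ d := by
  have hk0 : (0 : ℝ) < k := by exact_mod_cast hk
  obtain ⟨m, rfl⟩ : ∃ m, d = m + 1 := ⟨d - 1, by omega⟩
  have e1 : (((m + 1 : ℕ) : ℝ≥0∞) - 1) = (m : ℝ≥0∞) := by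
    push_cast
    exact ENNReal.add_sub_cancel_right ENNReal.one_ne_top
  have e2 : (((m + 1 : ℕ) : ℝ) - 1) = m := by push_cast; ring
  rw [criticalActivity, e1, e2]
  rcases Nat.eq_zero_or_pos m with rfl | hm
  · simp
  · have hm0 : (0 : ℝ) < m := by exact_mod_cast hm
    rw [ENNReal.le_div_iff_mul_le (by left; simp; omega)
      (by left; exact ENNReal.mul_ne_top (by simp) (by simp))]
    rw [show ((m + 1 : ℕ) : ℝ≥0∞) = ENNReal.ofReal ((m + 1 : ℕ) : ℝ) by
        rw [ENNReal.ofReal_natCast], show (m : ℝ≥0∞) = ENNReal.ofReal (m : ℝ) by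
        rw [ENNReal.ofReal_natCast], show (k : ℝ≥0∞) = ENNReal.ofReal (k : ℝ) by
        rw [ENNReal.ofReal_natCast], ← ENNReal.ofReal_pow (by positivity),
      ← ENNReal.ofReal_pow (by positivity), ← ENNReal.ofReal_mul (by positivity),
      ← ENNReal.ofReal_mul (by positivity), ENNReal.ofReal_le_ofReal_iff (by positivity)]
    rw [← mul_assoc, mul_comm lam]

namespace HardCoreRecursion

/-- Cauchy–Schwarz for the sum and its reversal, since `s ^ i * s ^ (n - i) = s ^ n`. -/
theorem sq_geom_sum_ge {s : ℝ} (hs : 0 < s) (n : ℕ) :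
    ((n : ℝ) + 1) ^ 2 * s ^ n ≤ (∑ i ∈ Finset.range (n + 1), s ^ i) ^ 2 := by
  have h := Finset.sum_sq_le_sum_mul_sum_of_sq_le_mul (Finset.range (n + 1))
    (r := fun _ => √(s ^ n)) (f := fun i => s ^ i) (g := fun i => s ^ (n - i))
    (fun i _ => by positivity) (fun i _ => by positivity) (fun i hi => by
      rw [Real.sq_sqrt (by positivity), ← pow_add]
      rw [Finset.mem_range] at hi
      rw [show i + (n - i) = n by omega])
  have h2 := Finset.sum_range_reflect (fun i => s ^ i) (n + 1)
  simp only [Nat.add_sub_cancel] at h2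
  rw [h2] at h
  simp only [Finset.sum_const, Finset.card_range, nsmul_eq_mul] at h
  rw [mul_pow, Real.sq_sqrt (by positivity)] at h
  push_cast at h
  nlinarith [h]

/-- With `S_n` the sum of the first `n` powers, `S_{n+2} S_n = S_{n+1} ^ 2 - s ^ n`. As `(n + 1) ^ 2
- n (n + 2) = 1`, the claim is equivalent to `sq_geom_sum_ge`. -/
theorem geom_sum_log_convex {s : ℝ} (hs : 0 < s) (n : ℕ) :
    (n : ℝ) * (n + 2) * (∑ i ∈ Finset.range (n + 1), s ^ i) ^ 2 ≤
      ((n : ℝ) + 1) ^ 2 * ((∑ i ∈ Finset.range (n + 2), s ^ i) * ∑ i ∈ Finset.range n, s ^ i) := by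
  have h := sq_geom_sum_ge hs n
  have key : (∑ i ∈ Finset.range (n + 2), s ^ i) * ∑ i ∈ Finset.range n, s ^ i =
      (∑ i ∈ Finset.range (n + 1), s ^ i) ^ 2 - s ^ n := by
    have h1 := Finset.sum_range_succ (fun i => s ^ i) (n + 1)
    have h2 := Finset.sum_range_succ (fun i => s ^ i) n
    have h3 := geom_sum_mul s n
    rw [h1, h2, pow_succ]
    linear_combination (s ^ n) * h3
  rw [key]
  nlinarith [h]

/-- The threshold inequality, an equality at `s = 1`. With `d = n + 1` a two-cycle of ratio `s` has
`L = S_{n+1} ^ (n+1) / (s * S_n ^ (n+2))`, and the value of this at `s = 1` is `d ^ d / (d - 1) ^ (d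
+ 1)`. In the induction, the log-convexity estimate raised to the power `n + 2` is multiplied with
the previous inequality. -/
theorem geom_sum_pow_lt {s : ℝ} (hs : 1 < s) {n : ℕ} (hn : 1 ≤ n) :
    ((n : ℝ) + 1) ^ (n + 1) * (s * (∑ i ∈ Finset.range n, s ^ i) ^ (n + 2)) <
      (∑ i ∈ Finset.range (n + 1), s ^ i) ^ (n + 1) * (n : ℝ) ^ (n + 2) := by
  have hs0 : 0 < s := by linarith
  have hpos : ∀ m, 1 ≤ m → 0 < ∑ i ∈ Finset.range m, s ^ i := by
    intro m hm
    exact Finset.sum_pos (fun i _ => by positivity) ⟨0, Finset.mem_range.2 (by omega)⟩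
  induction n, hn using Nat.le_induction with
  | base =>
    simp only [Finset.sum_range_succ, Finset.sum_range_zero]
    norm_num
    nlinarith [sq_pos_of_pos (sub_pos.2 hs)]
  | succ n hn ih =>
    have hn0 : (0 : ℝ) < n := by exact_mod_cast hn
    have hQ := geom_sum_log_convex hs0 n
    have p0 := hpos n hn
    have p1 := hpos (n + 1) (by omega)
    have p2 := hpos (n + 2) (by omega)
    set A := ∑ i ∈ Finset.range n, s ^ i
    set B := ∑ i ∈ Finset.range (n + 1), s ^ i
    set C := ∑ i ∈ Finset.range (n + 1 + 1), s ^ i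
    clear_value A B C
    push_cast
    rw [show (n : ℝ) + 1 + 1 = n + 2 by ring]
    obtain ⟨p, hp⟩ : ∃ p : ℝ, (n : ℝ) + 1 = p := ⟨_, rfl⟩
    obtain ⟨q, hq⟩ : ∃ q : ℝ, (n : ℝ) + 2 = q := ⟨_, rfl⟩
    have hp0 : 0 < p := by rw [← hp]; positivity
    have hq0 : 0 < q := by rw [← hq]; positivity
    rw [hp, hq] at hQ
    rw [hp] at ih
    rw [hp, hq]
    have hQ' := pow_le_pow_left₀ (by positivity) hQ (n + 2)
    simp only [mul_pow] at hQ'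
    have h1 : ((n : ℝ) ^ (n + 2) * q ^ (n + 2) * (B ^ 2) ^ (n + 2)) * (p ^ (n + 1) * s) <
        ((p ^ 2) ^ (n + 2) * C ^ (n + 2)) * (B ^ (n + 1) * (n : ℝ) ^ (n + 2)) := by
      calc _ ≤ ((p ^ 2) ^ (n + 2) * (C ^ (n + 2) * A ^ (n + 2))) * (p ^ (n + 1) * s) := by
            gcongr
        _ = ((p ^ 2) ^ (n + 2) * C ^ (n + 2)) * (p ^ (n + 1) * (s * A ^ (n + 2))) := by ring
        _ < _ := by gcongr
    have hc : (0 : ℝ) < (n : ℝ) ^ (n + 2) * B ^ (n + 1) * p ^ (n + 1) := by positivity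
    refine lt_of_mul_lt_mul_left ?_ hc.le
    calc _ = ((n : ℝ) ^ (n + 2) * q ^ (n + 2) * (B ^ 2) ^ (n + 2)) * (p ^ (n + 1) * s) := by ring
      _ < _ := h1
      _ = _ := by ring

/-- A two-cycle of the hard-core recursion below the threshold is a fixed point. -/
theorem cycle_eq {d : ℕ} (hd : 1 ≤ d) {L x y : ℝ} (hL : 0 < L) (hx : 0 ≤ x) (hy : 0 ≤ y)
    (hcrit : L * ((d : ℝ) - 1) ^ (d + 1) ≤ (d : ℝ) ^ d)
    (h1 : x * (1 + y) ^ d = L) (h2 : y * (1 + x) ^ d = L) : x = y := by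
  wlog hxy : x < y generalizing x y
  · rcases lt_trichotomy x y with h | h | h
    · exact absurd h hxy
    · exact h
    · exact (this hy hx h2 h1 h).symm
  exfalso
  have hx0 : 0 < x := by
    rcases hx.eq_or_lt with h | h
    · rw [← h] at h1; simp at h1; linarith
    · exact h
  -- Dividing the two cycle equations gives `y = s ^ d * x`. Substitution in `1 + y = s * (1 + x)`
  -- and cancellation of `s - 1` then express `x` through `s` alone (`hxS`).
  obtain ⟨s, hs⟩ : ∃ s, s = (1 + y) / (1 + x) := ⟨_, rfl⟩
  have hs1 : 1 < s := by rw [hs, one_lt_div (by positivity)]; linarith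
  have hsy : 1 + y = s * (1 + x) := by rw [hs]; field_simp
  have hyx : y = s ^ d * x := by
    rw [hsy, mul_pow] at h1
    have h3 : (1 + x) ^ d ≠ 0 := by positivity
    have : (y - s ^ d * x) * (1 + x) ^ d = 0 := by linear_combination h2 - h1
    rcases mul_eq_zero.1 this with h | h
    · linarith
    · exact absurd h h3
  obtain ⟨n, rfl⟩ : ∃ n, d = n + 1 := ⟨d - 1, by omega⟩
  have hgeom := geom_sum_mul s n
  have hxS : x * s * (∑ i ∈ Finset.range n, s ^ i) = 1 := by
    have : (s - 1) * (x * s * (∑ i ∈ Finset.range n, s ^ i) - 1) = 0 := by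
      rw [hyx] at hsy
      linear_combination (x * s) * hgeom + hsy
    rcases mul_eq_zero.1 this with h | h <;> linarith
  have hn : 1 ≤ n := by
    by_contra hn
    rw [show n = 0 by omega] at hxS
    simp at hxS
  have hS : (∑ i ∈ Finset.range (n + 1), s ^ i) = s * (∑ i ∈ Finset.range n, s ^ i) + 1 := by
    rw [Finset.sum_range_succ', Finset.mul_sum, pow_zero]
    exact congrArg (· + 1) (Finset.sum_congr rfl fun i _ => pow_succ' s i)
  have key := geom_sum_pow_lt hs1 hn
  have hA : 0 < ∑ i ∈ Finset.range n, s ^ i :=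
    Finset.sum_pos (fun i _ => by positivity) ⟨0, Finset.mem_range.2 (by omega)⟩
  set A := ∑ i ∈ Finset.range n, s ^ i
  set B := ∑ i ∈ Finset.range (n + 1), s ^ i
  have h1x : 1 + x = x * B := by rw [hS]; linear_combination -hxS
  have hLB : L * (s * A ^ (n + 2)) = B ^ (n + 1) := by
    rw [← h1, hsy, h1x]
    have : (x * s * A) ^ (n + 2) = 1 := by rw [hxS, one_pow]
    calc _ = (x * s * A) ^ (n + 2) * B ^ (n + 1) := by ring
      _ = _ := by rw [this, one_mul]
  rw [← hLB] at key
  push_cast at hcrit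
  rw [add_sub_cancel_right] at hcrit
  have hpos : 0 < s * A ^ (n + 2) := mul_pos (by linarith) (pow_pos hA _)
  have := mul_le_mul_of_nonneg_right hcrit hpos.le
  linarith

theorem exists_fixed (d : ℕ) {L : ℝ} (hL : 0 < L) : ∃ x, 0 < x ∧ x * (1 + x) ^ d = L := by
  have hc : ContinuousOn (fun x : ℝ => x * (1 + x) ^ d) (Set.Icc 0 L) := by fun_prop
  have hmem : L ∈ Set.Icc ((0 : ℝ) * (1 + 0) ^ d) (L * (1 + L) ^ d) := by
    refine ⟨by simpa using hL.le, ?_⟩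
    have : 1 ≤ (1 + L) ^ d := one_le_pow₀ (by linarith)
    nlinarith
  obtain ⟨x, hx, hxL⟩ := intermediate_value_Icc hL.le hc hmem
  refine ⟨x, hx.1.lt_of_ne ?_, hxL⟩
  rintro rfl
  simp at hxL
  linarith

/-- Above the threshold the hard-core recursion has a proper two-cycle. -/
theorem exists_cycle {d : ℕ} (hd : 1 ≤ d) {L : ℝ} (hL : 0 < L)
    (hcrit : (d : ℝ) ^ d < L * ((d : ℝ) - 1) ^ (d + 1)) :
    ∃ x y, 0 < x ∧ 0 < y ∧ x ≠ y ∧ x * (1 + y) ^ d = L ∧ y * (1 + x) ^ d = L := by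
  obtain ⟨n, rfl⟩ : ∃ n, d = n + 1 := ⟨d - 1, by omega⟩
  push_cast at hcrit
  rw [add_sub_cancel_right] at hcrit
  have hn : 1 ≤ n := by
    by_contra hn
    rw [show n = 0 by omega] at hcrit
    simp at hcrit
    linarith
  have hn0 : (0 : ℝ) < n := by exact_mod_cast hn
  -- For given `s`, the choices `x = 1 / G s` and `y = s ^ (n + 1) * x` satisfy `1 + y = s * (1 +
  -- x)`. Only `F s = L` remains to be solved, by continuity from `s = 1`.
  let G : ℝ → ℝ := fun s => s * ∑ i ∈ Finset.range n, s ^ i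
  have hG : ∀ s, 1 ≤ s → 0 < G s := fun s hs =>
    mul_pos (by linarith) (Finset.sum_pos (fun i _ => by positivity) ⟨0, Finset.mem_range.2 (by omega)⟩)
  have hGc : Continuous G := by fun_prop
  let F : ℝ → ℝ := fun s => (G s)⁻¹ * (1 + s ^ (n + 1) * (G s)⁻¹) ^ (n + 1)
  -- Here `M = L * n ^ (n + 2)` is large enough for `F M ≥ L`: the bound `G M ≤ n * M ^ n` gives `F
  -- M ≥ M / n ^ (n + 2) = L`.
  set M := L * (n : ℝ) ^ (n + 2) with hM
  have hM1 : 1 ≤ M := by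
    have : 1 ≤ ((n : ℝ) + 1) ^ (n + 1) := one_le_pow₀ (by linarith)
    linarith
  have hF : ContinuousOn F (Set.Icc 1 M) := by
    have : ContinuousOn (fun s => (G s)⁻¹) (Set.Icc 1 M) :=
      hGc.continuousOn.inv₀ fun s hs => (hG s hs.1).ne'
    fun_prop
  have hF1 : F 1 < L := by
    have hG1 : G 1 = n := by simp [G]
    simp only [F, hG1, one_pow, one_mul]
    rw [show 1 + (n : ℝ)⁻¹ = (n + 1) / n by field_simp]
    rw [div_pow, inv_mul_eq_div, div_div, div_lt_iff₀ (by positivity)]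
    calc _ < _ := hcrit
      _ = _ := by ring
  have hFM : L ≤ F M := by
    have hM0 : 0 < M := by linarith
    have hGM := hG M hM1
    have hGle : G M ≤ n * M ^ n := by
      simp only [G, Finset.mul_sum]
      calc _ ≤ ∑ i ∈ Finset.range n, M ^ n := by
            refine Finset.sum_le_sum fun i hi => ?_
            rw [← pow_succ']
            exact pow_le_pow_right₀ hM1 (Finset.mem_range.1 hi)
        _ = _ := by simp
    have hinv : (n * M ^ n)⁻¹ ≤ (G M)⁻¹ := inv_anti₀ hGM hGle
    calc L = (n * M ^ n)⁻¹ * (M ^ (n + 1) * (n * M ^ n)⁻¹) ^ (n + 1) := by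
          have : L = M / n ^ (n + 2) := by rw [hM]; field_simp
          rw [this]
          have hMn : M ^ (n + 1) * (n * M ^ n)⁻¹ = M / n := by rw [pow_succ]; field_simp
          rw [hMn, div_pow]
          field_simp
          ring
      _ ≤ (G M)⁻¹ * (0 + M ^ (n + 1) * (G M)⁻¹) ^ (n + 1) := by
          rw [zero_add]
          gcongr
      _ ≤ F M := by
          simp only [F]
          gcongr
          norm_num
  obtain ⟨s, hs, hsL⟩ := intermediate_value_Icc hM1 hF ⟨hF1.le, hFM⟩
  have hs1 : 1 < s := hs.1.lt_of_ne (by rintro rfl; exact hF1.ne hsL)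
  have hGs := hG s hs.1
  have hgeom := geom_sum_mul s n
  set x := (G s)⁻¹ with hx
  have hx0 : 0 < x := inv_pos.2 hGs
  have hxG : x * (s * ∑ i ∈ Finset.range n, s ^ i) = 1 := inv_mul_cancel₀ hGs.ne'
  have hsy : 1 + s ^ (n + 1) * x = s * (1 + x) := by
    linear_combination (s - 1) * hxG - x * s * hgeom
  refine ⟨x, s ^ (n + 1) * x, hx0, by positivity, ?_, hsL, ?_⟩
  · have : 1 < s ^ (n + 1) := one_lt_pow₀ hs1 (by omega)
    intro h
    nlinarith
  · calc s ^ (n + 1) * x * (1 + x) ^ (n + 1) = x * (s * (1 + x)) ^ (n + 1) := by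
          rw [mul_pow]; ring
      _ = x * (1 + s ^ (n + 1) * x) ^ (n + 1) := by rw [hsy]
      _ = L := hsL

/-- One step of the recursion for the probability that a downward hyperedge is vacant. -/
def step (L : ℝ) (d : ℕ) (t : ℝ) : ℝ := (1 + L * t ^ d)⁻¹

/-- Lower and upper bounds for the vacancy probabilities at a given distance from the boundary. -/
def bounds (L : ℝ) (d n : ℕ) : ℝ × ℝ := (fun p => (step L d p.2, step L d p.1))^[n] (0, 1)

theorem bounds_succ (L : ℝ) (d n : ℕ) :
    bounds L d (n + 1) = (step L d (bounds L d n).2, step L d (bounds L d n).1) :=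
  Function.iterate_succ_apply' _ _ _

theorem step_anti {L : ℝ} (hL : 0 < L) (d : ℕ) {s t : ℝ} (hs : 0 ≤ s) (hst : s ≤ t) :
    step L d t ≤ step L d s := by
  unfold step
  gcongr

theorem step_mem {L : ℝ} (hL : 0 < L) (d : ℕ) {t : ℝ} (ht : 0 ≤ t) :
    0 < step L d t ∧ step L d t ≤ 1 := by
  unfold step
  refine ⟨by positivity, inv_le_one_of_one_le₀ ?_⟩
  have : 0 ≤ L * t ^ d := by positivity
  linarith

theorem bounds_mem {L : ℝ} (hL : 0 < L) (d n : ℕ) :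
    0 ≤ (bounds L d n).1 ∧ (bounds L d n).1 ≤ (bounds L d n).2 ∧ (bounds L d n).2 ≤ 1 := by
  induction n with
  | zero => simp [bounds]
  | succ n ih =>
    rw [bounds_succ]
    exact ⟨(step_mem hL d (ih.1.trans ih.2.1)).1.le, step_anti hL d ih.1 ih.2.1,
      (step_mem hL d ih.1).2⟩

theorem bounds_step {L : ℝ} (hL : 0 < L) (d n : ℕ) :
    (bounds L d n).1 ≤ (bounds L d (n + 1)).1 ∧ (bounds L d (n + 1)).2 ≤ (bounds L d n).2 := by
  induction n with
  | zero =>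
    have h := bounds_mem hL d 1
    simpa [bounds] using And.intro h.1 h.2.2
  | succ n ih =>
    have h := bounds_mem hL d (n + 1)
    have h' := bounds_mem hL d n
    rw [bounds_succ, bounds_succ L d (n + 1)]
    exact ⟨step_anti hL d (h.1.trans h.2.1) ih.2, step_anti hL d h'.1 ih.1⟩

open Filter Topology in
/-- Below the threshold the bounds on the vacancy probabilities close up. -/
theorem tendsto_bounds {d : ℕ} (hd : 1 ≤ d) {L : ℝ} (hL : 0 < L)
    (hcrit : L * ((d : ℝ) - 1) ^ (d + 1) ≤ (d : ℝ) ^ d) {t : ℝ} (ht : 0 < t)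
    (hfix : t * (1 + L * t ^ d) = 1) :
    Tendsto (fun n => (bounds L d n).1) atTop (𝓝 t) ∧
      Tendsto (fun n => (bounds L d n).2) atTop (𝓝 t) := by
  have hstep : Continuous fun p : ℝ => (1 + L * p ^ d) := by fun_prop
  have hmono : Monotone fun n => (bounds L d n).1 :=
    monotone_nat_of_le_succ fun n => (bounds_step hL d n).1
  have hanti : Antitone fun n => (bounds L d n).2 :=
    antitone_nat_of_succ_le fun n => (bounds_step hL d n).2
  obtain ⟨l, hl⟩ : ∃ l, Tendsto (fun n => (bounds L d n).1) atTop (𝓝 l) :=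
    ⟨_, tendsto_atTop_ciSup hmono ⟨1, by
      rintro _ ⟨n, rfl⟩
      exact (bounds_mem hL d n).2.1.trans (bounds_mem hL d n).2.2⟩⟩
  obtain ⟨h, hh⟩ : ∃ h, Tendsto (fun n => (bounds L d n).2) atTop (𝓝 h) :=
    ⟨_, tendsto_atTop_ciInf hanti ⟨0, by
      rintro _ ⟨n, rfl⟩
      exact (bounds_mem hL d n).1.trans (bounds_mem hL d n).2.1⟩⟩
  have hl0 : 0 ≤ l := ge_of_tendsto' hl fun n => (bounds_mem hL d n).1
  have hh0 : 0 ≤ h := ge_of_tendsto' hh fun n => (bounds_mem hL d n).1.trans (bounds_mem hL d n).2.1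
  have hstep : ∀ {f : ℕ → ℝ} {a : ℝ}, 0 ≤ a → Tendsto f atTop (𝓝 a) →
      Tendsto (fun n => step L d (f n)) atTop (𝓝 (step L d a)) := by
    intro f a ha hf
    exact ((((hf.pow d).const_mul L).const_add 1)).inv₀ (by positivity)
  have e1 : l = step L d h := by
    refine tendsto_nhds_unique ((tendsto_add_atTop_iff_nat 1).2 hl) ?_
    simp only [bounds_succ]
    exact hstep hh0 hh
  have e2 : h = step L d l := by
    refine tendsto_nhds_unique ((tendsto_add_atTop_iff_nat 1).2 hh) ?_
    simp only [bounds_succ]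
    exact hstep hl0 hl
  -- The two limits are exchanged by `step`, and `L * p ^ d`, `L * q ^ d` then form a cycle in the
  -- sense of `cycle_eq`.
  have cyc : ∀ {p q : ℝ}, 0 ≤ p → 0 ≤ q → p = step L d q → q = step L d p → p = q := by
    intro p q hp hq h1 h2
    have hp' : p * (1 + L * q ^ d) = 1 := by rw [h1, step]; field_simp
    have hq' : q * (1 + L * p ^ d) = 1 := by rw [h2, step]; field_simp
    have h3 := cycle_eq hd hL (x := L * p ^ d) (y := L * q ^ d) (by positivity) (by positivity)
      hcrit (by rw [mul_assoc, ← mul_pow, hp', one_pow, mul_one])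
      (by rw [mul_assoc, ← mul_pow, hq', one_pow, mul_one])
    calc p = step L d q := h1
      _ = step L d p := by rw [step, step, h3]
      _ = q := h2.symm
  have hlh := cyc hl0 hh0 e1 e2
  subst hlh
  -- The fixed point is unique because `t * (1 + L * t ^ d)` is strictly increasing.
  have hlt : l = t := by
    have hp' : l * (1 + L * l ^ d) = 1 := by
      conv_lhs => enter [1]; rw [e1]
      rw [step]; field_simp
    rcases lt_trichotomy l t with h | h | h
    · have : L * l ^ d ≤ L * t ^ d := by gcongr
      have hY : 0 ≤ L * t ^ d := by positivity
      nlinarith [mul_nonneg hl0 (sub_nonneg.2 this), mul_pos (sub_pos.2 h) (by linarith : 0 < 1 + L * t ^ d)]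
    · exact h
    · have : L * t ^ d ≤ L * l ^ d := by gcongr
      have hY : 0 ≤ L * l ^ d := by positivity
      nlinarith [mul_nonneg ht.le (sub_nonneg.2 this), mul_pos (sub_pos.2 h) (by linarith : 0 < 1 + L * l ^ d)]
  subst hlt
  exact ⟨hl, hh⟩

/-- The right-hand sides decrease in the unknown while the left-hand sides increase. The unknown is
the odds of occupation at a vertex. -/
theorem odds_unique {k d : ℕ} {lam p q : ℝ} (hlam : 0 < lam)
    (hp1 : k * p ≤ 1) (hq1 : k * q ≤ 1) (hp : p = lam * (1 - k * p) ^ (d + 1))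
    (hq : q = lam * (1 - k * q) ^ (d + 1)) : p = q := by
  wlog h : p < q generalizing p q
  · rcases lt_trichotomy p q with h' | h' | h'
    · exact absurd h' h
    · exact h'
    · exact (this hq1 hp1 hq hp h').symm
  have : lam * (1 - k * q) ^ (d + 1) ≤ lam * (1 - k * p) ^ (d + 1) := by
    have hk : (0 : ℝ) ≤ k := Nat.cast_nonneg k
    have : 1 - k * q ≤ 1 - k * p := by nlinarith
    have : 0 ≤ 1 - k * q := by linarith
    gcongr
  linarith

/-- The two sides are the one-vertex odds on even and odd levels under the alternating law; after
cross-multiplication their difference is `a - b` times a positive factor. -/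
theorem cycle_odds_ne {k : ℕ} (hk : 1 ≤ k) {a b : ℝ} (ha : 0 < a) (hb : 0 < b) (hab : a ≠ b) :
    a * (1 + (k - 1) * b) / ((1 + (k - 1) * a) * (1 + k * b)) ≠
      b * (1 + (k - 1) * a) / ((1 + (k - 1) * b) * (1 + k * a)) := by
  have hk' : (0 : ℝ) ≤ k - 1 := by
    have : (1 : ℝ) ≤ k := by exact_mod_cast hk
    linarith
  obtain ⟨m, hm⟩ : ∃ m : ℝ, m = k - 1 := ⟨_, rfl⟩
  have hkm : (k : ℝ) = m + 1 := by rw [hm]; ring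
  rw [← hm] at hk' ⊢
  rw [hkm, Ne, div_eq_div_iff (by positivity) (by positivity)]
  intro h
  have h0 : (a - b) * (1 + (m + 1) * (a + b) + a * b * (m ^ 2 + 2 * m)) = 0 := by
    linear_combination h
  rcases mul_eq_zero.1 h0 with h1 | h1
  · exact hab (by linarith)
  · have : 0 < 1 + (m + 1) * (a + b) + a * b * (m ^ 2 + 2 * m) := by positivity
    linarith

end HardCoreRecursion

end

/-! ### Finite windows, cylinder masses and compactness. -/

noncomputable section

open scoped Classical

section Trace

variable {V : Type*}

/-- The part of the configuration `I` in the finite window `T`. -/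
def trace (T : Finset V) (I : Set V) : Finset V := T.filter (· ∈ I)

theorem mem_trace {T : Finset V} {I : Set V} {v : V} : v ∈ trace T I ↔ v ∈ T ∧ v ∈ I :=
  Finset.mem_filter

theorem trace_subset (T : Finset V) (I : Set V) : trace T I ⊆ T := Finset.filter_subset _ _

theorem coe_trace (T : Finset V) (I : Set V) : (trace T I : Set V) = I ∩ T := by
  ext v
  simp [mem_trace, and_comm]

theorem inter_eq_iff_trace {T A : Finset V} {I : Set V} : I ∩ T = (A : Set V) ↔ trace T I = A := by
  rw [← coe_trace, Finset.coe_inj]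

theorem trace_trace {T T' : Finset V} (h : T ⊆ T') (I : Set V) :
    trace T' I ∩ T = trace T I := by
  ext v
  simp only [Finset.mem_inter, mem_trace]
  exact ⟨fun hv => ⟨hv.2, hv.1.2⟩, fun hv => ⟨⟨h hv.1, hv.2⟩, hv.1⟩⟩

theorem measurable_inter (S : Set V) : Measurable fun I : Set V => I ∩ S := by
  rw [measurable_set_iff]
  intro v
  by_cases hv : v ∈ S
  · simpa [hv] using measurable_set_mem v
  · simp [hv]

theorem measurable_trace (T : Finset V) : Measurable[_, ⊤] (trace T : Set V → Finset V) := by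
  have h : ∀ A, MeasurableSet {I : Set V | trace T I = A} := by
    intro A
    by_cases hA : A ⊆ T
    · have : {I : Set V | trace T I = A} = ⋂ v ∈ T, {I | v ∈ I ↔ v ∈ A} := by
        ext I
        simp only [Set.mem_ofPred_eq, Set.mem_iInter, Finset.ext_iff, mem_trace]
        exact ⟨fun h v hv => by simp [← h, hv], fun h v => ⟨fun hv => (h v hv.1).1 hv.2,
          fun hv => ⟨hA hv, (h v (hA hv)).2 hv⟩⟩⟩
      rw [this]
      refine Finset.measurableSet_biInter _ fun v _ => ?_
      by_cases hv : v ∈ A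
      · simpa [hv] using measurableSet_mem v
      · simpa [hv] using measurable_set_notMem v
    · have : {I : Set V | trace T I = A} = ∅ := by
        ext I
        simp only [Set.mem_ofPred_eq, Set.mem_empty_iff_false, iff_false]
        rintro rfl
        exact hA (trace_subset T I)
      rw [this]
      exact MeasurableSet.empty
  intro s _
  have : trace T ⁻¹' s = ⋃ A ∈ T.powerset.filter (· ∈ s), {I : Set V | trace T I = A} := by
    ext I
    simp [trace_subset]
  rw [this]
  exact Finset.measurableSet_biUnion _ fun A _ => h A

theorem measurableSet_trace (T : Finset V) (p : Finset V → Prop) :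
    MeasurableSet {I : Set V | p (trace T I)} :=
  measurable_trace T (MeasurableSpace.measurableSet_top (s := {A | p A}))

/-- The mass of the configurations in `X` whose part in `T` is `A`. -/
def cylMass (μ : Measure (Set V)) (X : Set (Set V)) (T A : Finset V) : ℝ :=
  μ.real ({I | trace T I = A} ∩ X)

variable {μ : Measure (Set V)} {X : Set (Set V)}

theorem cylMass_nonneg (T A : Finset V) : 0 ≤ cylMass μ X T A := measureReal_nonneg

theorem measureReal_trace [IsFiniteMeasure μ] (hX : MeasurableSet X) (T : Finset V)
    (p : Finset V → Prop) :
    μ.real ({I | p (trace T I)} ∩ X) = ∑ A ∈ T.powerset.filter p, cylMass μ X T A := by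
  have : {I : Set V | p (trace T I)} ∩ X =
      ⋃ A ∈ T.powerset.filter p, ({I : Set V | trace T I = A} ∩ X) := by
    ext I
    simp only [Set.mem_inter_iff, Set.mem_ofPred_eq, Finset.mem_filter, Finset.mem_powerset,
      Set.mem_iUnion, exists_prop]
    constructor
    · rintro ⟨h1, h2⟩
      exact ⟨_, ⟨trace_subset T I, h1⟩, rfl, h2⟩
    · rintro ⟨A, ⟨_, h1⟩, rfl, h2⟩
      exact ⟨h1, h2⟩
  rw [this, measureReal_biUnion_finset]
  · rfl
  · intro A _ B _ hAB
    refine Set.disjoint_left.2 fun I h1 h2 => hAB (h1.1.symm.trans h2.1)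
  · exact fun A _ => (measurableSet_trace T (· = A)).inter hX

theorem sum_cylMass [IsFiniteMeasure μ] (hX : MeasurableSet X) (T : Finset V) :
    ∑ A ∈ T.powerset, cylMass μ X T A = μ.real X := by
  have := measureReal_trace (μ := μ) hX T (fun _ => True)
  simpa using this.symm

theorem cylMass_eq_sum [IsFiniteMeasure μ] (hX : MeasurableSet X) {T D A : Finset V}
    (hTD : Disjoint T D) (hA : A ⊆ T) :
    cylMass μ X T A = ∑ B ∈ D.powerset, cylMass μ X (T ∪ D) (A ∪ B) := by
  have h : {I : Set V | trace T I = A} = {I | trace (T ∪ D) I ∩ T = A} := by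
    ext I
    simp [trace_trace Finset.subset_union_left]
  have h2 := Finset.disjoint_left.1 hTD
  rw [cylMass, h, measureReal_trace hX (T ∪ D) (fun B => B ∩ T = A)]
  symm
  refine Finset.sum_nbij (fun B => A ∪ B) ?_ ?_ ?_ fun _ _ => rfl
  · intro B hB
    rw [Finset.mem_powerset] at hB
    simp only [Finset.mem_filter, Finset.mem_powerset]
    refine ⟨Finset.union_subset_union hA hB, ?_⟩
    ext x
    simp only [Finset.mem_inter, Finset.mem_union]
    grind
  · intro B hB B' hB' hBB
    simp only [Finset.coe_powerset, Set.mem_preimage, Set.mem_powerset_iff, Finset.coe_subset]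
      at hB hB'
    ext x
    have := Finset.ext_iff.1 hBB x
    simp only [Finset.mem_union] at this
    grind
  · intro B hB
    simp only [Finset.coe_filter, Finset.mem_powerset, Set.mem_ofPred_eq] at hB
    refine ⟨B \ T, ?_, ?_⟩
    · simp only [Finset.coe_powerset, Set.mem_preimage, Set.mem_powerset_iff, Finset.coe_subset]
      intro x hx
      have := hB.1 (Finset.mem_sdiff.1 hx).1
      simp only [Finset.mem_union, Finset.mem_sdiff] at this hx
      tauto
    · rw [← hB.2]
      ext x
      simp only [Finset.mem_union, Finset.mem_inter, Finset.mem_sdiff]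
      tauto

/-- The events `F ⊆ I` form a generating π-system, and each is a finite union of cylinders over any
window that contains `F`. -/
theorem eq_of_cylMass_eq {μ ν : Measure (Set V)} [IsProbabilityMeasure μ] [IsProbabilityMeasure ν]
    (h : ∀ F : Finset V, ∃ T, F ⊆ T ∧ ∀ A ⊆ T, cylMass μ Set.univ T A = cylMass ν Set.univ T A) :
    μ = ν := by
  refine ext_of_generate_finite {s : Set (Set V) | ∃ F : Finset V, s = {I | (F : Set V) ⊆ I}} ?_ ?_ ?_
    (by simp)
  · apply le_antisymm
    · have : Measurable[MeasurableSpace.generateFrom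
          {s : Set (Set V) | ∃ F : Finset V, s = {I | (F : Set V) ⊆ I}}] fun I : Set V => I := by
        refine (@measurable_set_iff _ _ (_) _).2 fun v => ?_
        exact (@measurableSet_setOfPred _ (_) _).1 (MeasurableSpace.measurableSet_generateFrom ⟨{v}, by simp⟩)
      exact fun s hs => this hs
    · refine MeasurableSpace.generateFrom_le ?_
      rintro _ ⟨F, rfl⟩
      have : {I : Set V | (F : Set V) ⊆ I} = {I | trace F I = F} := by
        ext I
        simp only [Set.mem_ofPred_eq, trace, Finset.filter_eq_self]
        rfl
      rw [this]
      exact measurableSet_trace F (· = F)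
  · rintro _ ⟨F, rfl⟩ _ ⟨F', rfl⟩ _
    refine ⟨F ∪ F', ?_⟩
    ext I
    simp
  · rintro _ ⟨F, rfl⟩
    obtain ⟨T, hFT, hT⟩ := h F
    have hset : {I : Set V | (F : Set V) ⊆ I} = {I | F ⊆ trace T I} ∩ Set.univ := by
      ext I
      simp only [Set.mem_ofPred_eq, Set.inter_univ]
      exact ⟨fun h x hx => mem_trace.2 ⟨hFT hx, h hx⟩, fun h x hx => (mem_trace.1 (h hx)).2⟩
    have key : ∀ p : Finset V → Prop, μ.real ({I | p (trace T I)} ∩ Set.univ) =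
        ν.real ({I | p (trace T I)} ∩ Set.univ) := by
      intro p
      rw [measureReal_trace .univ, measureReal_trace .univ]
      refine Finset.sum_congr rfl fun A hA => hT A ?_
      rw [Finset.mem_filter, Finset.mem_powerset] at hA
      exact hA.1
    rw [← measureReal_eq_measureReal_iff, hset]
    exact key _

open Filter Topology in
/-- Probability measures whose cylinder probabilities are eventually constant converge. -/
theorem exists_measure_of_eventually_eq [Countable V] (P : ℕ → Measure (Set V))
    [∀ n, IsProbabilityMeasure (P n)] :
    ∃ μ : Measure (Set V), IsProbabilityMeasure μ ∧ ∀ (T A : Finset V) (c : ℝ),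
      (∀ᶠ n in atTop, cylMass (P n) Set.univ T A = c) → cylMass μ Set.univ T A = c := by
  have htoB : Measurable fun (I : Set V) (v : V) => decide (v ∈ I) := by
    refine measurable_pi_lambda _ fun v => ?_
    refine measurable_to_countable' fun b => ?_
    rcases b
    · convert (measurableSet_mem v).compl using 1
      ext; simp
    · convert measurableSet_mem v using 1
      ext; simp
  have hofB : Measurable fun (f : V → Bool) => {v | f v = true} := by
    rw [measurable_set_iff]
    intro v
    have h := measurableSet_preimage (f := fun f : V → Bool => f v) (measurable_pi_apply v)
      (measurableSet_singleton true)
    exact measurableSet_setOfPred.1 h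
  -- Configurations are moved to the compact space `V → Bool`, whose probability measures are
  -- compact; the limit is taken along an ultrafilter.
  let Q : ℕ → ProbabilityMeasure (V → Bool) := fun n =>
    ⟨(P n).map fun I v => decide (v ∈ I), Measure.isProbabilityMeasure_map htoB.aemeasurable⟩
  obtain ⟨ν, hν⟩ : ∃ ν, Tendsto Q (hyperfilter ℕ) (𝓝 ν) :=
    ⟨_, ((hyperfilter ℕ).map Q).le_nhds_lim⟩
  refine ⟨(ν : Measure (V → Bool)).map fun f => {v | f v = true},
    Measure.isProbabilityMeasure_map hofB.aemeasurable, fun T A c hc => ?_⟩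
  set C : Set (V → Bool) := {f | trace T {v | f v = true} = A} with hC
  -- Cylinders depend on finitely many coordinates and so have empty frontier; weak convergence
  -- therefore passes to their masses.
  have hCclopen : IsClopen C := by
    have : C = (fun f (v : T) => f v) ⁻¹' {g : T → Bool | T.filter (fun v => ∃ h : v ∈ T, g ⟨v, h⟩ = true) = A} := by
      ext f
      simp only [hC, trace, Set.mem_ofPred_eq, Set.mem_preimage]
      rw [Finset.filter_congr (q := fun v => ∃ h : v ∈ T, f v = true)]
      intro v hv
      simp [hv]
    rw [this]
    exact (isClopen_discrete _).preimage (by fun_prop)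
  have h1 : Tendsto (fun n => (Q n : Measure (V → Bool)) C) (hyperfilter ℕ) (𝓝 ((ν : Measure (V → Bool)) C)) :=
    ProbabilityMeasure.tendsto_measure_of_null_frontier_of_tendsto' hν
      (by rw [hCclopen.frontier_eq]; simp)
  have h2 : ∀ n, (Q n : Measure (V → Bool)) C = ENNReal.ofReal (cylMass (P n) Set.univ T A) := by
    intro n
    change (P n).map _ C = _
    rw [Measure.map_apply htoB hCclopen.isOpen.measurableSet, cylMass, ofReal_measureReal, Set.inter_univ]
    congr 1
    ext I
    simp [hC]
  have h3 : Tendsto (fun n => (Q n : Measure (V → Bool)) C) (hyperfilter ℕ) (𝓝 (ENNReal.ofReal c)) := by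
    refine tendsto_const_nhds.congr' ?_
    have : ∀ᶠ n in (hyperfilter ℕ : Filter ℕ), cylMass (P n) Set.univ T A = c :=
      (Nat.hyperfilter_le_atTop) hc
    filter_upwards [this] with n hn
    rw [h2, hn]
  have h4 := tendsto_nhds_unique h1 h3
  have hc0 : 0 ≤ c := by
    obtain ⟨n, hn⟩ := hc.exists
    rw [← hn]
    exact cylMass_nonneg _ _
  rw [cylMass, Set.inter_univ, measureReal_def, Measure.map_apply hofB (measurableSet_trace T (· = A))]
  change ((ν : Measure (V → Bool)) C).toReal = c
  rw [h4, ENNReal.toReal_ofReal hc0]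

end Trace

end

/-! ### Hard-core weights on subtrees and boundary laws. -/

noncomputable section

open scoped Classical

namespace Hypergraph

variable {V : Type*} {H : Hypergraph V} {k d : ℕ}

theorem IsIndep.mono {I J : Set V} (hJ : H.IsIndep J) (h : I ⊆ J) : H.IsIndep I :=
  ⟨h.trans hJ.1, fun e he => (hJ.2 e he).anti (Set.inter_subset_inter_left e h)⟩

theorem EndStructure.isIndep_iff (S : H.EndStructure k d) {I : Set V} :
    H.IsIndep I ↔ ∀ x ∈ I, ∀ y ∈ I, H.Adj x y → x = y := by
  constructor
  · rintro ⟨_, h⟩ x hx y hy ⟨e, he, hxe, hye⟩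
    exact h e he ⟨hx, hxe⟩ ⟨hy, hye⟩
  · intro h
    refine ⟨fun x _ => H.subset_vertexSet_of_mem_edgeSet' (S.isEdge_up x) (S.mem_up x), ?_⟩
    rintro e he x ⟨hx, hxe⟩ y ⟨hy, hye⟩
    exact h x hx y hy ⟨e, he, hxe, hye⟩

theorem EndStructure.isIndep_empty (S : H.EndStructure k d) : H.IsIndep (∅ : Set V) := by
  rw [S.isIndep_iff]
  simp

/-- The weight of a configuration in the hard-core model with activities `w`. -/
def wt (H : Hypergraph V) (w : V → ℝ) (A : Finset V) : ℝ :=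
  if H.IsIndep (A : Set V) then ∏ v ∈ A, w v else 0

theorem wt_empty (S : H.EndStructure k d) (w : V → ℝ) : H.wt w ∅ = 1 := by
  rw [wt, if_pos (by simpa using S.isIndep_empty), Finset.prod_empty]

theorem wt_nonneg {w : V → ℝ} {A : Finset V} (hw : ∀ v ∈ A, 0 ≤ w v) : 0 ≤ H.wt w A := by
  unfold wt
  split_ifs
  · exact Finset.prod_nonneg hw
  · exact le_rfl

theorem wt_congr {w w' : V → ℝ} {A : Finset V} (hw : ∀ v ∈ A, w v = w' v) :
    H.wt w A = H.wt w' A := by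
  unfold wt
  rw [Finset.prod_congr rfl hw]

variable {S : H.EndStructure k d}

namespace EndStructure

theorem wt_union_singleton {T e : Finset V} {v : V} (hT : S.IsSubtree T) (he : H.IsEdge e)
    (hev : e ∩ T = {v}) {A : Finset V} (hA : A ⊆ T) (w : V → ℝ) {u : V} (hu : u ∈ e.erase v) :
    H.wt w (A ∪ {u}) = H.wt w A * if v ∈ A then 0 else w u := by
  have hve : v ∈ e ∩ T := by simp [hev]
  rw [Finset.mem_inter] at hve
  rw [Finset.mem_erase] at hu
  have huT : u ∉ T := fun h => hu.1 (by
    have : u ∈ e ∩ T := Finset.mem_inter.2 ⟨hu.2, h⟩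
    rwa [hev, Finset.mem_singleton] at this)
  split_ifs with hvA
  · rw [mul_zero, wt, if_neg]
    rw [S.isIndep_iff]
    intro h
    exact hu.1 (h u (by simp) v (by simp [hvA]) ⟨e, he, hu.2, hve.1⟩)
  · have hadj : ∀ x ∈ A, ¬ H.Adj x u := by
      intro x hx hxu
      obtain ⟨f, hf, hxf, huf⟩ := S.adj_iff.1 hxu
      by_cases hfe : f = e
      · subst hfe
        have : x ∈ f ∩ T := Finset.mem_inter.2 ⟨hxf, hA hx⟩
        rw [hev, Finset.mem_singleton] at this
        exact hvA (this ▸ hx)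
      · exact hT.notMem_of_mem he hf hve.1 hve.2 hu.2 huT huf hfe hxf (hA hx)
    have hiff : H.IsIndep ((A ∪ {u} : Finset V) : Set V) ↔ H.IsIndep (A : Set V) := by
      refine ⟨fun h => h.mono (by simp), fun h => ?_⟩
      rw [S.isIndep_iff] at h ⊢
      intro x hx y hy hxy
      simp only [Finset.coe_union, Finset.coe_singleton, Set.mem_union, Finset.mem_coe,
        Set.mem_singleton_iff] at hx hy
      rcases hx with hx | rfl <;> rcases hy with hy | rfl
      · exact h x hx y hy hxy
      · exact absurd hxy (hadj x hx)
      · exact absurd hxy.symm (hadj y hy)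
      · rfl
    simp only [wt, hiff]
    split_ifs
    · rw [Finset.prod_union, Finset.prod_singleton]
      exact Finset.disjoint_singleton_right.2 fun h => huT (hA h)
    · simp

/-- A hyperedge carries at most one occupied vertex: none of the outer ones if `v` is occupied,
otherwise the empty set or a single `u`. -/
theorem sum_wt_union {T e : Finset V} {v : V} (hT : S.IsSubtree T) (he : H.IsEdge e)
    (hev : e ∩ T = {v}) {A : Finset V} (hA : A ⊆ T) (w : V → ℝ) :
    ∑ D ∈ (e.erase v).powerset, H.wt w (A ∪ D) =
      H.wt w A * if v ∈ A then 1 else 1 + ∑ u ∈ e.erase v, w u := by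
  have hsub : insert ∅ ((e.erase v).image fun u => ({u} : Finset V)) ⊆ (e.erase v).powerset := by
    intro D hD
    simp only [Finset.mem_insert, Finset.mem_image] at hD
    rcases hD with rfl | ⟨u, hu, rfl⟩
    · simp
    · simpa using hu
  rw [← Finset.sum_subset hsub, Finset.sum_insert, Finset.sum_image, Finset.union_empty,
    Finset.sum_congr rfl fun u hu => wt_union_singleton hT he hev hA w hu]
  · split_ifs <;> simp [Finset.mul_sum, mul_add]
  · intro a _ b _ h
    simpa using h
  · simp
  · intro D hD hD'
    have h0 : D ≠ ∅ := by rintro rfl; simp at hD'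
    obtain ⟨x, hx⟩ := Finset.nonempty_iff_ne_empty.2 h0
    rw [Finset.mem_powerset] at hD
    have : D ≠ {x} := by
      rintro rfl
      exact hD' (Finset.mem_insert_of_mem (Finset.mem_image_of_mem _ (hD hx)))
    obtain ⟨y, hy, hyx⟩ : ∃ y ∈ D, y ≠ x := by
      by_contra! h
      exact this (Finset.eq_singleton_iff_unique_mem.2 ⟨hx, h⟩)
    rw [wt, if_neg]
    rw [S.isIndep_iff]
    intro h
    exact hyx (h y (by simp [hy]) x (by simp [hx])
      ⟨e, he, Finset.mem_of_mem_erase (hD hy), Finset.mem_of_mem_erase (hD hx)⟩)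

end EndStructure

/-- Inside the event `X`, the configuration in `T` follows the hard-core model with
activities `w`. -/
def IsHardCore (H : Hypergraph V) (μ : Measure (Set V)) (X : Set (Set V)) (T : Finset V)
    (w : V → ℝ) : Prop :=
  ∀ A ⊆ T, cylMass μ X T A = cylMass μ X T ∅ * H.wt w A

variable {μ : Measure (Set V)} {X : Set (Set V)}

theorem IsHardCore.congr {T : Finset V} {w w' : V → ℝ} (h : H.IsHardCore μ X T w)
    (hw : ∀ v ∈ T, w v = w' v) : H.IsHardCore μ X T w' := fun A hA => by
  rw [h A hA, wt_congr fun v hv => hw v (hA hv)]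

/-- Summing out the vertices of a hyperedge attached to a subtree at `v`. -/
theorem IsHardCore.of_union_edge [IsFiniteMeasure μ] (hX : MeasurableSet X) {T e : Finset V} {v : V}
    (hT : S.IsSubtree T) (he : H.IsEdge e) (hev : e ∩ T = {v}) {w : V → ℝ}
    (hw : ∀ u ∈ e, 0 ≤ w u) (h : H.IsHardCore μ X (T ∪ e) w) :
    H.IsHardCore μ X T fun x => if x = v then w v * (1 + ∑ u ∈ e.erase v, w u)⁻¹ else w x := by
  have hve : v ∈ e ∩ T := by simp [hev]
  rw [Finset.mem_inter] at hve
  have hTe : T ∪ e = T ∪ e.erase v := by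
    ext x
    by_cases hx : x = v <;> simp [hx, hve.2]
  have hdisj : Disjoint T (e.erase v) := by
    rw [Finset.disjoint_left]
    intro x hxT hxe
    rw [Finset.mem_erase] at hxe
    have : x ∈ e ∩ T := Finset.mem_inter.2 ⟨hxe.2, hxT⟩
    rw [hev, Finset.mem_singleton] at this
    exact hxe.1 this
  have hs : 0 ≤ ∑ u ∈ e.erase v, w u :=
    Finset.sum_nonneg fun u hu => hw u (Finset.mem_of_mem_erase hu)
  set s := ∑ u ∈ e.erase v, w u with hsdef
  have key : ∀ A ⊆ T, cylMass μ X T A = cylMass μ X (T ∪ e) ∅ *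
      (H.wt w A * if v ∈ A then 1 else 1 + s) := by
    intro A hA
    rw [cylMass_eq_sum hX hdisj hA, ← EndStructure.sum_wt_union hT he hev hA, Finset.mul_sum]
    refine Finset.sum_congr rfl fun D hD => ?_
    rw [← hTe]
    refine h _ ?_
    rw [hTe]
    exact Finset.union_subset_union hA (Finset.mem_powerset.1 hD)
  intro A hA
  rw [key A hA, key ∅ (by simp), wt_empty S]
  simp only [Finset.notMem_empty, if_false, one_mul]
  -- The factor `1 + s` belongs to configurations with `v` vacant. Taking it out as normalisation
  -- leaves `(1 + s)⁻¹` on those with `v` occupied.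
  have hwt : (H.wt w A * if v ∈ A then 1 else 1 + s) =
      (1 + s) * H.wt (fun x => if x = v then w v * (1 + s)⁻¹ else w x) A := by
    unfold wt
    split_ifs with h1 h2 h2
    · rw [← Finset.mul_prod_erase A _ h2, ← Finset.mul_prod_erase A _ h2, if_pos rfl,
        Finset.prod_congr rfl fun x hx => if_neg (Finset.ne_of_mem_erase hx)]
      field_simp
    · rw [Finset.prod_congr rfl fun x hx => if_neg (by rintro rfl; exact h2 hx), mul_comm]
    · simp
    · simp
  rw [hwt]
  ring

/-- Consistent families of messages: `m v e` is the effective activity of `v` as seen from the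
hyperedge `e`. -/
structure IsBoundaryLaw (H : Hypergraph V) (S : H.EndStructure k d) (lam : ℝ)
    (m : V → Finset V → ℝ) : Prop where
  nonneg : ∀ v e, 0 ≤ m v e
  eq : ∀ v, ∀ e ∈ S.edgesAt v,
    m v e = lam * ∏ f ∈ (S.edgesAt v).erase e, (1 + ∑ u ∈ f.erase v, m u f)⁻¹

/-- The activities on a subtree obtained from the messages of the hyperedges that leave it. -/
def lawWeight (S : H.EndStructure k d) (lam : ℝ) (m : V → Finset V → ℝ) (T : Finset V) (v : V) : ℝ :=
  lam * ∏ e ∈ (S.edgesAt v).filter (fun e => ¬ e ⊆ T), (1 + ∑ u ∈ e.erase v, m u e)⁻¹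

/-- `μ` has hard-core marginals on all finite subtrees, with activities given by `m`. -/
def HasLaw (S : H.EndStructure k d) (lam : ℝ) (m : V → Finset V → ℝ) (μ : Measure (Set V)) : Prop :=
  ∀ T, S.IsSubtree T → H.IsHardCore μ Set.univ T (lawWeight S lam m T)

variable {lam : ℝ} {m : V → Finset V → ℝ}

theorem lawWeight_nonneg (hlam : 0 < lam) (hm : IsBoundaryLaw H S lam m) (T : Finset V) (v : V) :
    0 ≤ lawWeight S lam m T v :=
  mul_nonneg hlam.le (Finset.prod_nonneg fun e _ =>
    inv_nonneg.2 (add_nonneg zero_le_one (Finset.sum_nonneg fun u _ => hm.nonneg u e)))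

/-- For an outer vertex `u` of `e`, every hyperedge except `e` leaves `T ∪ e`, so the activity of
`u` is the message `m u e`. Summing out these vertices puts at `v` precisely the factor that `e`
contributes once it leaves the subtree. -/
theorem IsHardCore.lawWeight_of_union_edge [IsFiniteMeasure μ] (hk : 1 ≤ k) (hlam : 0 < lam)
    (hm : IsBoundaryLaw H S lam m) (hX : MeasurableSet X) {T e : Finset V} {v : V}
    (hT : S.IsSubtree T) (he : H.IsEdge e) (hev : e ∩ T = {v})
    (h : H.IsHardCore μ X (T ∪ e) (lawWeight S lam m (T ∪ e))) :
    H.IsHardCore μ X T (lawWeight S lam m T) := by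
  have hve : v ∈ e ∩ T := by simp [hev]
  rw [Finset.mem_inter] at hve
  have hout : ∀ x ∈ e, x ≠ v → x ∉ T := by
    intro x hx hxv hxT
    have : x ∈ e ∩ T := Finset.mem_inter.2 ⟨hx, hxT⟩
    rw [hev, Finset.mem_singleton] at this
    exact hxv this
  obtain ⟨u₀, hu₀⟩ : (e.erase v).Nonempty := by
    rw [← Finset.card_pos, S.card_edge_erase he hve.1]; omega
  rw [Finset.mem_erase] at hu₀
  have heT : ¬ e ⊆ T := fun h => hout u₀ hu₀.2 hu₀.1 (h hu₀.2)
  have hsub : ∀ x ∈ T, ∀ f ∈ S.edgesAt x, f ≠ e → (f ⊆ T ∪ e ↔ f ⊆ T) := by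
    intro x hx f hf hfe
    rw [S.mem_edgesAt] at hf
    refine ⟨fun h y hy => ?_, fun h => h.trans Finset.subset_union_left⟩
    by_contra hyT
    have hye : y ∈ e := by simpa [hyT] using h hy
    exact hT.notMem_of_mem he hf.1 hve.1 hve.2 hye hyT hy hfe hf.2 hx
  have hnew : ∀ u ∈ e.erase v, lawWeight S lam m (T ∪ e) u = m u e := by
    intro u hu
    rw [Finset.mem_erase] at hu
    rw [hm.eq u e (S.mem_edgesAt.2 ⟨he, hu.2⟩), lawWeight]
    congr 2
    ext f
    simp only [Finset.mem_filter, Finset.mem_erase, S.mem_edgesAt]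
    constructor
    · rintro ⟨⟨hf, huf⟩, hfT⟩
      refine ⟨?_, hf, huf⟩
      rintro rfl
      exact hfT Finset.subset_union_right
    · rintro ⟨hfe, hf, huf⟩
      refine ⟨⟨hf, huf⟩, fun hfT => ?_⟩
      obtain ⟨y, hy⟩ : (f.erase u).Nonempty := by
        rw [← Finset.card_pos, S.card_edge_erase hf huf]; omega
      rw [Finset.mem_erase] at hy
      have hyT := hT.notMem_of_mem he hf hve.1 hve.2 hu.2 (hout u hu.2 hu.1) huf hfe hy.2
      have hye : y ∈ e := by simpa [hyT] using hfT hy.2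
      exact hfe (S.isEdge_eq_of_mem hf he hy.1 hy.2 huf hye hu.2)
  refine (h.of_union_edge hX hT he hev fun u _ => lawWeight_nonneg hlam hm _ u).congr ?_
  intro x hx
  rw [Finset.sum_congr rfl hnew]
  split_ifs with hxv
  · subst hxv
    rw [lawWeight, lawWeight]
    have : (S.edgesAt x).filter (fun f => ¬ f ⊆ T) =
        insert e ((S.edgesAt x).filter (fun f => ¬ f ⊆ T ∪ e)) := by
      ext f
      simp only [Finset.mem_filter, Finset.mem_insert]
      by_cases hfe : f = e
      · subst hfe
        simp [heT, S.mem_edgesAt, he, hve.1]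
      · refine ⟨fun hf => Or.inr ⟨hf.1, by rw [hsub x hx f hf.1 hfe]; exact hf.2⟩, ?_⟩
        rintro (hf | hf)
        · exact absurd hf hfe
        · exact ⟨hf.1, by rw [← hsub x hx f hf.1 hfe]; exact hf.2⟩
    rw [this, Finset.prod_insert (by simp)]
    ring
  · rw [lawWeight, lawWeight]
    congr 2
    ext f
    simp only [Finset.mem_filter]
    refine and_congr_right fun hf => ?_
    rw [hsub x hx f hf]
    rintro rfl
    exact hout x (S.mem_edgesAt.1 hf).2 hxv hx

theorem IsHardCore.lawWeight_of_subset [IsFiniteMeasure μ] (hk : 1 ≤ k) (hlam : 0 < lam)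
    (hm : IsBoundaryLaw H S lam m) (hX : MeasurableSet X) {T T' : Finset V}
    (hT : S.IsSubtree T) (hT' : S.IsSubtree T') (hTT : T ⊆ T')
    (h : H.IsHardCore μ X T' (lawWeight S lam m T')) :
    H.IsHardCore μ X T (lawWeight S lam m T) :=
  hT'.down_induction hk (Q := fun T => H.IsHardCore μ X T (lawWeight S lam m T)) h
    (fun _ _ _ hT he hev _ h => h.lawWeight_of_union_edge hk hlam hm hX hT he hev) hT hTT

theorem sum_wt_pos {T : Finset V} {w : V → ℝ} (S : H.EndStructure k d) (hw : ∀ v, 0 ≤ w v) :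
    0 < ∑ A ∈ T.powerset, H.wt w A := by
  refine Finset.sum_pos' (fun A _ => wt_nonneg fun v _ => hw v) ⟨∅, by simp, ?_⟩
  rw [wt_empty S]
  exact one_pos

theorem IsHardCore.cylMass_eq [IsProbabilityMeasure μ] {T : Finset V} {w : V → ℝ} (h : H.IsHardCore μ Set.univ T w) {A : Finset V} (hA : A ⊆ T) :
    cylMass μ Set.univ T A = (∑ B ∈ T.powerset, H.wt w B)⁻¹ * H.wt w A := by
  have h1 := sum_cylMass (μ := μ) .univ T
  rw [Finset.sum_congr rfl fun A hA => h A (Finset.mem_powerset.1 hA), ← Finset.mul_sum] at h1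
  rw [h A hA]
  congr 1
  exact eq_inv_of_mul_eq_one_left (by rw [h1]; simp)

theorem HasLaw.unique [Nonempty V] {ν : Measure (Set V)} [IsProbabilityMeasure μ] [IsProbabilityMeasure ν]
    (hμ : HasLaw S lam m μ) (hν : HasLaw S lam m ν) : μ = ν := by
  obtain ⟨o⟩ := ‹Nonempty V›
  refine eq_of_cylMass_eq fun F => ?_
  obtain ⟨n, hn⟩ := EndStructure.exists_subset_ballAt (S := S) o F
  refine ⟨_, hn, fun A hA => ?_⟩
  have hT := EndStructure.isSubtree_ballAt (S := S) o n
  rw [(hμ _ hT).cylMass_eq hA,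
    (hν _ hT).cylMass_eq hA]

/-- The finite-volume hard-core measure on `T` with activities `w`. -/
def finiteHardCore (H : Hypergraph V) (T : Finset V) (w : V → ℝ) : Measure (Set V) :=
  ∑ A ∈ T.powerset,
    ENNReal.ofReal ((∑ B ∈ T.powerset, H.wt w B)⁻¹ * H.wt w A) • Measure.dirac (A : Set V)

theorem isProbabilityMeasure_finiteHardCore (S : H.EndStructure k d) (T : Finset V) {w : V → ℝ}
    (hw : ∀ v, 0 ≤ w v) : IsProbabilityMeasure (finiteHardCore H T w) := by
  have hZ := sum_wt_pos (T := T) S hw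
  constructor
  simp only [finiteHardCore, Measure.finsetSum_apply, Measure.smul_apply, measure_univ, smul_eq_mul,
    mul_one]
  rw [← ENNReal.ofReal_sum_of_nonneg, ← Finset.mul_sum, inv_mul_cancel₀ hZ.ne', ENNReal.ofReal_one]
  exact fun A _ => mul_nonneg (inv_nonneg.2 hZ.le) (wt_nonneg fun v _ => hw v)

theorem isHardCore_finiteHardCore (S : H.EndStructure k d) (T : Finset V) {w : V → ℝ}
    (hw : ∀ v, 0 ≤ w v) : H.IsHardCore (finiteHardCore H T w) Set.univ T w := by
  have hZ := sum_wt_pos (T := T) S hw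
  have key : ∀ A ⊆ T, cylMass (finiteHardCore H T w) Set.univ T A =
      (∑ B ∈ T.powerset, H.wt w B)⁻¹ * H.wt w A := by
    intro A hA
    rw [cylMass, Set.inter_univ, measureReal_def]
    have hB : ∀ B ∈ T.powerset, Measure.dirac (B : Set V) {I | trace T I = A} =
        if B = A then 1 else 0 := by
      intro B hB
      rw [Measure.dirac_apply' _ (measurableSet_trace T (· = A)), Set.indicator_apply]
      have : trace T (B : Set V) = B := by
        ext v
        simp only [mem_trace, Finset.mem_coe]
        exact ⟨fun h => h.2, fun h => ⟨Finset.mem_powerset.1 hB h, h⟩⟩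
      simp [this]
    simp only [finiteHardCore, Measure.finsetSum_apply, Measure.smul_apply, smul_eq_mul]
    rw [Finset.sum_congr rfl fun B h => by rw [hB B h]]
    simp only [mul_ite, mul_one, mul_zero, Finset.sum_ite_eq', Finset.mem_powerset, hA, if_true]
    exact ENNReal.toReal_ofReal (mul_nonneg (inv_nonneg.2 hZ.le) (wt_nonneg fun v _ => hw v))
  intro A hA
  rw [key A hA, key ∅ (by simp), wt_empty S, mul_one]

/-- Finite-volume measures on growing balls restrict consistently to smaller subtrees, so each
cylinder mass is eventually constant along the sequence. -/
theorem IsBoundaryLaw.exists_hasLaw [Nonempty V] (hk : 1 ≤ k) (hlam : 0 < lam)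
    (hm : IsBoundaryLaw H S lam m) : ∃ μ, IsProbabilityMeasure μ ∧ HasLaw S lam m μ := by
  obtain ⟨o⟩ := ‹Nonempty V›
  have := S.countable
  have hw := lawWeight_nonneg hlam hm
  let P : ℕ → Measure (Set V) := fun n =>
    finiteHardCore H (S.ballAt o n) (lawWeight S lam m (S.ballAt o n))
  have hP : ∀ n, IsProbabilityMeasure (P n) := fun n => isProbabilityMeasure_finiteHardCore S _ (hw _)
  obtain ⟨μ, hμ, h⟩ := exists_measure_of_eventually_eq P
  refine ⟨μ, hμ, fun T hT => ?_⟩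
  have key : ∀ A ⊆ T, cylMass μ Set.univ T A =
      (∑ B ∈ T.powerset, H.wt (lawWeight S lam m T) B)⁻¹ * H.wt (lawWeight S lam m T) A := by
    intro A hA
    refine h T A _ ?_
    obtain ⟨n, hn⟩ := EndStructure.exists_subset_ballAt (S := S) o T
    filter_upwards [Filter.eventually_ge_atTop n] with j hj
    refine IsHardCore.cylMass_eq ?_ hA
    exact (isHardCore_finiteHardCore S _ (hw _)).lawWeight_of_subset hk hlam hm .univ hT
      (EndStructure.isSubtree_ballAt o j) (hn.trans (EndStructure.ballAt_mono o hj))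
  intro A hA
  rw [key A hA, key ∅ (by simp), wt_empty S, mul_one]

end Hypergraph

end

/-! ### The Gibbs property in terms of cylinder masses. -/

noncomputable section

open scoped Classical

namespace Hypergraph

variable {V : Type*} {H : Hypergraph V} {k d : ℕ} {S : H.EndStructure k d}
  {μ : Measure (Set V)} {X : Set (Set V)} {lam : ℝ} {m : V → Finset V → ℝ}

theorem measureReal_trace_eq_zero [IsFiniteMeasure μ] {T : Finset V} (p : Finset V → Prop)
    (h : ∀ A ⊆ T, p A → cylMass μ Set.univ T A = 0) : μ.real {I | p (trace T I)} = 0 := by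
  rw [← Set.inter_univ {I | p (trace T I)}, measureReal_trace .univ, Finset.sum_eq_zero]
  intro A hA
  rw [Finset.mem_filter, Finset.mem_powerset] at hA
  exact h A hA.1 hA.2

theorem outerBoundary_eq (S : H.EndStructure k d) (W : Finset V) :
    H.outerBoundary W = ((S.hull W \ W : Finset V) : Set V) := by
  ext u
  simp only [outerBoundary, Set.mem_ofPred_eq, Finset.mem_coe, Finset.mem_sdiff,
    EndStructure.mem_hull, S.adj_iff]
  grind

theorem trace_hull_eq_iff {W A : Finset V} (hA : A ⊆ W) {I : Set V} :
    trace (S.hull W) I = A ↔ trace (S.hull W \ W) I = ∅ ∧ trace W I = A := by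
  have hsub := EndStructure.subset_hull (S := S) W
  simp only [Finset.ext_iff, mem_trace, Finset.mem_sdiff, Finset.notMem_empty, iff_false]
  constructor
  · intro h
    exact ⟨fun x hx => hx.1.2 (hA ((h x).1 ⟨hx.1.1, hx.2⟩)), fun x =>
      ⟨fun hx => (h x).1 ⟨hsub hx.1, hx.2⟩, fun hx => ⟨hA hx, ((h x).2 hx).2⟩⟩⟩
  · rintro ⟨h1, h2⟩ x
    refine ⟨fun hx => (h2 x).1 ⟨?_, hx.2⟩, fun hx => ⟨hsub (hA hx), ((h2 x).2 hx).2⟩⟩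
    by_contra hxW
    exact h1 x ⟨⟨hx.1, hxW⟩, hx.2⟩

/-- Vacancy of the outer boundary together with the configuration `A` in `W` is a single cylinder
over `S.hull W`, so the conditional law is a ratio of cylinder masses. -/
theorem cond_real_eq [IsProbabilityMeasure μ] (S : H.EndStructure k d) {W A : Finset V}
    (hA : A ⊆ W) :
    μ[|{I | I ∩ H.outerBoundary W = ∅}].real {I | I ∩ W = (A : Set V)} =
      (∑ B ∈ W.powerset, cylMass μ Set.univ (S.hull W) B)⁻¹ * cylMass μ Set.univ (S.hull W) A := by
  have hD : {I : Set V | I ∩ H.outerBoundary W = ∅} = {I | trace (S.hull W \ W) I = ∅} := by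
    ext I
    rw [Set.mem_ofPred_eq, Set.mem_ofPred_eq, ← inter_eq_iff_trace, outerBoundary_eq S W,
      Finset.coe_empty]
  have hE : {I : Set V | I ∩ W = (A : Set V)} = {I | trace W I = A} := by
    ext I
    exact inter_eq_iff_trace
  have hDm : MeasurableSet {I : Set V | trace (S.hull W \ W) I = ∅} :=
    measurableSet_trace _ (· = ∅)
  have hcyl : ∀ B ⊆ W, cylMass μ {I | trace (S.hull W \ W) I = ∅} W B =
      cylMass μ Set.univ (S.hull W) B := by
    intro B hB
    rw [cylMass, cylMass, Set.inter_univ]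
    congr 1
    ext I
    rw [Set.mem_inter_iff, Set.mem_ofPred_eq, Set.mem_ofPred_eq, Set.mem_ofPred_eq,
      trace_hull_eq_iff hB, and_comm]
  rw [hD, hE, measureReal_def, cond_apply hDm, ENNReal.toReal_mul, ENNReal.toReal_inv,
    Set.inter_comm]
  change (μ.real _)⁻¹ * cylMass μ _ W A = _
  rw [hcyl A hA, ← sum_cylMass hDm W, Finset.sum_congr rfl fun B hB =>
    hcyl B (Finset.mem_powerset.1 hB)]

theorem indepPartition_eq (W : Finset V) :
    H.indepPartition lam W = ∑ A ∈ W.powerset, H.wt (fun _ => lam) A := by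
  rw [indepPartition, Finset.sum_filter]
  refine Finset.sum_congr rfl fun A _ => ?_
  simp [wt]

/-- A hard-core type identity on all neighbourhoods yields the Gibbs property. -/
theorem isGibbs_of_cylMass [IsProbabilityMeasure μ] (S : H.EndStructure k d) (hlam : 0 < lam)
    (hind : ∀ᵐ I ∂μ, H.IsIndep I)
    (hpos : ∀ W : Finset V, cylMass μ Set.univ (S.hull W) ∅ ≠ 0)
    (h : ∀ W : Finset V, ∀ A ⊆ W, cylMass μ Set.univ (S.hull W) A =
      cylMass μ Set.univ (S.hull W) ∅ * H.wt (fun _ => lam) A) : H.IsGibbs lam μ := by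
  refine ⟨inferInstance, hind, fun W A hA hAi => ?_⟩
  have hZ := sum_wt_pos (T := W) S (w := fun _ => lam) fun _ => hlam.le
  rw [cond_real_eq S hA, Finset.sum_congr rfl fun B hB => h W B (Finset.mem_powerset.1 hB),
    ← Finset.mul_sum, h W A hA, indepPartition_eq]
  have := hpos W
  rw [wt, if_pos hAi]
  simp only [Finset.prod_const]
  field_simp

theorem IsGibbs.cylMass_hull_pos (S : H.EndStructure k d) (hμ : H.IsGibbs lam μ) (hlam : 0 < lam)
    (W : Finset V) : 0 < cylMass μ Set.univ (S.hull W) ∅ := by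
  have := hμ.isProbabilityMeasure
  have hZ := sum_wt_pos (T := W) S (w := fun _ => lam) fun _ => hlam.le
  have h := hμ.cond_eq W ∅ (by simp) (by simpa using S.isIndep_empty)
  rw [cond_real_eq S (by simp), indepPartition_eq] at h
  refine (cylMass_nonneg _ _).lt_of_ne' fun h0 => ?_
  rw [h0, mul_zero, Finset.card_empty, pow_zero] at h
  exact (div_pos one_pos hZ).ne h

theorem cylMass_eq_zero (hind : ∀ᵐ I ∂μ, H.IsIndep I) {T A : Finset V}
    (hA : ¬ H.IsIndep (A : Set V)) : cylMass μ X T A = 0 := by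
  rw [cylMass, measureReal_def, measure_mono_null Set.inter_subset_left, ENNReal.toReal_zero]
  refine measure_mono_null ?_ hind
  intro I hI hIi
  rw [Set.mem_ofPred_eq] at hI
  exact hA (hIi.mono (by rw [← hI, coe_trace]; exact Set.inter_subset_left))

/-- The conditional formula for `A` divided by that for the empty configuration; the partition
function and the conditioning cancel. -/
theorem IsGibbs.cylMass_hull (S : H.EndStructure k d) (hμ : H.IsGibbs lam μ) (hlam : 0 < lam)
    {W A : Finset V} (hA : A ⊆ W) : cylMass μ Set.univ (S.hull W) A =
      cylMass μ Set.univ (S.hull W) ∅ * H.wt (fun _ => lam) A := by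
  have := hμ.isProbabilityMeasure
  by_cases hAi : H.IsIndep (A : Set V)
  · have hZ := sum_wt_pos (T := W) S (w := fun _ => lam) fun _ => hlam.le
    have h := hμ.cond_eq W A hA hAi
    have h0 := hμ.cond_eq W ∅ (by simp) (by simpa using S.isIndep_empty)
    have hp := hμ.cylMass_hull_pos S hlam W
    rw [cond_real_eq S hA, indepPartition_eq] at h
    rw [cond_real_eq S (by simp), indepPartition_eq, Finset.card_empty, pow_zero] at h0
    have hs : (∑ B ∈ W.powerset, cylMass μ Set.univ (S.hull W) B)⁻¹ ≠ 0 := by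
      intro hs
      rw [hs, zero_mul] at h0
      exact (div_pos one_pos hZ).ne h0
    refine mul_left_cancel₀ hs ?_
    rw [h, ← mul_assoc, h0, wt, if_pos hAi, Finset.prod_const]
    ring
  · rw [cylMass_eq_zero hμ.ae_isIndep hAi, wt, if_neg hAi, mul_zero]

theorem edge_subset_of_hull_subset {T W : Finset V} (h : S.hull W ⊆ T) {v : V} (hv : v ∈ W) :
    (S.edgesAt v).filter (fun e => ¬ e ⊆ T) = ∅ := by
  refine Finset.filter_eq_empty_iff.2 fun e he => ?_
  rw [S.mem_edgesAt] at he
  exact not_not.2 ((EndStructure.edge_subset_hull hv he.1 he.2).trans h)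

/-- Inside a ball containing `S.hull W`, no hyperedge at a vertex of `W` leaves the ball, so these
vertices have activity exactly `lam`. With the outer boundary of `W` vacant, the rest of the ball
does not interact with `W` and contributes a constant factor. The set `W` itself need not be
connected. -/
theorem HasLaw.isGibbs [Nonempty V] [IsProbabilityMeasure μ] (hlam : 0 < lam)
    (hm : IsBoundaryLaw H S lam m) (h : HasLaw S lam m μ) : H.IsGibbs lam μ := by
  obtain ⟨o⟩ := ‹Nonempty V›
  have hc := S.countable
  have hw := lawWeight_nonneg hlam hm
  have key : ∀ W : Finset V, ∃ c : ℝ, c ≠ 0 ∧ ∀ A ⊆ W, cylMass μ Set.univ (S.hull W) A =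
      c * H.wt (fun _ => lam) A := by
    intro W
    obtain ⟨n, hn⟩ := EndStructure.exists_subset_ballAt (S := S) o (S.hull W)
    set T := S.ballAt o n
    have hT := h T (EndStructure.isSubtree_ballAt o n)
    have hZ := sum_wt_pos (T := T) S (hw T)
    have hlamW : ∀ v ∈ W, lawWeight S lam m T v = lam := by
      intro v hv
      rw [lawWeight, edge_subset_of_hull_subset hn hv, Finset.prod_empty, mul_one]
    have hcT : 0 < cylMass μ Set.univ T ∅ := by
      rw [hT.cylMass_eq (by simp), wt_empty S, mul_one]
      exact inv_pos.2 hZ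
    refine ⟨cylMass μ Set.univ T ∅ * ∑ B ∈ (T \ S.hull W).powerset, H.wt (lawWeight S lam m T) B,
      (mul_pos hcT (sum_wt_pos S (hw T))).ne', fun A hA => ?_⟩
    rw [cylMass_eq_sum .univ Finset.disjoint_sdiff (hA.trans (EndStructure.subset_hull W)),
      mul_assoc, Finset.sum_mul, Finset.mul_sum]
    refine Finset.sum_congr rfl fun B hB => ?_
    rw [Finset.mem_powerset] at hB
    have hAT : A ⊆ T := (hA.trans (EndStructure.subset_hull W)).trans hn
    rw [Finset.union_sdiff_of_subset hn,
      hT _ (Finset.union_subset hAT (hB.trans Finset.sdiff_subset))]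
    congr 1
    have hBh : ∀ y ∈ B, y ∉ S.hull W := fun y hy => (Finset.mem_sdiff.1 (hB hy)).2
    have hdisj : Disjoint A B := Finset.disjoint_left.2 fun x hx hxB =>
      hBh x hxB (EndStructure.subset_hull W (hA hx))
    have hadj : ∀ x ∈ A, ∀ y ∈ B, ¬ H.Adj x y := by
      intro x hx y hy hxy
      obtain ⟨e, he, hxe, hye⟩ := S.adj_iff.1 hxy
      exact hBh y hy (EndStructure.edge_subset_hull (hA hx) he hxe hye)
    have hiff : H.IsIndep ((A ∪ B : Finset V) : Set V) ↔
        H.IsIndep (A : Set V) ∧ H.IsIndep (B : Set V) := by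
      refine ⟨fun h => ⟨h.mono (by simp), h.mono (by simp)⟩, fun ⟨h1, h2⟩ => ?_⟩
      rw [S.isIndep_iff] at h1 h2 ⊢
      intro x hx y hy hxy
      simp only [Finset.coe_union, Set.mem_union, Finset.mem_coe] at hx hy
      rcases hx with hx | hx <;> rcases hy with hy | hy
      · exact h1 x hx y hy hxy
      · exact absurd hxy (hadj x hx y hy)
      · exact absurd hxy.symm (hadj y hy x hx)
      · exact h2 x hx y hy hxy
    simp only [wt, hiff]
    by_cases hAi : H.IsIndep (A : Set V) <;> by_cases hBi : H.IsIndep (B : Set V)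
    · simp only [hAi, hBi, and_self, if_true]
      rw [Finset.prod_union hdisj, Finset.prod_congr rfl fun v hv => hlamW v (hA hv), mul_comm]
    all_goals simp [hAi, hBi]
  have hind : ∀ᵐ I ∂μ, H.IsIndep I := by
    have hpair : ∀ x y, x ≠ y → H.Adj x y → ∀ᵐ I ∂μ, ¬ (x ∈ I ∧ y ∈ I) := by
      intro x y hxy hadj
      obtain ⟨n, hn⟩ := EndStructure.exists_subset_ballAt (S := S) o {x, y}
      set T := S.ballAt o n
      have hT := h T (EndStructure.isSubtree_ballAt o n)
      have hxT : x ∈ T := hn (by simp)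
      have hyT : y ∈ T := hn (by simp)
      have h0 := measureReal_trace_eq_zero (μ := μ) (T := T) (fun A => x ∈ A ∧ y ∈ A) (by
        intro A hA hxyA
        rw [hT A hA, wt, if_neg, mul_zero]
        rw [S.isIndep_iff]
        intro hi
        exact hxy (hi x hxyA.1 y hxyA.2 hadj))
      have : {I : Set V | x ∈ trace T I ∧ y ∈ trace T I} = {I | x ∈ I ∧ y ∈ I} := by
        ext I
        simp [mem_trace, hxT, hyT]
      rw [this, measureReal_eq_zero_iff] at h0
      rw [ae_iff]
      simpa using h0
    have hall : ∀ᵐ I ∂μ, ∀ x y, x ≠ y → H.Adj x y → ¬ (x ∈ I ∧ y ∈ I) := by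
      refine ae_all_iff.2 fun x => ae_all_iff.2 fun y => ?_
      by_cases h : x ≠ y ∧ H.Adj x y
      · filter_upwards [hpair x y h.1 h.2] with I hI _ _ using hI
      · exact Filter.Eventually.of_forall fun I h1 h2 => absurd ⟨h1, h2⟩ h
    filter_upwards [hall] with I hI
    rw [S.isIndep_iff]
    intro x hx y hy hxy
    by_contra hne
    exact hI x y hne hxy ⟨hx, hy⟩
  have key0 : ∀ W : Finset V, ∀ c : ℝ, (∀ A ⊆ W, cylMass μ Set.univ (S.hull W) A =
      c * H.wt (fun _ => lam) A) → cylMass μ Set.univ (S.hull W) ∅ = c := by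
    intro W c hc
    rw [hc ∅ (by simp), wt_empty S, mul_one]
  refine isGibbs_of_cylMass S hlam hind (fun W => ?_) (fun W A hA => ?_)
  · obtain ⟨c, hc0, hc⟩ := key W
    rw [key0 W c hc]
    exact hc0
  · obtain ⟨c, hc0, hc⟩ := key W
    rw [key0 W c hc, hc A hA]

end Hypergraph

end

/-! ### Uniqueness up to the critical activity. -/

noncomputable section

open scoped Classical

namespace Hypergraph

variable {V : Type*} {H : Hypergraph V} {k d : ℕ} {S : H.EndStructure k d}
  {μ : Measure (Set V)} {X : Set (Set V)} {lam : ℝ} {m : V → Finset V → ℝ}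

/-- The hyperedges at `v` that are not contained in `T`. -/
def outAt (S : H.EndStructure k d) (T : Finset V) (v : V) : Finset (Finset V) :=
  (S.edgesAt v).filter fun e => ¬ e ⊆ T

theorem mem_outAt {T : Finset V} {v : V} {e : Finset V} :
    e ∈ outAt S T v ↔ (H.IsEdge e ∧ v ∈ e) ∧ ¬ e ⊆ T := by
  rw [outAt, Finset.mem_filter, S.mem_edgesAt]

theorem outAt_hull {T : Finset V} {v : V} (hv : v ∈ T) : outAt S (S.hull T) v = ∅ :=
  edge_subset_of_hull_subset le_rfl hv

/-- A new boundary vertex `u` has just one hyperedge inside the hull, the one it was reached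
through. The other `d` account for the exponent in the recursion. -/
theorem card_outAt_hull (hk : 1 ≤ k) {T : Finset V} (hT : S.IsSubtree T) {v u : V} (hv : v ∈ T)
    {e : Finset V} (he : e ∈ outAt S T v) (hu : u ∈ e.erase v) :
    #(outAt S (S.hull T) u) = d := by
  rw [mem_outAt] at he
  rw [Finset.mem_erase] at hu
  have hev := hT.inter_eq he.1.1 he.1.2 hv he.2
  have hout : ∀ x ∈ e, x ≠ v → x ∉ T := fun x hx hxv hxT =>
    he.2 (hT.edge_subset he.1.1 hxv hx he.1.2 hxT hv)
  have : outAt S (S.hull T) u = (S.edgesAt u).erase e := by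
    ext f
    rw [mem_outAt, Finset.mem_erase, S.mem_edgesAt]
    constructor
    · rintro ⟨hf, hfT⟩
      refine ⟨?_, hf⟩
      rintro rfl
      exact hfT (EndStructure.edge_subset_hull hv he.1.1 he.1.2)
    · rintro ⟨hfe, hf⟩
      refine ⟨hf, fun hfT => ?_⟩
      obtain ⟨y, hy⟩ : (f.erase u).Nonempty := by
        rw [← Finset.card_pos, S.card_edge_erase hf.1 hf.2]; omega
      rw [Finset.mem_erase] at hy
      have hyT := hT.notMem_of_mem he.1.1 hf.1 he.1.2 hv hu.2 (hout u hu.2 hu.1) hf.2 hfe hy.2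
      obtain ⟨v', hv', e', he', hve', hye'⟩ := EndStructure.mem_hull.1 (hfT hy.2)
      have hye : y ∉ e := fun hye =>
        hfe (S.isEdge_eq_of_mem hf.1 he.1.1 hy.1 hy.2 hf.2 hye hu.2)
      by_cases hfe' : f = e'
      · subst hfe'
        exact hT.notMem_of_mem he.1.1 hf.1 he.1.2 hv hu.2 (hout u hu.2 hu.1) hf.2 hfe hve' hv'
      · exact (hT.union_edge he.1.1 hev).notMem_of_mem he' hf.1 hve' (Finset.mem_union_left _ hv')
          hye' (by simp [hyT, hye]) hy.2 hfe' hf.2 (Finset.mem_union_right _ hu.2)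
  rw [this, Finset.card_erase_of_mem (S.mem_edgesAt.2 ⟨he.1.1, hu.2⟩), S.card_edgesAt hk]
  rfl

/-- Summing out several hyperedges attached to a subtree. -/
theorem IsHardCore.of_union_edges [IsFiniteMeasure μ] (hX : MeasurableSet X) {T : Finset V}
    (hT : S.IsSubtree T) (F : Finset (Finset V)) (hF : ∀ e ∈ F, ∃ v ∈ T, e ∈ outAt S T v) :
    S.IsSubtree (T ∪ F.biUnion id) ∧ ∀ w : V → ℝ, (∀ v, 0 ≤ w v) →
      H.IsHardCore μ X (T ∪ F.biUnion id) w →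
      H.IsHardCore μ X T fun v =>
        w v * ∏ e ∈ F.filter (fun e => v ∈ e), (1 + ∑ u ∈ e.erase v, w u)⁻¹ := by
  induction F using Finset.induction_on with
  | empty =>
    simp only [Finset.biUnion_empty, Finset.union_empty, Finset.filter_empty, Finset.prod_empty,
      mul_one]
    exact ⟨hT, fun w _ h => h⟩
  | insert e F heF ih =>
    obtain ⟨ih1, ih2⟩ := ih fun f hf => hF f (Finset.mem_insert_of_mem hf)
    obtain ⟨v, hv, he⟩ := hF e (Finset.mem_insert_self e F)
    rw [mem_outAt] at he
    have hout : ∀ f v, H.IsEdge f → v ∈ f → v ∈ T → ¬ f ⊆ T → ∀ x ∈ f, x ≠ v → x ∉ T :=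
      fun f v hf hvf hv hfT x hx hxv hxT => hfT (hT.edge_subset hf hxv hx hvf hxT hv)
    have hev : e ∩ (T ∪ F.biUnion id) = {v} := by
      ext x
      simp only [Finset.mem_inter, Finset.mem_singleton]
      constructor
      · rintro ⟨hxe, hx⟩
        by_contra hxv
        have hxT := hout e v he.1.1 he.1.2 hv he.2 x hxe hxv
        simp only [Finset.mem_union, hxT, false_or, Finset.mem_biUnion, id] at hx
        obtain ⟨f, hfF, hxf⟩ := hx
        obtain ⟨y, hy, hf⟩ := hF f (Finset.mem_insert_of_mem hfF)
        rw [mem_outAt] at hf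
        exact hT.notMem_of_mem he.1.1 hf.1.1 he.1.2 hv hxe hxT hxf
          (by rintro rfl; exact heF hfF) hf.1.2 hy
      · rintro rfl
        exact ⟨he.1.2, Finset.mem_union_left _ hv⟩
    have hunion : T ∪ (insert e F).biUnion id = (T ∪ F.biUnion id) ∪ e := by
      rw [Finset.biUnion_insert, id, Finset.union_comm e, Finset.union_assoc]
    rw [hunion]
    refine ⟨ih1.union_edge he.1.1 hev, fun w hw h => ?_⟩
    have hs : ∀ f : Finset V, ∀ x, 0 ≤ (1 + ∑ u ∈ f.erase x, w u)⁻¹ := fun f x =>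
      inv_nonneg.2 (add_nonneg zero_le_one (Finset.sum_nonneg fun u _ => hw u))
    refine (ih2 _ (fun x => ?_) (h.of_union_edge hX ih1 he.1.1 hev fun u _ => hw u)).congr ?_
    · split_ifs
      · exact mul_nonneg (hw v) (hs e v)
      · exact hw x
    · intro x hx
      have hsum : ∀ f ∈ F.filter (fun e => x ∈ e),
          (1 + ∑ u ∈ f.erase x, if u = v then w v * (1 + ∑ u ∈ e.erase v, w u)⁻¹ else w u)⁻¹ =
          (1 + ∑ u ∈ f.erase x, w u)⁻¹ := by
        intro f hf
        rw [Finset.mem_filter] at hf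
        obtain ⟨y, hy, hfy⟩ := hF f (Finset.mem_insert_of_mem hf.1)
        rw [mem_outAt] at hfy
        congr 2
        refine Finset.sum_congr rfl fun u hu => if_neg ?_
        rw [Finset.mem_erase] at hu
        rintro rfl
        exact hout f x hfy.1.1 hf.2 hx hfy.2 u hu.2 hu.1 hv
      rw [Finset.prod_congr rfl hsum]
      split_ifs with hxv
      · subst hxv
        rw [Finset.filter_insert, if_pos he.1.2, Finset.prod_insert (by simp [heF])]
        ring
      · rw [Finset.filter_insert, if_neg]
        intro hxe
        exact hout e v he.1.1 he.1.2 hv he.2 x hxe hxv hx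

/-- Peeling a whole layer: the leaving hyperedges are disjoint outside `T`, so their factors
multiply. -/
theorem IsHardCore.of_hull [IsFiniteMeasure μ] (hX : MeasurableSet X) {T : Finset V}
    (hT : S.IsSubtree T) {w : V → ℝ} (hw : ∀ v, 0 ≤ w v) (h : H.IsHardCore μ X (S.hull T) w) :
    H.IsHardCore μ X T fun v => w v * ∏ e ∈ outAt S T v, (1 + ∑ u ∈ e.erase v, w u)⁻¹ := by
  have hF : ∀ e ∈ T.biUnion (outAt S T), ∃ v ∈ T, e ∈ outAt S T v := by simp
  have hun : T ∪ (T.biUnion (outAt S T)).biUnion id = S.hull T := by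
    ext x
    simp only [Finset.mem_union, Finset.mem_biUnion, mem_outAt, id, EndStructure.mem_hull]
    constructor
    · rintro (hx | ⟨e, ⟨v, hv, he, _⟩, hxe⟩)
      · exact ⟨x, hx, S.up x, S.isEdge_up x, S.mem_up x, S.mem_up x⟩
      · exact ⟨v, hv, e, he.1, he.2, hxe⟩
    · rintro ⟨v, hv, e, he, hve, hxe⟩
      by_cases heT : e ⊆ T
      · exact Or.inl (heT hxe)
      · exact Or.inr ⟨e, ⟨v, hv, ⟨he, hve⟩, heT⟩, hxe⟩
  refine ((IsHardCore.of_union_edges hX hT _ hF).2 w hw (by rw [hun]; exact h)).congr ?_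
  intro v hv
  congr 1
  refine Finset.prod_congr ?_ fun _ _ => rfl
  ext e
  simp only [Finset.mem_filter, Finset.mem_biUnion, mem_outAt]
  constructor
  · rintro ⟨⟨x, hx, he, heT⟩, hve⟩
    exact ⟨⟨he.1, hve⟩, heT⟩
  · rintro ⟨⟨he, hve⟩, heT⟩
    exact ⟨⟨v, hv, ⟨he, hve⟩, heT⟩, hve⟩

open HardCoreRecursion

/-- Inside `X`, the part in `T` is hard-core with activities controlled by the `n`-th bounds. -/
def IsBoundedHardCore (S : H.EndStructure k d) (lam : ℝ) (μ : Measure (Set V)) (X : Set (Set V))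
    (T : Finset V) (n : ℕ) : Prop :=
  ∃ w : V → ℝ, (∀ v, 0 ≤ w v) ∧ H.IsHardCore μ X T w ∧ ∀ v ∈ T,
    lam * (bounds (k * lam) d n).1 ^ #(outAt S T v) ≤ w v ∧
    w v ≤ lam * (bounds (k * lam) d n).2 ^ #(outAt S T v)

/-- Removing a layer is one step of the recursion. Vertices of `T` have activity exactly `lam`
inside the hull, because no hyperedge at them leaves it. Each removed hyperedge carries `k` outer
vertices with `d` leaving hyperedges each, so its factor lies between the two values of `step`; as
`step` is decreasing, upper and lower bounds change places. -/
theorem IsBoundedHardCore.succ [IsFiniteMeasure μ] (hk : 1 ≤ k) (hlam : 0 < lam)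
    (hX : MeasurableSet X) {T : Finset V} (hT : S.IsSubtree T) {n : ℕ}
    (h : IsBoundedHardCore S lam μ X (S.hull T) n) : IsBoundedHardCore S lam μ X T (n + 1) := by
  obtain ⟨w, hw, hhc, hb⟩ := h
  have hL : 0 < k * lam := mul_pos (by exact_mod_cast hk) hlam
  have hbd := bounds_mem hL d n
  have hwv : ∀ v ∈ T, w v = lam := by
    intro v hv
    have := hb v (EndStructure.subset_hull T hv)
    rw [outAt_hull hv] at this
    simp only [Finset.card_empty, pow_zero, mul_one] at this
    exact le_antisymm this.2 this.1
  have hedge : ∀ v ∈ T, ∀ e ∈ outAt S T v,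
      (bounds (k * lam) d (n + 1)).1 ≤ (1 + ∑ u ∈ e.erase v, w u)⁻¹ ∧
      (1 + ∑ u ∈ e.erase v, w u)⁻¹ ≤ (bounds (k * lam) d (n + 1)).2 := by
    intro v hv e he
    have he' := mem_outAt.1 he
    have hu : ∀ u ∈ e.erase v, lam * (bounds (k * lam) d n).1 ^ d ≤ w u ∧
        w u ≤ lam * (bounds (k * lam) d n).2 ^ d := by
      intro u hu
      have := hb u (EndStructure.edge_subset_hull hv he'.1.1 he'.1.2 (Finset.mem_of_mem_erase hu))
      rwa [card_outAt_hull hk hT hv he hu] at this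
    have h1 := Finset.card_nsmul_le_sum _ _ _ fun u h => (hu u h).1
    have h2 := Finset.sum_le_card_nsmul _ _ _ fun u h => (hu u h).2
    rw [S.card_edge_erase he'.1.1 he'.1.2, nsmul_eq_mul, ← mul_assoc] at h1 h2
    rw [bounds_succ]
    have h0 : 0 ≤ k * lam * (bounds (k * lam) d n).1 ^ d :=
      mul_nonneg hL.le (pow_nonneg hbd.1 d)
    unfold step
    constructor <;> apply inv_anti₀ <;> linarith
  refine ⟨_, fun v => mul_nonneg (hw v) (Finset.prod_nonneg fun e _ => inv_nonneg.2
    (add_nonneg zero_le_one (Finset.sum_nonneg fun u _ => hw u))), hhc.of_hull hX hT hw, ?_⟩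
  intro v hv
  have hbd' := bounds_mem hL d (n + 1)
  have h1 := Finset.prod_le_prod (s := outAt S T v) (fun _ _ => hbd'.1) fun e he => (hedge v hv e he).1
  have h2 := Finset.prod_le_prod (s := outAt S T v)
    (fun e he => hbd'.1.trans (hedge v hv e he).1) fun e he => (hedge v hv e he).2
  rw [Finset.prod_const] at h1 h2
  rw [hwv v hv]
  exact ⟨mul_le_mul_of_nonneg_left h1 hlam.le, mul_le_mul_of_nonneg_left h2 hlam.le⟩

theorem IsBoundedHardCore.of_iterate [IsFiniteMeasure μ] (hk : 1 ≤ k) (hlam : 0 < lam)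
    (hX : MeasurableSet X) (n : ℕ) {T : Finset V} (hT : S.IsSubtree T) {j : ℕ}
    (h : IsBoundedHardCore S lam μ X (S.hull^[n] T) j) : IsBoundedHardCore S lam μ X T (n + j) := by
  induction n generalizing T with
  | zero => simpa using h
  | succ n ih =>
    rw [Function.iterate_succ_apply] at h
    have := (ih hT.hull h).succ hk hlam hX hT
    rwa [show n + j + 1 = n + 1 + j by ring] at this

/-- The Gibbs property conditions only on vacant boundaries. To treat an occupied set `C`, it is
applied to the window `U ∪ C`: by independence the neighbours of `C` are almost surely vacant, so
prescribing the configuration on `U` and on its boundary is the same as prescribing it on the hull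
of `U ∪ C`. -/
theorem IsGibbs.isHardCore_of_boundary (S : H.EndStructure k d) (hμ : H.IsGibbs lam μ)
    (hlam : 0 < lam) {U C : Finset V} (hC : C ⊆ S.hull U \ U) :
    H.IsHardCore μ {I | trace (S.hull U \ U) I = C} U
      fun v => if ∃ c ∈ C, H.Adj v c then 0 else lam := by
  intro A hA
  have hdisj : Disjoint A C := Finset.disjoint_left.2 fun x hx hxC =>
    (Finset.mem_sdiff.1 (hC hxC)).2 (hA hx)
  have hAC : ¬ H.IsIndep ((A ∪ C : Finset V) : Set V) →
      cylMass μ {I | trace (S.hull U \ U) I = C} U A = 0 := by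
    intro hi
    rw [cylMass, measureReal_def, measure_mono_null _ hμ.ae_isIndep, ENNReal.toReal_zero]
    rintro I ⟨h1, h2⟩ hIi
    rw [Set.mem_ofPred_eq] at h1 h2
    refine hi (hIi.mono ?_)
    rw [Finset.coe_union, ← h1, ← h2, coe_trace, coe_trace]
    exact Set.union_subset Set.inter_subset_left Set.inter_subset_left
  have hmain : ∀ B ⊆ U, H.IsIndep (C : Set V) →
      cylMass μ {I | trace (S.hull U \ U) I = C} U B =
      cylMass μ Set.univ (S.hull (U ∪ C)) ∅ * H.wt (fun _ => lam) (B ∪ C) := by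
    intro B hB hCi
    rw [← hμ.cylMass_hull S hlam (Finset.union_subset_union hB le_rfl)]
    simp only [cylMass, measureReal_def, Set.inter_univ]
    congr 1
    apply measure_congr
    filter_upwards [hμ.ae_isIndep] with I hI
    rw [S.isIndep_iff] at hI
    have hsub := EndStructure.hull_mono (S := S) (Finset.subset_union_left (s₁ := U) (s₂ := C))
    have hsub' := EndStructure.subset_hull (S := S) (U ∪ C)
    have hsubU := EndStructure.subset_hull (S := S) U
    apply propext
    change (trace U I = B ∧ trace (S.hull U \ U) I = C) ↔ trace (S.hull (U ∪ C)) I = B ∪ C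
    simp only [Finset.ext_iff, mem_trace, Finset.mem_union, Finset.mem_sdiff]
    constructor
    · rintro ⟨h1, h2⟩ x
      constructor
      · rintro ⟨hx, hxI⟩
        obtain ⟨v, hv, e, he, hve, hxe⟩ := EndStructure.mem_hull.1 hx
        rcases Finset.mem_union.1 hv with hvU | hvC
        · by_cases hxU : x ∈ U
          · exact Or.inl ((h1 x).1 ⟨hxU, hxI⟩)
          · exact Or.inr ((h2 x).1 ⟨⟨EndStructure.edge_subset_hull hvU he hve hxe, hxU⟩, hxI⟩)
        · have := hI v ((h2 v).2 hvC).2 x hxI ⟨e, he, hve, hxe⟩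
          exact Or.inr (this ▸ hvC)
      · rintro (hx | hx)
        · exact ⟨hsub' (Finset.mem_union_left _ (hB hx)), ((h1 x).2 hx).2⟩
        · exact ⟨hsub' (Finset.mem_union_right _ hx), ((h2 x).2 hx).2⟩
    · intro h
      have hCU : ∀ x, x ∈ C → x ∈ S.hull U ∧ x ∉ U := fun x hx => Finset.mem_sdiff.1 (hC hx)
      refine ⟨fun x => ⟨fun hx => ?_, fun hx => ⟨hB hx, ((h x).2 (Or.inl hx)).2⟩⟩,
        fun x => ⟨fun hx => ?_, fun hx => ⟨hCU x hx, ((h x).2 (Or.inr hx)).2⟩⟩⟩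
      · rcases (h x).1 ⟨hsub (hsubU hx.1), hx.2⟩ with h' | h'
        · exact h'
        · exact absurd hx.1 (hCU x h').2
      · rcases (h x).1 ⟨hsub hx.1.1, hx.2⟩ with h' | h'
        · exact absurd (hB h') hx.1.2
        · exact h'
  by_cases hCi : H.IsIndep (C : Set V)
  swap
  · have h1 := hAC fun h => hCi (h.mono (by simp))
    have h0 : cylMass μ {I | trace (S.hull U \ U) I = C} U ∅ = 0 := by
      rw [cylMass, measureReal_def, measure_mono_null _ hμ.ae_isIndep, ENNReal.toReal_zero]
      rintro I ⟨h1, h2⟩ hIi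
      rw [Set.mem_ofPred_eq] at h2
      refine hCi (hIi.mono ?_)
      rw [← h2, coe_trace]
      exact Set.inter_subset_left
    rw [h1, h0, zero_mul]
  rw [hmain A hA hCi, hmain ∅ (by simp) hCi, Finset.empty_union]
  rw [wt, wt, wt, if_pos hCi]
  by_cases hAi : H.IsIndep (A : Set V)
  swap
  · rw [if_neg fun h => hAi (h.mono (by simp)), if_neg hAi]
    ring
  rw [if_pos hAi]
  by_cases hadj : ∃ v ∈ A, ∃ c ∈ C, H.Adj v c
  · obtain ⟨v, hv, c, hc, hvc⟩ := hadj
    have hz : ∏ v ∈ A, (if ∃ c ∈ C, H.Adj v c then 0 else lam) = 0 :=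
      Finset.prod_eq_zero hv (if_pos ⟨c, hc, hvc⟩)
    rw [if_neg, hz]
    · ring
    · rw [S.isIndep_iff]
      intro h
      have := h v (by simp [hv]) c (by simp [hc]) hvc
      exact Finset.disjoint_left.1 hdisj hv (this ▸ hc)
  · push Not at hadj
    rw [if_pos, Finset.prod_union hdisj, Finset.prod_congr (s₂ := A) rfl
      fun v hv => if_neg (by push Not; exact hadj v hv)]
    · ring
    · rw [S.isIndep_iff] at hAi hCi ⊢
      intro x hx y hy hxy
      simp only [Finset.coe_union, Set.mem_union, Finset.mem_coe] at hx hy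
      rcases hx with hx | hx <;> rcases hy with hy | hy
      · exact hAi x hx y hy hxy
      · exact absurd hxy (hadj x hx y hy)
      · exact absurd hxy.symm (hadj y hy x hx)
      · exact hCi x hx y hy hxy

theorem IsGibbs.isBoundedHardCore_zero (S : H.EndStructure k d) (hμ : H.IsGibbs lam μ)
    (hlam : 0 < lam) {U C : Finset V} (hC : C ⊆ S.hull U \ U) :
    IsBoundedHardCore S lam μ {I | trace (S.hull U \ U) I = C} U 0 := by
  refine ⟨_, fun v => ?_, hμ.isHardCore_of_boundary S hlam hC, fun v hv => ?_⟩
  · split_ifs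
    exacts [le_rfl, hlam.le]
  · simp only [bounds, Function.iterate_zero, id, one_pow, mul_one]
    split_ifs with h
    · refine ⟨?_, hlam.le⟩
      obtain ⟨c, hc, hvc⟩ := h
      obtain ⟨e, he, hve, hce⟩ := S.adj_iff.1 hvc
      -- The lower bound has to vanish here, and `0 ^ 0 = 1`, so a leaving hyperedge is needed: the
      -- one joining `v` to `c` serves.
      have : outAt S U v ≠ ∅ := by
        refine Finset.nonempty_iff_ne_empty.1 ⟨e, mem_outAt.2 ⟨⟨he, hve⟩, fun heU => ?_⟩⟩
        exact (Finset.mem_sdiff.1 (hC hc)).2 (heU hce)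
      rw [zero_pow (by simpa using this), mul_zero]
    · exact ⟨mul_le_of_le_one_right hlam.le (pow_le_one₀ le_rfl zero_le_one), le_rfl⟩

/-- Split according to the configuration on the boundary of the `n`-fold hull. Each piece obeys the
bounds after `n` peelings, and the bounds do not depend on the piece. -/
theorem IsGibbs.cylMass_bounds (S : H.EndStructure k d) (hk : 1 ≤ k) (hμ : H.IsGibbs lam μ)
    (hlam : 0 < lam) {T : Finset V} (hT : S.IsSubtree T) {A : Finset V} (hA : A ⊆ T) (n : ℕ) :
    cylMass μ Set.univ T ∅ *
      H.wt (fun v => lam * (bounds (k * lam) d n).1 ^ #(outAt S T v)) A ≤ cylMass μ Set.univ T A ∧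
    cylMass μ Set.univ T A ≤ cylMass μ Set.univ T ∅ *
      H.wt (fun v => lam * (bounds (k * lam) d n).2 ^ #(outAt S T v)) A := by
  have := hμ.isProbabilityMeasure
  have hL : 0 < k * lam := mul_pos (by exact_mod_cast hk) hlam
  have hbd := bounds_mem hL d n
  set U := S.hull^[n] T with hU
  have hsplit : ∀ B, cylMass μ Set.univ T B = ∑ C ∈ (S.hull U \ U).powerset,
      cylMass μ {I | trace (S.hull U \ U) I = C} T B := by
    intro B
    have h1 := sum_cylMass (μ := μ) (measurableSet_trace T (· = B)) (S.hull U \ U)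
    rw [cylMass, Set.inter_univ, ← h1]
    refine Finset.sum_congr rfl fun C _ => ?_
    rw [cylMass, cylMass, Set.inter_comm]
  have hC : ∀ C ∈ (S.hull U \ U).powerset,
      IsBoundedHardCore S lam μ {I | trace (S.hull U \ U) I = C} T n := by
    intro C hC
    have h0 := hμ.isBoundedHardCore_zero S hlam (Finset.mem_powerset.1 hC)
    exact h0.of_iterate hk hlam (measurableSet_trace _ (· = C)) n hT
  have hwt : ∀ {w w' : V → ℝ}, (∀ v ∈ T, 0 ≤ w v) → (∀ v ∈ T, w v ≤ w' v) →
      H.wt w A ≤ H.wt w' A := by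
    intro w w' h0 h1
    unfold wt
    split_ifs
    · exact Finset.prod_le_prod (fun v hv => h0 v (hA hv)) fun v hv => h1 v (hA hv)
    · exact le_rfl
  rw [hsplit ∅, hsplit A, Finset.sum_mul, Finset.sum_mul]
  constructor
  · refine Finset.sum_le_sum fun C hCm => ?_
    obtain ⟨w, hw, hhc, hb⟩ := hC C hCm
    rw [hhc A hA]
    exact mul_le_mul_of_nonneg_left (hwt (fun v _ => mul_nonneg hlam.le (pow_nonneg hbd.1 _))
      fun v hv => (hb v hv).1) (cylMass_nonneg _ _)
  · refine Finset.sum_le_sum fun C hCm => ?_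
    obtain ⟨w, hw, hhc, hb⟩ := hC C hCm
    rw [hhc A hA]
    exact mul_le_mul_of_nonneg_left (hwt (fun v _ => hw v) fun v hv => (hb v hv).2)
      (cylMass_nonneg _ _)

/-- The constant boundary law given by a fixed point `t` of the recursion. -/
theorem isBoundaryLaw_const (S : H.EndStructure k d) (hk : 1 ≤ k) (hlam : 0 < lam) {t : ℝ}
    (ht : 0 < t) (hfix : t * (1 + k * lam * t ^ d) = 1) :
    IsBoundaryLaw H S lam fun _ _ => lam * t ^ d := by
  refine ⟨fun _ _ => by positivity, fun v e he => ?_⟩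
  have h1 : ∀ f ∈ (S.edgesAt v).erase e, (1 + ∑ u ∈ f.erase v, lam * t ^ d)⁻¹ = t := by
    intro f hf
    have hf' := S.mem_edgesAt.1 (Finset.mem_of_mem_erase hf)
    rw [Finset.sum_const, S.card_edge_erase hf'.1 hf'.2, nsmul_eq_mul, ← mul_assoc]
    exact (eq_inv_of_mul_eq_one_left hfix).symm
  rw [Finset.prod_congr rfl h1, Finset.prod_const, Finset.card_erase_of_mem he, S.card_edgesAt hk]
  rfl

theorem lawWeight_const (S : H.EndStructure k d) {t : ℝ}
    (hfix : t * (1 + k * lam * t ^ d) = 1) (T : Finset V) (v : V) :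
    lawWeight S lam (fun _ _ => lam * t ^ d) T v = lam * t ^ #(outAt S T v) := by
  rw [lawWeight, ← Finset.prod_const]
  congr 1
  refine Finset.prod_congr rfl fun f hf => ?_
  have hf' := (mem_outAt.1 hf).1
  rw [Finset.sum_const, S.card_edge_erase hf'.1 hf'.2, nsmul_eq_mul, ← mul_assoc]
  exact (eq_inv_of_mul_eq_one_left hfix).symm

open Filter Topology in
/-- At or below the threshold every Gibbs measure has the constant boundary law. -/
theorem IsGibbs.hasLaw_const (S : H.EndStructure k d) (hk : 1 ≤ k) (hd : 1 ≤ d)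
    (hμ : H.IsGibbs lam μ) (hlam : 0 < lam)
    (hcrit : k * lam * ((d : ℝ) - 1) ^ (d + 1) ≤ (d : ℝ) ^ d) {t : ℝ} (ht : 0 < t)
    (hfix : t * (1 + k * lam * t ^ d) = 1) : HasLaw S lam (fun _ _ => lam * t ^ d) μ := by
  have hL : 0 < k * lam := mul_pos (by exact_mod_cast hk) hlam
  obtain ⟨h1, h2⟩ := tendsto_bounds hd hL hcrit ht hfix
  intro T hT A hA
  have hwt : ∀ {f : ℕ → ℝ}, Tendsto f atTop (𝓝 t) → Tendsto (fun n => cylMass μ Set.univ T ∅ *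
      H.wt (fun v => lam * f n ^ #(outAt S T v)) A) atTop
      (𝓝 (cylMass μ Set.univ T ∅ * H.wt (lawWeight S lam (fun _ _ => lam * t ^ d) T) A)) := by
    intro f hf
    refine Tendsto.const_mul _ ?_
    simp only [wt, lawWeight_const S hfix]
    split_ifs
    · exact tendsto_finsetProd _ fun v _ => (hf.pow _).const_mul lam
    · exact tendsto_const_nhds
  have hb := fun n => hμ.cylMass_bounds S hk hlam hT hA n
  exact le_antisymm (ge_of_tendsto' (hwt h2) fun n => (hb n).2)
    (le_of_tendsto' (hwt h1) fun n => (hb n).1)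

theorem exists_fixed_vacancy (hk : 1 ≤ k) (d : ℕ) (hlam : 0 < lam) :
    ∃ t : ℝ, 0 < t ∧ t * (1 + k * lam * t ^ d) = 1 := by
  have hL : 0 < k * lam := mul_pos (by exact_mod_cast hk) hlam
  obtain ⟨x, hx, hxL⟩ := exists_fixed d hL
  -- The root of `x * (1 + x) ^ d = k * lam` gives `k * lam * t ^ d = x` for `t = (1 + x)⁻¹`.
  refine ⟨(1 + x)⁻¹, by positivity, ?_⟩
  rw [← hxL, inv_pow]
  field_simp

end Hypergraph

end

/-! ### Invariance, and the alternating boundary law. -/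

noncomputable section

open scoped Classical

namespace Hypergraph

variable {V : Type*} {H : Hypergraph V} {k d : ℕ} {S : H.EndStructure k d}
  {μ : Measure (Set V)} {lam : ℝ} {m : V → Finset V → ℝ}

theorem edgesAt_image {g : Equiv.Perm V} (hg : g ∈ H.aut) (v : V) :
    S.edgesAt (g v) = (S.edgesAt v).image (Finset.image g) := by
  ext e
  simp only [S.mem_edgesAt, Finset.mem_image]
  constructor
  · rintro ⟨he, hv⟩
    have : (e.image g.symm).image g = e := by simp [Finset.image_image]
    refine ⟨e.image g.symm, ⟨?_, ?_⟩, this⟩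
    · rw [← EndStructure.isEdge_image_iff hg, this]
      exact he
    · exact Finset.mem_image.2 ⟨_, hv, by simp⟩
  · rintro ⟨f, ⟨hf, hv⟩, rfl⟩
    exact ⟨(EndStructure.isEdge_image_iff hg).2 hf, Finset.mem_image.2 ⟨v, hv, rfl⟩⟩

theorem lawWeight_image {g : Equiv.Perm V} (hg : g ∈ H.aut)
    (hm : ∀ v e, m (g v) (e.image g) = m v e) (T : Finset V) (v : V) :
    lawWeight S lam m (T.image g) (g v) = lawWeight S lam m T v := by
  have hinj : Function.Injective (Finset.image g) := Finset.image_injective g.injective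
  rw [lawWeight, lawWeight, edgesAt_image hg, Finset.filter_image, Finset.prod_image
    fun _ _ _ _ h => hinj h]
  congr 1
  refine Finset.prod_congr ?_ fun e _ => ?_
  · refine Finset.filter_congr fun e _ => ?_
    rw [Finset.image_subset_image_iff g.injective]
  · rw [← Finset.image_erase g.injective, Finset.sum_image fun _ _ _ _ h => g.injective h]
    simp only [hm]

theorem isIndep_image {g : Equiv.Perm V} (S : H.EndStructure k d) (hg : g ∈ H.aut) (A : Finset V) :
    H.IsIndep ((A.image g : Finset V) : Set V) ↔ H.IsIndep (A : Set V) := by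
  have hadj : ∀ x y, H.Adj (g x) (g y) ↔ H.Adj x y := by
    intro x y
    constructor
    · rintro ⟨e, he, hx, hy⟩
      have : g '' (g ⁻¹' e) = e := g.surjective.image_preimage e
      exact ⟨g ⁻¹' e, (hg.2 _).1 (by rwa [this]), hx, hy⟩
    · rintro ⟨e, he, hx, hy⟩
      exact ⟨g '' e, (hg.2 e).2 he, Set.mem_image_of_mem g hx, Set.mem_image_of_mem g hy⟩
  rw [S.isIndep_iff, S.isIndep_iff]
  simp only [Finset.mem_coe, Finset.forall_mem_image, hadj, g.injective.eq_iff]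

theorem measurable_image (g : Equiv.Perm V) : Measurable fun I : Set V => g '' I := by
  rw [measurable_set_iff]
  intro v
  simp only [Equiv.image_eq_preimage_symm, Set.mem_preimage]
  exact measurable_set_mem _

theorem HasLaw.map (hk : 1 ≤ k) {g : Equiv.Perm V} (hg : g ∈ H.aut)
    (hm : ∀ v e, m (g v) (e.image g) = m v e) (h : HasLaw S lam m μ) :
    HasLaw S lam m (μ.map fun I : Set V => (g⁻¹ : Equiv.Perm V) '' I) := by
  have hcyl : ∀ T A : Finset V, cylMass (μ.map fun I : Set V => (g⁻¹ : Equiv.Perm V) '' I) Set.univ T A =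
      cylMass μ Set.univ (T.image g) (A.image g) := by
    intro T A
    rw [cylMass, cylMass, Set.inter_univ, Set.inter_univ, measureReal_def, measureReal_def,
      Measure.map_apply (measurable_image _) (measurableSet_trace T (· = A))]
    congr 2
    ext I
    have : trace (T.image g) I = (trace T ((g⁻¹ : Equiv.Perm V) '' I)).image g := by
      ext v
      simp only [mem_trace, Finset.mem_image]
      constructor
      · rintro ⟨⟨x, hx, rfl⟩, hxI⟩
        exact ⟨x, ⟨hx, _, hxI, by simp⟩, rfl⟩
      · rintro ⟨x, ⟨hx, y, hy, rfl⟩, rfl⟩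
        exact ⟨⟨_, hx, rfl⟩, by simpa using hy⟩
    simp only [Set.mem_preimage, Set.mem_ofPred_eq, this]
    exact (Finset.image_injective g.injective).eq_iff.symm
  intro T hT A hA
  rw [hcyl, hcyl, h _ (hT.image hk hg) _ (Finset.image_subset_image hA), Finset.image_empty]
  congr 1
  rw [wt, wt, isIndep_image S hg, Finset.prod_image fun _ _ _ _ h => g.injective h]
  simp only [lawWeight_image hg hm]

/-- The image measure has the same boundary law, and a law determines its measure. -/
theorem HasLaw.isInvariant [Nonempty V] [IsProbabilityMeasure μ] (hk : 1 ≤ k)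
    {G : Subgroup (Equiv.Perm V)} (hG : G ≤ H.aut)
    (hm : ∀ g ∈ G, ∀ v e, m (g v) (e.image g) = m v e) (h : HasLaw S lam m μ) :
    IsInvariant G μ := by
  intro g hg
  have hg' := inv_mem hg
  have h' := h.map hk (hG hg') (hm _ hg')
  rw [inv_inv] at h'
  have := Measure.isProbabilityMeasure_map (μ := μ) (measurable_image g).aemeasurable
  exact h'.unique h

/-- The boundary law that alternates between the two values of a cycle of the recursion along the
levels of the hypertree. -/
def cycleLaw (S : H.EndStructure k d) (a b : ℝ) (v : V) (e : Finset V) : ℝ :=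
  let x := if Even (S.ht v) then a else b
  let y := if Even (S.ht v) then b else a
  if S.par v ∈ e then x else x * (1 + (k - 1) * y) / (1 + (k - 1) * x)

theorem cycleLaw_image {g : Equiv.Perm V} (hg : g ∈ S.parityGroup) (a b : ℝ) (v : V)
    (e : Finset V) : cycleLaw S a b (g v) (e.image g) = cycleLaw S a b v e := by
  unfold cycleLaw
  rw [(hg.2 v).1]
  simp only [(hg.2 v).2, Finset.mem_image, g.injective.eq_iff, exists_eq_right]

theorem even_ht_par (v : V) : Even (S.ht (S.par v)) ↔ ¬ Even (S.ht v) := by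
  rw [S.ht_par, Int.even_sub]
  simp

theorem par_notMem_edge (v : V) (i : Fin d) : S.par v ∉ S.edge v i := by
  intro h
  rcases S.mem_edge.1 h with h | h
  · exact S.par_ne v h
  · have h1 := S.ht_par v
    have h2 := S.ht_par (S.par v)
    rw [h.1] at h2
    omega

theorem sum_cycleLaw_edge {a b : ℝ} (v : V) (i : Fin d) :
    ∑ u ∈ (S.edge v i).erase v, cycleLaw S a b u (S.edge v i) =
      k * if Even (S.ht v) then b else a := by
  have hc := S.card_edge_erase (S.isEdge_edge v i) (S.mem_edge.2 (Or.inl rfl))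
  suffices h : ∀ u ∈ (S.edge v i).erase v, cycleLaw S a b u (S.edge v i) =
      if Even (S.ht v) then b else a by
    rw [Finset.sum_congr rfl h, Finset.sum_const, hc, nsmul_eq_mul]
  intro u hu
  rw [Finset.mem_erase, S.mem_edge] at hu
  obtain ⟨rfl, -⟩ := hu.2.resolve_left hu.1
  rw [cycleLaw, if_pos (S.mem_edge.2 (Or.inl rfl))]
  simp only [even_ht_par]
  split_ifs <;> rfl

/-- The `k - 1` siblings send their upward messages, and the parent, on a level of the other parity,
sends its downward one. -/
theorem sum_cycleLaw_up {a b : ℝ} (hk : 1 ≤ k) (v : V) {x y : ℝ}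
    (hx : x = if Even (S.ht v) then a else b) (hy : y = if Even (S.ht v) then b else a) :
    ∑ u ∈ (S.up v).erase v, cycleLaw S a b u (S.up v) =
      (k - 1) * x + y * (1 + (k - 1) * x) / (1 + (k - 1) * y) := by
  have hp : S.par v ∈ (S.up v).erase v := Finset.mem_erase.2 ⟨S.par_ne v, S.par_mem_up v⟩
  rw [← Finset.sum_erase_add _ _ hp]
  congr 1
  · have hc : #(((S.up v).erase v).erase (S.par v)) = k - 1 := by
      rw [Finset.card_erase_of_mem hp, S.card_edge_erase (S.isEdge_up v) (S.mem_up v)]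
    have hcast : ((k : ℝ) - 1) = ((k - 1 : ℕ) : ℝ) := by push_cast [hk]; ring
    suffices h : ∀ u ∈ ((S.up v).erase v).erase (S.par v), cycleLaw S a b u (S.up v) = x by
      rw [Finset.sum_congr rfl h, Finset.sum_const, hc, nsmul_eq_mul, hcast]
    intro u hu
    rw [Finset.mem_erase, Finset.mem_erase] at hu
    have hu' := S.mem_edge.1 hu.2.2
    have hup := (hu'.resolve_left hu.1).1
    have hht := S.ht_par u
    rw [hup, S.ht_par v] at hht
    rw [cycleLaw, hup, if_pos (S.par_mem_up v), hx, show S.ht u = S.ht v by omega]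
  · have hpp : S.par (S.par v) ∉ S.up v := par_notMem_edge _ _
    rw [cycleLaw, if_neg hpp]
    simp only [even_ht_par]
    rw [hx, hy]
    by_cases h : Even (S.ht v) <;> simp [h]

/-- Upward messages satisfy `x * (1 + k * y) ^ d = lam`, the cycle equation, because `d` downward
hyperedges with `k` children of value `y` are combined. The downward message is then forced by the
upward hyperedge. The second part records the odds at a single vertex, which tell the two laws
apart. -/
theorem isBoundaryLaw_cycleLaw (S : H.EndStructure k d) (hk : 1 ≤ k) {a b : ℝ}
    (ha : 0 < a) (hb : 0 < b) (hab : a * (1 + k * b) ^ d = lam) (hba : b * (1 + k * a) ^ d = lam) :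
    IsBoundaryLaw H S lam (cycleLaw S a b) ∧
    ∀ v, lawWeight S lam (cycleLaw S a b) {v} v =
      if Even (S.ht v) then a * (1 + (k - 1) * b) / ((1 + (k - 1) * a) * (1 + k * b))
      else b * (1 + (k - 1) * a) / ((1 + (k - 1) * b) * (1 + k * a)) := by
  have hk1 : (0 : ℝ) ≤ k - 1 := by
    have : (1 : ℝ) ≤ k := by exact_mod_cast hk
    linarith
  have hall : ∀ v, ∃ x y : ℝ, 0 < x ∧ 0 < y ∧ x * (1 + k * y) ^ d = lam ∧
      (x = if Even (S.ht v) then a else b) ∧ (y = if Even (S.ht v) then b else a) := by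
    intro v
    by_cases h : Even (S.ht v)
    · exact ⟨a, b, ha, hb, hab, by simp [h], by simp [h]⟩
    · exact ⟨b, a, hb, ha, hba, by simp [h], by simp [h]⟩
  -- The product over all hyperedges at `v` is computed once; every message is obtained from it by
  -- dividing out the factor of one hyperedge.
  have hF : ∀ (v : V) (x y : ℝ), 0 < x → 0 < y → x * (1 + k * y) ^ d = lam →
      (x = if Even (S.ht v) then a else b) → (y = if Even (S.ht v) then b else a) →
      lam * ∏ f ∈ S.edgesAt v, (1 + ∑ u ∈ f.erase v, cycleLaw S a b u f)⁻¹ =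
        x * (1 + (k - 1) * y) / ((1 + (k - 1) * x) * (1 + k * y)) := by
    intro v x y hx0 hy0 hxy hx hy
    rw [S.prod_edgesAt hk, sum_cycleLaw_up hk v hx hy]
    simp only [sum_cycleLaw_edge, ← hy]
    rw [Finset.prod_const, Finset.card_univ, Fintype.card_fin, ← hxy, inv_pow]
    obtain ⟨c, hc⟩ : ∃ c : ℝ, (k : ℝ) = c + 1 := ⟨k - 1, by ring⟩
    have hc0 : 0 ≤ c := by rw [hc] at hk1; linarith
    rw [hc, add_sub_cancel_right]
    field_simp
    ring
  constructor
  · refine ⟨fun v e => ?_, fun v e he => ?_⟩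
    · unfold cycleLaw
      simp only
      split_ifs <;> positivity
    · obtain ⟨x, y, hx0, hy0, hxy, hx, hy⟩ := hall v
      have h1 := hF v x y hx0 hy0 hxy hx hy
      rw [← Finset.mul_prod_erase _ _ he] at h1
      obtain ⟨c, hc⟩ : ∃ c : ℝ, (k : ℝ) = c + 1 := ⟨k - 1, by ring⟩
      have hc0 : 0 ≤ c := by rw [hc] at hk1; linarith
      obtain ⟨q, hq⟩ : ∃ q, q = ∏ f ∈ (S.edgesAt v).erase e,
        (1 + ∑ u ∈ f.erase v, cycleLaw S a b u f)⁻¹ := ⟨_, rfl⟩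
      rw [← hq] at h1 ⊢
      rw [EndStructure.edgesAt, Finset.mem_insert, Finset.mem_image] at he
      rcases he with rfl | ⟨i, -, rfl⟩
      · rw [sum_cycleLaw_up hk v hx hy] at h1
        rw [cycleLaw, if_pos (S.par_mem_up v), ← hx]
        rw [hc, add_sub_cancel_right] at h1
        have ht : 1 + (c * x + y * (1 + c * x) / (1 + c * y)) =
            (1 + c * x) * (1 + (c + 1) * y) / (1 + c * y) := by
          field_simp
          ring
        rw [ht, mul_left_comm] at h1
        have hp : 0 < (1 + c * x) * (1 + (c + 1) * y) / (1 + c * y) := by positivity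
        rw [inv_mul_eq_iff_eq_mul₀ hp.ne'] at h1
        rw [h1]
        field_simp
      · rw [sum_cycleLaw_edge, ← hy] at h1
        rw [cycleLaw, if_neg (par_notMem_edge v i), ← hx, ← hy]
        have hky : (0 : ℝ) < 1 + k * y := by positivity
        calc x * (1 + (k - 1) * y) / (1 + (k - 1) * x)
            = (x * (1 + (k - 1) * y) / ((1 + (k - 1) * x) * (1 + k * y))) * (1 + k * y) := by
              have : (0 : ℝ) < 1 + (k - 1) * x := by positivity
              field_simp
          _ = _ := by rw [← h1]; field_simp
  · intro v
    obtain ⟨x, y, hx0, hy0, hxy, hx, hy⟩ := hall v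
    have h1 := hF v x y hx0 hy0 hxy hx hy
    have h2 : (S.edgesAt v).filter (fun e => ¬ e ⊆ {v}) = S.edgesAt v := by
      refine Finset.filter_true_of_mem fun e he hev => ?_
      rw [S.mem_edgesAt] at he
      have := S.card_edge_erase he.1 he.2
      have h0 : e.erase v = ∅ := by
        rw [Finset.erase_eq_empty_iff]
        exact Finset.subset_singleton_iff.1 hev
      rw [h0, Finset.card_empty] at this
      omega
    rw [lawWeight, h2, h1, hx, hy]
    split_ifs <;> rfl

end Hypergraph

end

/-! ### Conditional probabilities given the configuration on a set. -/

noncomputable section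

open scoped Classical

section ConfigSigma

open Hypergraph

variable {V : Type*} {μ : Measure (Set V)}

theorem measurableSet_superset (F : Finset V) : MeasurableSet {I : Set V | (F : Set V) ⊆ I} := by
  have : {I : Set V | (F : Set V) ⊆ I} = {I | trace F I = F} := by
    ext I
    simp only [Set.mem_ofPred_eq, trace, Finset.filter_eq_self]
    rfl
  rw [this]
  exact measurableSet_trace F (· = F)

theorem configSigma_le (S : Set V) :
    configSigma S ≤ (inferInstance : MeasurableSpace (Set V)) := (measurable_inter S).comap_le

theorem measurableSet_configSigma {S : Set V} {v : V} (hv : v ∈ S) :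
    MeasurableSet[configSigma S] {I | v ∈ I} :=
  ⟨{I | v ∈ I}, measurableSet_mem v, by ext I; simp [hv]⟩

theorem configSigma_le_iff {S : Set V} {m : MeasurableSpace (Set V)} :
    configSigma S ≤ m ↔ ∀ v ∈ S, MeasurableSet[m] {I | v ∈ I} := by
  constructor
  · exact fun h v hv => h _ (measurableSet_configSigma hv)
  · intro h
    have : @Measurable _ _ m Set.instMeasurableSpace fun I : Set V => I ∩ S := by
      refine (@measurable_set_iff _ _ m _).2 fun v => ?_
      by_cases hv : v ∈ S
      · simp only [Set.mem_inter_iff, hv, and_true]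
        exact (@measurableSet_setOfPred _ m _).1 (h v hv)
      · simp [hv]
    exact this.comap_le

theorem configSigma_mono {S S' : Set V} (h : S ⊆ S') : configSigma S ≤ configSigma S' :=
  configSigma_le_iff.2 fun _ hv => measurableSet_configSigma (h hv)

theorem measurable_trace_configSigma {S : Set V} {F : Finset V} (h : (F : Set V) ⊆ S) :
    Measurable[configSigma S, ⊤] (trace F : Set V → Finset V) := by
  have h1 : (trace F : Set V → Finset V) = trace F ∘ fun I => I ∩ S := by
    ext I v
    simp only [Function.comp_apply, mem_trace, Set.mem_inter_iff]
    exact ⟨fun hv => ⟨hv.1, hv.2, h hv.1⟩, fun hv => ⟨hv.1, hv.2.1⟩⟩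
  rw [h1]
  exact (measurable_trace F).comp (comap_measurable _)

theorem configSigma_eq_generateFrom (S : Set V) : configSigma S =
    MeasurableSpace.generateFrom
      {s : Set (Set V) | ∃ F : Finset V, (F : Set V) ⊆ S ∧ s = {I | (F : Set V) ⊆ I}} := by
  apply le_antisymm
  · refine configSigma_le_iff.2 fun v hv => MeasurableSpace.measurableSet_generateFrom
      ⟨{v}, by simpa using hv, by simp⟩
  · refine MeasurableSpace.generateFrom_le ?_
    rintro _ ⟨F, hF, rfl⟩
    have : {I : Set V | (F : Set V) ⊆ I} = trace F ⁻¹' {F} := by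
      ext I
      simp only [Set.mem_ofPred_eq, trace, Set.mem_preimage, Set.mem_singleton_iff,
        Finset.filter_eq_self]
      rfl
    rw [this]
    exact measurable_trace_configSigma hF trivial

theorem iSup_configSigma {Λ : Set V} {T : ℕ → Finset V} (hT : ∀ v, ∃ n, v ∈ T n) :
    ⨆ n, configSigma (Λ ∩ T n) = configSigma Λ := by
  apply le_antisymm
  · exact iSup_le fun n => configSigma_mono Set.inter_subset_left
  · refine configSigma_le_iff.2 fun v hv => ?_
    obtain ⟨n, hn⟩ := hT v
    exact le_iSup (fun n => configSigma (Λ ∩ T n)) n _ (measurableSet_configSigma ⟨hv, hn⟩)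

/-- Conditional probabilities given the configuration in a finite window. -/
theorem condExp_configSigma_coe [IsProbabilityMeasure μ] {E : Set (Set V)} (hE : MeasurableSet E)
    (L : Finset V) : μ⟦E | configSigma (L : Set V)⟧ =ᵐ[μ]
      fun I => cylMass μ E L (trace L I) / cylMass μ Set.univ L (trace L I) := by
  set G : Finset V → ℝ := fun A => cylMass μ E L A / cylMass μ Set.univ L A with hG
  have hle : ∀ A, cylMass μ E L A ≤ cylMass μ Set.univ L A := fun A =>
    measureReal_mono (Set.inter_subset_inter_right _ (Set.subset_univ _))
  have hmeas : Measurable[configSigma (L : Set V)] fun I => G (trace L I) :=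
    @Measurable.comp _ _ _ (configSigma (L : Set V)) ⊤ _ G (trace L)
      (fun _ _ => MeasurableSpace.measurableSet_top) (measurable_trace_configSigma subset_rfl)
  have hint : Integrable (fun I => G (trace L I)) μ := by
    refine Integrable.of_bound (hmeas.mono (configSigma_le _) le_rfl).aestronglyMeasurable 1
      (ae_of_all _ fun I => ?_)
    rw [Real.norm_of_nonneg (div_nonneg (cylMass_nonneg _ _) (cylMass_nonneg _ _))]
    exact div_le_one_of_le₀ (hle _) (cylMass_nonneg _ _)
  refine (ae_eq_condExp_of_forall_setIntegral_eq (configSigma_le _)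
    ((integrable_const 1).indicator hE) (fun s _ _ => hint.integrableOn) ?_
    hmeas.aestronglyMeasurable).symm
  rintro _ ⟨t, ht, rfl⟩ -
  have hs : (fun I : Set V => I ∩ L) ⁻¹' t = {I | ((trace L I : Finset V) : Set V) ∈ t} := by
    ext I
    simp [coe_trace]
  rw [hs, integral_indicator_const _ hE, smul_eq_mul, mul_one, measureReal_restrict_apply hE,
    Set.inter_comm, measureReal_trace hE L fun A => (A : Set V) ∈ t]
  have hU : {I : Set V | ((trace L I : Finset V) : Set V) ∈ t} =
      ⋃ A ∈ L.powerset.filter (fun A : Finset V => (A : Set V) ∈ t), {I | trace L I = A} := by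
    ext I
    simp [trace_subset]
  rw [hU]
  refine (integral_biUnion_finset _ ?_ ?_ ?_).trans ?_
  · exact fun A _ => measurableSet_trace L (· = A)
  · intro A _ B _ hAB
    exact Set.disjoint_left.2 fun I h1 h2 => hAB (h1.symm.trans h2)
  · exact fun A _ => hint.integrableOn
  · refine Finset.sum_congr rfl fun A _ => ?_
    have hA := measurableSet_trace (V := V) L (· = A)
    rw [setIntegral_congr_fun hA (g := fun _ => G A) (fun I hI => congrArg G hI), setIntegral_const, smul_eq_mul]
    have h0 : μ.real {I | trace L I = A} = cylMass μ Set.univ L A := by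
      rw [cylMass, Set.inter_univ]
    rw [h0, hG]
    -- On a null cylinder `G A` is `0 / 0 = 0`, and the mass of its intersection with `E` is zero as
    -- well.
    by_cases hz : cylMass μ Set.univ L A = 0
    · have := hle A
      have := cylMass_nonneg (μ := μ) (X := E) L A
      rw [hz, zero_mul]
      linarith
    · simp only
      field_simp

/-- Conditional independence given a finite window, reduced to a cross-multiplied identity so that
null cylinders need no separate hypothesis. -/
theorem condExp_configSigma_coe_eq_mul [IsProbabilityMeasure μ] {E E₁ E₂ : Set (Set V)}
    (hE : MeasurableSet E) (hE₁ : MeasurableSet E₁) (hE₂ : MeasurableSet E₂) {L : Finset V}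
    (h : ∀ B ⊆ L, cylMass μ E L B * cylMass μ Set.univ L B = cylMass μ E₁ L B * cylMass μ E₂ L B) :
    μ⟦E | configSigma (L : Set V)⟧ =ᵐ[μ]
      μ⟦E₁ | configSigma (L : Set V)⟧ * μ⟦E₂ | configSigma (L : Set V)⟧ := by
  filter_upwards [condExp_configSigma_coe hE L, condExp_configSigma_coe hE₁ L,
    condExp_configSigma_coe hE₂ L] with I h0 h1 h2
  rw [Pi.mul_apply, h0, h1, h2]
  have := h _ (trace_subset L I)
  by_cases hz : cylMass μ Set.univ L (trace L I) = 0
  · simp [hz]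
  · field_simp
    exact this

end ConfigSigma

instance (V : Type*) [Countable V] : StandardBorelSpace (Set V) :=
  inferInstanceAs (StandardBorelSpace (V → Prop))

namespace Hypergraph

variable {V : Type*} {H : Hypergraph V} {k d : ℕ} {S : H.EndStructure k d}
  {μ : Measure (Set V)} {w : V → ℝ}

/-- The weight of the common part `B` is assigned to the first factor only, while both factors test
compatibility with `B`. -/
theorem wt_union (S : H.EndStructure k d) {B A₁ A₂ : Finset V}
    (h2 : Disjoint B A₂) (h3 : Disjoint A₁ A₂) (hadj : ∀ x ∈ A₁, ∀ y ∈ A₂, ¬ H.Adj x y) :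
    H.wt w (B ∪ A₁ ∪ A₂) = (if H.IsIndep ((B ∪ A₁ : Finset V) : Set V) then
        ∏ v ∈ B ∪ A₁, w v else 0) *
      (if H.IsIndep ((B ∪ A₂ : Finset V) : Set V) then ∏ v ∈ A₂, w v else 0) := by
  have hiff : H.IsIndep ((B ∪ A₁ ∪ A₂ : Finset V) : Set V) ↔
      H.IsIndep ((B ∪ A₁ : Finset V) : Set V) ∧ H.IsIndep ((B ∪ A₂ : Finset V) : Set V) := by
    refine ⟨fun h => ⟨h.mono ?_, h.mono ?_⟩, fun ⟨ha, hb⟩ => ?_⟩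
    · exact_mod_cast Finset.subset_union_left
    · exact_mod_cast Finset.union_subset_union_left Finset.subset_union_left
    · rw [S.isIndep_iff] at ha hb ⊢
      simp only [Finset.coe_union, Set.mem_union, Finset.mem_coe] at ha hb ⊢
      intro x hx y hy hxy
      rcases hx with hx | hx
      · rcases hy with hy | hy
        · exact ha x hx y hy hxy
        · rcases hx with hx | hx
          · exact hb x (Or.inl hx) y (Or.inr hy) hxy
          · exact absurd hxy (hadj x hx y hy)
      · rcases hy with (hy | hy) | hy
        · exact hb x (Or.inr hx) y (Or.inl hy) hxy
        · exact absurd hxy.symm (hadj y hy x hx)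
        · exact hb x (Or.inr hx) y (Or.inr hy) hxy
  rw [wt, Finset.prod_union (Finset.disjoint_union_left.2 ⟨h2, h3⟩)]
  simp only [hiff]
  split_ifs <;> simp_all

/-- For fixed `B` the mass is a product of a function of `p₁` and a function of `p₂`; conditional
independence of the two parts follows formally. -/
theorem IsHardCore.cylMass_eq_mul [IsProbabilityMeasure μ] (S : H.EndStructure k d)
    {L U₁ U₂ : Finset V} (h1 : Disjoint L U₁) (h2 : Disjoint L U₂) (h3 : Disjoint U₁ U₂)
    (hadj : ∀ x ∈ U₁, ∀ y ∈ U₂, ¬ H.Adj x y) (h : H.IsHardCore μ Set.univ (L ∪ U₁ ∪ U₂) w)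
    {B : Finset V} (hB : B ⊆ L) (p₁ p₂ : Finset V → Prop) :
    cylMass μ {I | p₁ (trace U₁ I) ∧ p₂ (trace U₂ I)} L B =
      cylMass μ Set.univ (L ∪ U₁ ∪ U₂) ∅ *
      ((∑ A ∈ U₁.powerset.filter p₁, if H.IsIndep ((B ∪ A : Finset V) : Set V) then
        ∏ v ∈ B ∪ A, w v else 0) *
      ∑ A ∈ U₂.powerset.filter p₂, if H.IsIndep ((B ∪ A : Finset V) : Set V) then
        ∏ v ∈ A, w v else 0) := by
  obtain ⟨q, hq⟩ : ∃ q : Finset V → Prop, ∀ A, q A ↔ A ∩ L = B ∧ p₁ (A ∩ U₁) ∧ p₂ (A ∩ U₂) :=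
    ⟨_, fun _ => Iff.rfl⟩
  have hset : {I : Set V | trace L I = B} ∩ {I | p₁ (trace U₁ I) ∧ p₂ (trace U₂ I)} =
      {I | q (trace (L ∪ U₁ ∪ U₂) I)} ∩ Set.univ := by
    ext I
    simp only [hq, Set.mem_inter_iff, Set.mem_ofPred_eq, Set.mem_univ, and_true]
    rw [trace_trace, trace_trace, trace_trace]
    · exact Finset.subset_union_right
    · exact Finset.subset_union_right.trans Finset.subset_union_left
    · exact Finset.subset_union_left.trans Finset.subset_union_left
  have hd1 := Finset.disjoint_left.1 h1
  have hd2 := Finset.disjoint_left.1 h2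
  have hd3 := Finset.disjoint_left.1 h3
  rw [cylMass, hset, measureReal_trace .univ (L ∪ U₁ ∪ U₂)
    q, Finset.sum_mul_sum,
    ← Finset.sum_product', Finset.mul_sum]
  symm
  have hsub : ∀ A₁ A₂ : Finset V, A₁ ⊆ U₁ → A₂ ⊆ U₂ → (B ∪ A₁ ∪ A₂) ∩ L = B ∧
      (B ∪ A₁ ∪ A₂) ∩ U₁ = A₁ ∧ (B ∪ A₁ ∪ A₂) ∩ U₂ = A₂ := by
    intro A₁ A₂ hA₁ hA₂
    refine ⟨?_, ?_, ?_⟩ <;> ext x <;> simp only [Finset.mem_inter, Finset.mem_union] <;> grind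
  refine Finset.sum_nbij' (fun A => B ∪ A.1 ∪ A.2) (fun A => (A ∩ U₁, A ∩ U₂)) ?_ ?_ ?_ ?_ ?_
  · rintro ⟨A₁, A₂⟩ hA
    rw [Finset.mem_product, Finset.mem_filter, Finset.mem_filter, Finset.mem_powerset,
      Finset.mem_powerset] at hA
    obtain ⟨e1, e2, e3⟩ := hsub A₁ A₂ hA.1.1 hA.2.1
    rw [Finset.mem_filter, Finset.mem_powerset, hq]
    refine ⟨Finset.union_subset_union (Finset.union_subset_union hB hA.1.1) hA.2.1, e1, ?_, ?_⟩
    · rw [e2]; exact hA.1.2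
    · rw [e3]; exact hA.2.2
  · intro A hA
    rw [Finset.mem_filter, Finset.mem_powerset, hq] at hA
    rw [Finset.mem_product, Finset.mem_filter, Finset.mem_filter, Finset.mem_powerset,
      Finset.mem_powerset]
    exact ⟨⟨Finset.inter_subset_right, hA.2.2.1⟩, Finset.inter_subset_right, hA.2.2.2⟩
  · rintro ⟨A₁, A₂⟩ hA
    rw [Finset.mem_product, Finset.mem_filter, Finset.mem_filter, Finset.mem_powerset,
      Finset.mem_powerset] at hA
    obtain ⟨e1, e2, e3⟩ := hsub A₁ A₂ hA.1.1 hA.2.1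
    simp only [e2, e3]
  · intro A hA
    rw [Finset.mem_filter, Finset.mem_powerset, hq] at hA
    simp only
    rw [← hA.2.1, ← Finset.inter_union_distrib_left, ← Finset.inter_union_distrib_left]
    exact Finset.inter_eq_left.2 hA.1
  · rintro ⟨A₁, A₂⟩ hA
    rw [Finset.mem_product, Finset.mem_filter, Finset.mem_filter, Finset.mem_powerset,
      Finset.mem_powerset] at hA
    simp only
    rw [h _ (Finset.union_subset_union (Finset.union_subset_union hB hA.1.1) hA.2.1),
      wt_union S (h2.mono hB hA.2.1) (h3.mono hA.1.1 hA.2.1)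
        fun x hx y hy => hadj x (hA.1.1 hx) y (hA.2.1 hy)]

/-- In the hard-core model, non-adjacent parts are conditionally independent given the rest. -/
theorem IsHardCore.cylMass_mul [IsProbabilityMeasure μ] (S : H.EndStructure k d)
    {L U₁ U₂ : Finset V} (h1 : Disjoint L U₁) (h2 : Disjoint L U₂) (h3 : Disjoint U₁ U₂)
    (hadj : ∀ x ∈ U₁, ∀ y ∈ U₂, ¬ H.Adj x y) (h : H.IsHardCore μ Set.univ (L ∪ U₁ ∪ U₂) w)
    {B : Finset V} (hB : B ⊆ L) (p₁ p₂ : Finset V → Prop) :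
    cylMass μ {I | p₁ (trace U₁ I) ∧ p₂ (trace U₂ I)} L B * cylMass μ Set.univ L B =
      cylMass μ {I | p₁ (trace U₁ I)} L B * cylMass μ {I | p₂ (trace U₂ I)} L B := by
  have key := h.cylMass_eq_mul S h1 h2 h3 hadj hB
  have e0 := key (fun _ => True) (fun _ => True)
  have e1 := key p₁ (fun _ => True)
  have e2 := key (fun _ => True) p₂
  simp only [and_true, true_and] at e0 e1 e2
  have hu : {_I : Set V | True} = Set.univ := Set.ofPred_true
  rw [hu] at e0
  rw [key p₁ p₂, e0, e1, e2]
  ring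

end Hypergraph

end

/-! ### Measures with a boundary law are simple. -/

noncomputable section

open scoped Classical

namespace Hypergraph

variable {V : Type*} {H : Hypergraph V} {k d : ℕ} {S : H.EndStructure k d}
  {μ : Measure (Set V)} {lam : ℝ} {m : V → Finset V → ℝ} {Λ : Set V}

theorem notMem_of_mem_supp {C : H.ComponentsOff Λ} {x : V} (hx : x ∈ Subtype.val '' C.supp) :
    x ∉ Λ := by
  obtain ⟨x, -, rfl⟩ := hx
  exact x.2

theorem mem_supp_of_adj {C : H.ComponentsOff Λ} {x y : V} (hx : x ∈ Subtype.val '' C.supp)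
    (hy : y ∉ Λ) (h : H.Adj x y) : y ∈ Subtype.val '' C.supp := by
  by_cases hxy : x = y
  · rwa [← hxy]
  obtain ⟨x, hxC, rfl⟩ := hx
  refine ⟨⟨y, hy⟩, ?_, rfl⟩
  refine C.mem_supp_of_adj_mem_supp hxC ?_
  simp only [SimpleGraph.comap_adj, SimpleGraph.fromRel_adj, Function.Embedding.subtype_apply]
  exact ⟨hxy, Or.inl h⟩

theorem eq_of_mem_supp {C D : H.ComponentsOff Λ} {x : V} (hx : x ∈ Subtype.val '' C.supp)
    (hy : x ∈ Subtype.val '' D.supp) : C = D := by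
  obtain ⟨x, hxC, rfl⟩ := hx
  obtain ⟨y, hyD, hyx⟩ := hy
  obtain rfl := Subtype.val_injective hyx
  exact hxC.symm.trans hyD

/-- Induction on the number of components: the part of the window in one component is not adjacent
to the rest of the window off `Λ`. -/
theorem IsHardCore.condExp_iInter [IsProbabilityMeasure μ] (S : H.EndStructure k d) {T : Finset V}
    {w : V → ℝ} (h : H.IsHardCore μ Set.univ T w) (s : Finset (H.ComponentsOff Λ))
    (F : H.ComponentsOff Λ → Finset V)
    (hF : ∀ C ∈ s, F C ⊆ T ∧ (F C : Set V) ⊆ Subtype.val '' C.supp) :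
    μ⟦⋂ C ∈ s, {I | (F C : Set V) ⊆ I} | configSigma (Λ ∩ T)⟧ =ᵐ[μ]
      ∏ C ∈ s, μ⟦{I | (F C : Set V) ⊆ I} | configSigma (Λ ∩ T)⟧ := by
  have hL : Λ ∩ T = ((T.filter (· ∈ Λ) : Finset V) : Set V) := by
    ext v
    simp [and_comm]
  rw [hL]
  induction s using Finset.induction_on with
  | empty =>
    simp only [Finset.notMem_empty, Set.iInter_of_empty, Set.iInter_univ, Finset.prod_empty,
      Set.indicator_univ]
    rw [condExp_const (configSigma_le _)]
    rfl
  | insert C s hCs ih =>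
    rw [Finset.prod_insert hCs, Finset.set_biInter_insert]
    refine (condExp_configSigma_coe_eq_mul ?_ ?_ ?_ ?_).trans
      (Filter.EventuallyEq.mul (Filter.EventuallyEq.refl _ _)
        (ih fun D hD => hF D (Finset.mem_insert_of_mem hD)))
    · exact (measurableSet_superset _).inter
        (Finset.measurableSet_biInter _ fun D _ => measurableSet_superset _)
    · exact measurableSet_superset _
    · exact Finset.measurableSet_biInter _ fun D _ => measurableSet_superset _
    · intro B hB
      obtain ⟨p, hp⟩ : ∃ p : V → Prop, ∀ x, p x ↔ x ∉ Λ ∧ x ∉ Subtype.val '' C.supp :=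
        ⟨_, fun _ => Iff.rfl⟩
      obtain ⟨q, hq⟩ : ∃ q : V → Prop, ∀ x, q x ↔ x ∈ Subtype.val '' C.supp :=
        ⟨_, fun _ => Iff.rfl⟩
      have hT : T = T.filter (· ∈ Λ) ∪ T.filter q ∪ T.filter p := by
        ext x
        simp only [Finset.mem_union, Finset.mem_filter, hp, hq]
        tauto
      have h1 : {I : Set V | (F C : Set V) ⊆ I} = {I | F C ⊆ trace (T.filter q) I} := by
        ext I
        refine ⟨fun h x hx => ?_, fun h x hx => (mem_trace.1 (h hx)).2⟩
        have := hF C (Finset.mem_insert_self _ _)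
        exact mem_trace.2 ⟨Finset.mem_filter.2 ⟨this.1 hx, (hq x).2 (this.2 hx)⟩, h hx⟩
      have h2 : ⋂ D ∈ s, {I : Set V | (F D : Set V) ⊆ I} =
          {I | ∀ D ∈ s, F D ⊆ trace (T.filter p) I} := by
        ext I
        simp only [Set.mem_iInter, Set.mem_ofPred_eq]
        refine ⟨fun h D hD x hx => ?_, fun h D hD x hx => (mem_trace.1 (h D hD hx)).2⟩
        have := hF D (Finset.mem_insert_of_mem hD)
        refine mem_trace.2 ⟨Finset.mem_filter.2 ⟨this.1 hx, (hp x).2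
          ⟨notMem_of_mem_supp (this.2 hx), fun hxC => ?_⟩⟩, h D hD hx⟩
        exact hCs (eq_of_mem_supp hxC (this.2 hx) ▸ hD)
      rw [h1, h2]
      rw [hT] at h
      refine IsHardCore.cylMass_mul S ?_ ?_ ?_ ?_ h hB (F C ⊆ ·) (fun A => ∀ D ∈ s, F D ⊆ A)
      · rw [Finset.disjoint_filter]
        exact fun x _ hx hx' => notMem_of_mem_supp ((hq x).1 hx') hx
      · rw [Finset.disjoint_filter]
        exact fun x _ hx hx' => ((hp x).1 hx').1 hx
      · rw [Finset.disjoint_filter]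
        exact fun x _ hx hx' => ((hp x).1 hx').2 ((hq x).1 hx)
      · intro x hx y hy hxy
        rw [Finset.mem_filter, hq] at hx
        rw [Finset.mem_filter, hp] at hy
        exact hy.2.2 (mem_supp_of_adj hx.2 hy.2.1 hxy)

open Filter Topology in
-- It suffices to test the π-systems of events `F ⊆ I`. Since `Λ` may be infinite, its σ-algebra is
-- exhausted by those of the finite windows `Λ ∩ S.ballAt o n`, where the hard-core identity
-- applies, and Lévy's upward theorem passes to the limit.
theorem HasLaw.isSimple [Nonempty V] [IsProbabilityMeasure μ] (h : HasLaw S lam m μ) :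
    H.IsSimple μ := by
  obtain ⟨o⟩ := ‹Nonempty V›
  have := S.countable
  intro Λ
  suffices hs : iCondIndep (configSigma Λ) (configSigma_le Λ)
      (fun C : H.ComponentsOff Λ => configSigma (Subtype.val '' C.supp)) μ from
    fun s A hA => (iCondIndep_iff _ (configSigma_le Λ) _ (fun C => configSigma_le _) μ).1 hs s hA
  refine iCondIndepSets.iCondIndep _ (fun C => configSigma_le _)
    (fun C : H.ComponentsOff Λ => {s | ∃ F : Finset V, (F : Set V) ⊆ Subtype.val '' C.supp ∧
      s = {I | (F : Set V) ⊆ I}}) ?_ (fun C => configSigma_eq_generateFrom _) ?_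
  · rintro C _ ⟨F, hF, rfl⟩ _ ⟨F', hF', rfl⟩ _
    refine ⟨F ∪ F', by simp [hF, hF'], ?_⟩
    ext I
    simp
  · rw [iCondIndepSets_iff]
    swap
    · rintro C _ ⟨F, -, rfl⟩
      exact measurableSet_superset F
    intro s f hf
    choose! F hF using hf
    have hmem : ∀ v, ∃ n, v ∈ S.ballAt o n := fun v => S.exists_mem_ballAt o v
    let ℱ : Filtration ℕ (inferInstance : MeasurableSpace (Set V)) :=
      { seq := fun n => configSigma (Λ ∩ S.ballAt o n)
        mono' := fun i j hij => configSigma_mono (Set.inter_subset_inter_right _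
          (Finset.coe_subset.2 (EndStructure.ballAt_mono o hij)))
        le' := fun n => configSigma_le _ }
    have hsup : ⨆ n, ℱ n = configSigma Λ := iSup_configSigma hmem
    have hlim : ∀ E : Set (Set V), ∀ᵐ I ∂μ,
        Tendsto (fun n => (μ⟦E | ℱ n⟧) I) atTop (𝓝 ((μ⟦E | configSigma Λ⟧) I)) := by
      intro E
      have := tendsto_ae_condExp (μ := μ) (ℱ := ℱ) (E.indicator fun _ => (1 : ℝ))
      rwa [hsup] at this
    obtain ⟨N, hN⟩ := EndStructure.exists_subset_ballAt (S := S) o (s.biUnion F)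
    have hfin : ∀ᵐ I ∂μ, ∀ n ≥ N, (μ⟦⋂ C ∈ s, f C | ℱ n⟧) I =
        ∏ C ∈ s, (μ⟦f C | ℱ n⟧) I := by
      rw [ae_all_iff]
      intro n
      rw [eventually_imp_distrib_left]
      intro hn
      have hT := EndStructure.isSubtree_ballAt (S := S) o n
      have key := (h _ hT).condExp_iInter S (Λ := Λ) s F fun C hC =>
        ⟨(Finset.subset_biUnion_of_mem F hC).trans (hN.trans (EndStructure.ballAt_mono o hn)),
          (hF C hC).1⟩
      have e1 : ⋂ C ∈ s, f C = ⋂ C ∈ s, {I | (F C : Set V) ⊆ I} :=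
        Set.iInter₂_congr fun C hC => (hF C hC).2
      filter_upwards [key] with I hI
      rw [e1]
      refine hI.trans ?_
      rw [Finset.prod_apply]
      exact Finset.prod_congr rfl fun C hC => by rw [(hF C hC).2]
    have hall : ∀ᵐ I ∂μ, ∀ C ∈ s,
        Tendsto (fun n => (μ⟦f C | ℱ n⟧) I) atTop (𝓝 ((μ⟦f C | configSigma Λ⟧) I)) :=
      (ae_ball_iff s.countable_toSet).2 fun C _ => hlim (f C)
    filter_upwards [hlim (⋂ C ∈ s, f C), hfin, hall] with I h1 h2 h3
    rw [Finset.prod_apply]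
    refine tendsto_nhds_unique h1 ((tendsto_finsetProd s h3).congr' ?_)
    filter_upwards [eventually_ge_atTop N] with n hn
    exact (h2 n hn).symm

end Hypergraph

end

/-! ### The Markov property of simple measures at a vertex. -/

noncomputable section

open scoped Classical

theorem trace_eq_iff {V : Type*} {T A : Finset V} (hA : A ⊆ T) {I : Set V} :
    trace T I = A ↔ ∀ x ∈ T, (x ∈ I ↔ x ∈ A) := by
  simp only [Finset.ext_iff, mem_trace]
  exact ⟨fun h x hx => by rw [← h]; simp [hx], fun h x => ⟨fun hx => (h x hx.1).1 hx.2,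
    fun hx => ⟨hA hx, (h x (hA hx)).2 hx⟩⟩⟩

namespace Hypergraph

variable {V : Type*} {H : Hypergraph V} {k d : ℕ} {S : H.EndStructure k d}
  {μ : Measure (Set V)} {lam : ℝ} {Λ : Set V}

/-- A set closed under adjacency off `Λ` contains a whole component as soon as it meets it. -/
theorem mem_of_mem_supp {C : H.ComponentsOff Λ} {D : Set V}
    (hD : ∀ x ∈ D, ∀ y ∉ Λ, H.Adj x y → y ∈ D) {x y : V} (hx : x ∈ Subtype.val '' C.supp)
    (hy : y ∈ Subtype.val '' C.supp) (hxD : x ∈ D) : y ∈ D := by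
  obtain ⟨x, hx, rfl⟩ := hx
  obtain ⟨y, hy, rfl⟩ := hy
  obtain ⟨p⟩ := SimpleGraph.ConnectedComponent.exact (hx.trans hy.symm)
  clear hx hy
  induction p with
  | nil => exact hxD
  | @cons x z _ hadj p ih =>
    refine ih (hD _ hxD _ z.2 ?_)
    simp only [SimpleGraph.comap_adj, SimpleGraph.fromRel_adj, Function.Embedding.subtype_apply]
      at hadj
    exact hadj.2.elim id fun h => h.symm

theorem IsSimple.cylMass_iInter [IsProbabilityMeasure μ] (h : H.IsSimple μ) {L B : Finset V}
    (hB : cylMass μ Set.univ L B ≠ 0) (s : Finset (H.ComponentsOff (L : Set V)))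
    (A : H.ComponentsOff (L : Set V) → Set (Set V))
    (hA : ∀ C ∈ s, MeasurableSet[configSigma (Subtype.val '' C.supp)] (A C)) :
    cylMass μ (⋂ C ∈ s, A C) L B / cylMass μ Set.univ L B =
      ∏ C ∈ s, cylMass μ (A C) L B / cylMass μ Set.univ L B := by
  have hA' : ∀ C ∈ s, MeasurableSet (A C) := fun C hC => configSigma_le _ _ (hA C hC)
  have hall : ∀ᵐ I ∂μ, ∀ C ∈ s, (μ⟦A C | configSigma (L : Set V)⟧) I =
      cylMass μ (A C) L (trace L I) / cylMass μ Set.univ L (trace L I) :=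
    (ae_ball_iff s.countable_toSet).2 fun C hC => condExp_configSigma_coe (hA' C hC) L
  have hae := (h L s A hA).and
    ((condExp_configSigma_coe (μ := μ) (Finset.measurableSet_biInter s hA') L).and hall)
  have hpos : μ {I | trace L I = B} ≠ 0 := by
    rw [cylMass, Set.inter_univ, measureReal_def] at hB
    exact fun h0 => hB (by rw [h0]; rfl)
  -- The almost sure identities are evaluated at one configuration of the event with trace `B`,
  -- which has positive mass.
  obtain ⟨I, hI, h1, h2, h3⟩ := (frequently_ae_mem_iff.2 hpos).and_eventually hae |>.exists
  rw [Set.mem_ofPred_eq] at hI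
  simp only [hI] at h2
  rw [← h2, h1, Finset.prod_apply]
  refine Finset.prod_congr rfl fun C hC => ?_
  rw [h3 C hC, hI]

/-- Parts of a simple random set on different sides of a finite cutset. -/
theorem IsSimple.cylMass_mul [IsProbabilityMeasure μ] (h : H.IsSimple μ) {L B : Finset V}
    (hB : cylMass μ Set.univ L B ≠ 0) {D : Set V}
    (hD : ∀ x ∈ D, ∀ y ∉ (L : Set V), H.Adj x y → y ∈ D) {U₁ U₂ A₁ A₂ : Finset V}
    (hU₁ : ∀ x ∈ U₁, x ∉ L ∧ x ∉ D) (hU₂ : ∀ x ∈ U₂, x ∉ L ∧ x ∈ D) (hA₁ : A₁ ⊆ U₁)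
    (hA₂ : A₂ ⊆ U₂) :
    cylMass μ ({I | trace U₁ I = A₁} ∩ {I | trace U₂ I = A₂}) L B * cylMass μ Set.univ L B =
      cylMass μ {I | trace U₁ I = A₁} L B * cylMass μ {I | trace U₂ I = A₂} L B := by
  -- The finitely many components that meet a window; those meeting `U₁` lie outside `D` and those
  -- meeting `U₂` inside it.
  let s : Finset V → Finset (H.ComponentsOff (L : Set V)) := fun U =>
    (U.subtype (· ∈ ((L : Set V)ᶜ))).image (SimpleGraph.connectedComponentMk _)
  have hs : ∀ {U C}, C ∈ s U → ∃ x ∈ U, x ∈ Subtype.val '' C.supp := by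
    intro U C hC
    obtain ⟨x, hx, rfl⟩ := Finset.mem_image.1 hC
    exact ⟨x, (Finset.mem_subtype.1 hx), x, rfl, rfl⟩
  have hs' : ∀ {U : Finset V} {x}, x ∈ U → x ∉ L → ∃ C ∈ s U, x ∈ Subtype.val '' C.supp := by
    intro U x hx hxL
    have hxL' : x ∈ ((L : Set V)ᶜ) := hxL
    exact ⟨_, Finset.mem_image_of_mem _ (Finset.mem_subtype.2
      (show ((⟨x, hxL'⟩ : ((L : Set V)ᶜ : Set V)) : V) ∈ U from hx)), ⟨⟨x, hxL'⟩, rfl, rfl⟩⟩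
  let A : H.ComponentsOff (L : Set V) → Set (Set V) := fun C =>
    trace ((U₁ ∪ U₂).filter (· ∈ Subtype.val '' C.supp)) ⁻¹'
      {(A₁ ∪ A₂).filter (· ∈ Subtype.val '' C.supp)}
  have hA : ∀ C, MeasurableSet[configSigma (Subtype.val '' C.supp)] (A C) := by
    intro C
    refine measurable_trace_configSigma ?_ trivial
    intro x hx
    exact (Finset.mem_filter.1 hx).2
  have hmem : ∀ C I, I ∈ A C ↔ ∀ x ∈ U₁ ∪ U₂, x ∈ Subtype.val '' C.supp →
      (x ∈ I ↔ x ∈ A₁ ∪ A₂) := by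
    intro C I
    have := trace_eq_iff (I := I) (Finset.filter_subset_filter (· ∈ Subtype.val '' C.supp)
      (Finset.union_subset_union hA₁ hA₂))
    refine Iff.trans this ⟨fun h x hx hxC => ?_, fun h x hx => ?_⟩
    · rw [h x (Finset.mem_filter.2 ⟨hx, hxC⟩), Finset.mem_filter]
      exact ⟨fun h => h.1, fun h => ⟨h, hxC⟩⟩
    · rw [Finset.mem_filter] at hx
      rw [h x hx.1 hx.2, Finset.mem_filter]
      exact ⟨fun h => ⟨h, hx.2⟩, fun h => h.1⟩
  have e1 : ⋂ C ∈ s U₁, A C = {I | trace U₁ I = A₁} := by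
    ext I
    simp only [Set.mem_iInter, hmem, Set.mem_ofPred_eq, trace_eq_iff hA₁]
    constructor
    · intro hI x hx
      obtain ⟨C, hC, hxC⟩ := hs' hx (hU₁ x hx).1
      rw [hI C hC x (Finset.mem_union_left _ hx) hxC, Finset.mem_union]
      exact ⟨fun hx' => hx'.resolve_right fun hx2 => (hU₁ x hx).2 (hU₂ x (hA₂ hx2)).2, Or.inl⟩
    · intro hI C hC x hx hxC
      obtain ⟨y, hy, hyC⟩ := hs hC
      have hxD : x ∉ D := fun hxD => (hU₁ y hy).2 (mem_of_mem_supp hD hxC hyC hxD)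
      have hx1 : x ∈ U₁ := (Finset.mem_union.1 hx).resolve_right fun h => hxD (hU₂ x h).2
      rw [hI x hx1, Finset.mem_union]
      exact ⟨Or.inl, fun hx' => hx'.resolve_right fun hx2 => hxD (hU₂ x (hA₂ hx2)).2⟩
  have e2 : ⋂ C ∈ s U₂, A C = {I | trace U₂ I = A₂} := by
    ext I
    simp only [Set.mem_iInter, hmem, Set.mem_ofPred_eq, trace_eq_iff hA₂]
    constructor
    · intro hI x hx
      obtain ⟨C, hC, hxC⟩ := hs' hx (hU₂ x hx).1
      rw [hI C hC x (Finset.mem_union_right _ hx) hxC, Finset.mem_union]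
      exact ⟨fun hx' => hx'.resolve_left fun hx2 => (hU₁ x (hA₁ hx2)).2 (hU₂ x hx).2, Or.inr⟩
    · intro hI C hC x hx hxC
      obtain ⟨y, hy, hyC⟩ := hs hC
      have hxD : x ∈ D := mem_of_mem_supp hD hyC hxC (hU₂ y hy).2
      have hx1 : x ∈ U₂ := (Finset.mem_union.1 hx).resolve_left fun h => (hU₁ x h).2 hxD
      rw [hI x hx1, Finset.mem_union]
      exact ⟨Or.inr, fun hx' => hx'.resolve_left fun hx2 => (hU₁ x (hA₁ hx2)).2 hxD⟩
  have hdisj : Disjoint (s U₁) (s U₂) := by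
    rw [Finset.disjoint_left]
    intro C h1 h2
    obtain ⟨x, hx, hxC⟩ := hs h1
    obtain ⟨y, hy, hyC⟩ := hs h2
    exact (hU₁ x hx).2 (mem_of_mem_supp hD hyC hxC (hU₂ y hy).2)
  have k1 := h.cylMass_iInter hB (s U₁) A fun C _ => hA C
  have k2 := h.cylMass_iInter hB (s U₂) A fun C _ => hA C
  have k3 := h.cylMass_iInter hB (s U₁ ∪ s U₂) A fun C _ => hA C
  rw [Finset.prod_union hdisj, ← k1, ← k2, Finset.set_biInter_inter, e1, e2] at k3
  field_simp at k3
  exact k3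

namespace EndStructure

variable (S) in
/-- The vertices below `v` through its downward hyperedge `i`. -/
def descendants (v : V) (i : Fin d) : Set V :=
  {x | ∃ n, S.par (S.par^[n] x) = v ∧ S.idx (S.par^[n] x) = i}

theorem mem_descendants_of_adj {v : V} {i : Fin d} {x : V} (hx : x ∈ S.descendants v i) {y : V}
    (hy : y ≠ v) (hxy : H.Adj x y) : y ∈ S.descendants v i := by
  obtain ⟨n, h1, h2⟩ := hx
  obtain ⟨f, hf, hxf, hyf⟩ := S.adj_iff.1 hxy
  obtain ⟨u, j, rfl⟩ := S.isEdge_iff.1 hf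
  rw [S.mem_edge] at hxf hyf
  have child : ∀ {n z}, S.par y = z → S.par (S.par^[n] z) = v → S.idx (S.par^[n] z) = i →
      y ∈ S.descendants v i := by
    rintro n z rfl h1 h2
    exact ⟨n + 1, h1, h2⟩
  rcases hxf with rfl | ⟨hxu, hxj⟩
  · rcases hyf with rfl | ⟨hyu, -⟩
    · exact ⟨n, h1, h2⟩
    · exact child hyu h1 h2
  · rcases n with _ | n
    · simp only [Function.iterate_zero, id_eq] at h1 h2
      rcases hyf with rfl | ⟨hyu, hyj⟩
      · exact absurd (hxu.symm.trans h1) hy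
      · exact ⟨0, by simpa using hyu.trans (hxu.symm.trans h1),
          by simpa using hyj.trans (hxj.symm.trans h2)⟩
    · rw [Function.iterate_succ_apply, hxu] at h1 h2
      rcases hyf with rfl | ⟨hyu, -⟩
      · exact ⟨n, h1, h2⟩
      · exact child hyu h1 h2

theorem mem_descendants_of_mem_edge {v x : V} {i : Fin d} (hx : x ∈ (S.edge v i).erase v) :
    x ∈ S.descendants v i := by
  rw [Finset.mem_erase, S.mem_edge] at hx
  exact ⟨0, hx.2.resolve_left hx.1⟩

/-- Climbing from a descendant of `v` that lies in `T` stays in `T`, since these vertices are higher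
than `v` and hence differ from the top. The climb reaches a child of `v` in `S.edge v i`, but `T`
meets that hyperedge only in `v`. -/
theorem IsSubtree.notMem_descendants {T : Finset V} (hT : S.IsSubtree T) {v : V} {i : Fin d}
    (hev : S.edge v i ∩ T = {v}) {x : V} (hx : x ∈ T) : x ∉ S.descendants v i := by
  rintro ⟨n, h1, h2⟩
  obtain ⟨t, ht⟩ := hT
  have hvT : v ∈ T := by
    have : v ∈ S.edge v i ∩ T := by simp [hev]
    exact (Finset.mem_inter.1 this).2
  have hht : ∀ m (y : V), S.par (S.par^[m] y) = v → S.ht v < S.ht y := by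
    intro m y hy
    rw [← Function.iterate_succ_apply' S.par m y] at hy
    have := S.ht_iterate (m + 1) y
    rw [hy] at this
    push_cast at this
    omega
  have key : ∀ m (y : V), y ∈ T → S.par (S.par^[m] y) = v → S.par^[m] y ∈ T := by
    intro m
    induction m with
    | zero => exact fun y hy _ => hy
    | succ m ih =>
      intro y hy hyv
      rw [Function.iterate_succ_apply] at hyv ⊢
      refine ih _ ?_ hyv
      have hyt : y ≠ t := by
        rintro rfl
        have a1 := ht.ht_le hvT
        have a2 := hht (m + 1) y (by rwa [Function.iterate_succ_apply])
        omega
      exact ht.2 y hy hyt (S.par_mem_up y)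
  have hmem : S.par^[n] x ∈ S.edge v i ∩ T :=
    Finset.mem_inter.2 ⟨S.mem_edge.2 (Or.inr ⟨h1, h2⟩), key n x hx h1⟩
  rw [hev, Finset.mem_singleton] at hmem
  rw [hmem] at h1
  exact S.par_ne v h1

end EndStructure

/-- The single vertex `v` is the cutset and the descendants through the new hyperedge are one side
of it. The marginal on the enlarged subtree is thereby determined by the marginals on `T`, on the
hyperedge and at `v`. -/
theorem IsSimple.cylMass_union_edge [IsProbabilityMeasure μ] (h : H.IsSimple μ) {T : Finset V}
    (hT : S.IsSubtree T) {v : V} {i : Fin d} (hev : S.edge v i ∩ T = {v})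
    (hpos : ∀ B ⊆ {v}, cylMass μ Set.univ {v} B ≠ 0) {A : Finset V} (hA : A ⊆ T ∪ S.edge v i) :
    cylMass μ Set.univ (T ∪ S.edge v i) A * cylMass μ Set.univ {v} (A ∩ {v}) =
      cylMass μ Set.univ T (A ∩ T) * cylMass μ Set.univ (S.edge v i) (A ∩ S.edge v i) := by
  have hve : v ∈ S.edge v i ∩ T := by simp [hev]
  rw [Finset.mem_inter] at hve
  have key := h.cylMass_mul (hpos (A ∩ {v}) Finset.inter_subset_right) (D := S.descendants v i)
    (U₁ := T.erase v) (U₂ := (S.edge v i).erase v) (A₁ := A ∩ T.erase v)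
    (A₂ := A ∩ (S.edge v i).erase v) ?_ ?_ ?_ Finset.inter_subset_right Finset.inter_subset_right
  · have hrw : ∀ (W : Finset V), v ∈ W → ∀ I : Set V,
        (trace {v} I = A ∩ {v} ∧ trace (W.erase v) I = A ∩ W.erase v) ↔ trace W I = A ∩ W := by
      intro W hW I
      simp only [trace_eq_iff Finset.inter_subset_right]
      constructor
      · intro ⟨h1, h2⟩ x hx
        by_cases hxv : x = v
        · subst hxv
          simpa [hx] using h1 x (by simp)
        · simpa [hxv] using h2 x (by simp [hxv, hx])
      · intro h
        refine ⟨fun x hx => ?_, fun x hx => ?_⟩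
        · rw [Finset.mem_singleton] at hx
          subst hx
          simpa [hW] using h x hW
        · rw [Finset.mem_erase] at hx
          simpa [hx.1, hx.2] using h x hx.2
    have c1 : cylMass μ {I | trace (T.erase v) I = A ∩ T.erase v} {v} (A ∩ {v}) =
        cylMass μ Set.univ T (A ∩ T) := by
      rw [cylMass, cylMass, Set.inter_univ]
      congr 1
      ext I
      exact hrw T hve.2 I
    have c2 : cylMass μ {I | trace ((S.edge v i).erase v) I = A ∩ (S.edge v i).erase v} {v}
        (A ∩ {v}) = cylMass μ Set.univ (S.edge v i) (A ∩ S.edge v i) := by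
      rw [cylMass, cylMass, Set.inter_univ]
      congr 1
      ext I
      exact hrw _ hve.1 I
    have c3 : cylMass μ ({I | trace (T.erase v) I = A ∩ T.erase v} ∩
        {I | trace ((S.edge v i).erase v) I = A ∩ (S.edge v i).erase v}) {v} (A ∩ {v}) =
        cylMass μ Set.univ (T ∪ S.edge v i) A := by
      rw [cylMass, cylMass, Set.inter_univ]
      congr 1
      ext I
      rw [Set.inter_inter_distrib_left]
      refine (and_congr (hrw T hve.2 I) (hrw _ hve.1 I)).trans ?_
      rw [Set.mem_ofPred_eq, trace_eq_iff hA, trace_eq_iff Finset.inter_subset_right,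
        trace_eq_iff Finset.inter_subset_right]
      simp only [Finset.mem_inter, Finset.mem_union]
      grind
    rw [c1, c2, c3] at key
    exact key
  · intro x hx y hy hxy
    exact EndStructure.mem_descendants_of_adj hx (by simpa using hy) hxy
  · intro x hx
    rw [Finset.mem_erase] at hx
    exact ⟨by simpa using hx.1, hT.notMem_descendants hev hx.2⟩
  · intro x hx
    exact ⟨by simpa using Finset.ne_of_mem_erase hx, EndStructure.mem_descendants_of_mem_edge hx⟩

end Hypergraph

end

/-! ### Uniqueness of the simple measure with constant density. -/

noncomputable section

open scoped Classical

theorem Finset.sum_powerset_of_subsingleton {V : Type*} {E : Finset V} {f : Finset V → ℝ}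
    (hf : ∀ B ⊆ E, ∀ x ∈ B, ∀ y ∈ B, x ≠ y → f B = 0) :
    ∑ B ∈ E.powerset, f B = f ∅ + ∑ u ∈ E, f {u} := by
  have hsub : insert ∅ (E.image fun u => ({u} : Finset V)) ⊆ E.powerset := by
    intro D hD
    simp only [Finset.mem_insert, Finset.mem_image] at hD
    rcases hD with rfl | ⟨u, hu, rfl⟩
    · simp
    · simpa using hu
  rw [← Finset.sum_subset hsub, Finset.sum_insert, Finset.sum_image]
  · intro a _ b _ h
    simpa using h
  · simp
  · intro B hB hB'
    rw [Finset.mem_insert, Finset.mem_image, not_or] at hB'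
    obtain ⟨x, hx⟩ := Finset.nonempty_iff_ne_empty.2 hB'.1
    rw [Finset.mem_powerset] at hB
    obtain ⟨y, hy, hyx⟩ : ∃ y ∈ B, y ≠ x := by
      by_contra! h
      exact hB'.2 ⟨x, hB hx, (Finset.eq_singleton_iff_unique_mem.2 ⟨hx, h⟩).symm⟩
    exact hf B hB y hy x hx hyx

namespace Hypergraph

variable {V : Type*} {H : Hypergraph V} {k d : ℕ} {S : H.EndStructure k d}
  {μ ν : Measure (Set V)} {lam p : ℝ}

theorem cylMass_eq_zero_of_adj (S : H.EndStructure k d) (hind : ∀ᵐ I ∂μ, H.IsIndep I)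
    {T A : Finset V} {x y : V} (hx : x ∈ A) (hy : y ∈ A) (hxy : x ≠ y) (hadj : H.Adj x y) :
    cylMass μ Set.univ T A = 0 := by
  refine cylMass_eq_zero hind fun h => hxy ?_
  rw [S.isIndep_iff] at h
  exact h x hx y hy hadj

theorem cylMass_singleton_empty [IsProbabilityMeasure μ] (v : V) :
    cylMass μ Set.univ {v} ∅ = 1 - cylMass μ Set.univ {v} {v} := by
  have h := sum_cylMass (μ := μ) .univ {v}
  rw [Finset.sum_powerset_of_subsingleton, Finset.sum_singleton, probReal_univ] at h
  · linarith
  · intro B hB x hx y hy hxy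
    exact absurd ((Finset.mem_singleton.1 (hB hx)).trans (Finset.mem_singleton.1 (hB hy)).symm) hxy

theorem cylMass_of_star [IsProbabilityMeasure μ] (S : H.EndStructure k d)
    (hind : ∀ᵐ I ∂μ, H.IsIndep I) {x : V} {T : Finset V} (hx : x ∈ T)
    (hadj : ∀ y ∈ T, H.Adj x y) :
    cylMass μ Set.univ T {x} = cylMass μ Set.univ {x} {x} := by
  have hT : {x} ∪ T.erase x = T := by
    rw [← Finset.insert_eq, Finset.insert_erase hx]
  rw [cylMass_eq_sum (D := T.erase x) .univ (by simp) subset_rfl, hT,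
    Finset.sum_eq_single ∅, Finset.union_empty]
  · intro B hB hB0
    obtain ⟨y, hy⟩ := Finset.nonempty_iff_ne_empty.2 hB0
    have hy' := Finset.mem_erase.1 (Finset.mem_powerset.1 hB hy)
    exact cylMass_eq_zero_of_adj S hind (x := x) (y := y) (by simp) (by simp [hy]) hy'.1.symm
      (hadj y hy'.2)
  · simp

theorem cylMass_edge_singleton [IsProbabilityMeasure μ] (S : H.EndStructure k d)
    (hind : ∀ᵐ I ∂μ, H.IsIndep I) {e : Finset V} (he : H.IsEdge e) {x : V} (hx : x ∈ e) :
    cylMass μ Set.univ e {x} = cylMass μ Set.univ {x} {x} :=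
  cylMass_of_star S hind hx fun _ hy => ⟨e, he, hx, hy⟩

theorem cylMass_edge_empty [IsProbabilityMeasure μ] (S : H.EndStructure k d)
    (hind : ∀ᵐ I ∂μ, H.IsIndep I) (hp : ∀ v, cylMass μ Set.univ {v} {v} = p) {e : Finset V}
    (he : H.IsEdge e) {v : V} (hv : v ∈ e) : cylMass μ Set.univ e ∅ = 1 - (k + 1) * p := by
  have h := sum_cylMass (μ := μ) .univ e
  have hc : #e = k + 1 := by
    rw [← S.card_edge_erase he hv, Finset.card_erase_add_one hv]
  rw [Finset.sum_powerset_of_subsingleton, probReal_univ,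
    Finset.sum_congr rfl fun u hu => (cylMass_edge_singleton S hind he hu).trans (hp u),
    Finset.sum_const, hc, nsmul_eq_mul] at h
  · push_cast at h
    linarith
  · intro B hB x hx y hy hxy
    exact cylMass_eq_zero_of_adj S hind hx hy hxy ⟨e, he, hB hx, hB hy⟩

/-- Given that `v` is vacant, its `d + 1` hyperedges are independent, and each is vacant with
conditional probability `(1 - (k + 1) * p) / (1 - p)`. -/
theorem IsSimple.cylMass_star_empty [IsProbabilityMeasure μ] (hk : 1 ≤ k) (h : H.IsSimple μ)
    (hind : ∀ᵐ I ∂μ, H.IsIndep I) (hp : ∀ v, cylMass μ Set.univ {v} {v} = p) (hp0 : p ≠ 0)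
    (hp1 : 1 - p ≠ 0) (v : V) : cylMass μ Set.univ (S.hull {v}) ∅ =
      (1 - p) * ((1 - (k + 1) * p) / (1 - p)) ^ (d + 1) := by
  have hv0 : cylMass μ Set.univ {v} ∅ = 1 - p := by rw [cylMass_singleton_empty, hp]
  have hpos : ∀ B ⊆ {v}, cylMass μ Set.univ {v} B ≠ 0 := by
    intro B hB
    rcases Finset.subset_singleton_iff.1 hB with rfl | rfl
    · rwa [hv0]
    · rwa [hp]
  have key : ∀ s : Finset (Fin d), S.IsSubtree (S.up v ∪ s.biUnion (S.edge v)) ∧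
      cylMass μ Set.univ (S.up v ∪ s.biUnion (S.edge v)) ∅ =
        (1 - p) * ((1 - (k + 1) * p) / (1 - p)) ^ (#s + 1) := by
    intro s
    induction s using Finset.induction_on with
    | empty =>
      have hup : S.IsSubtree (S.up v) := by
        have := (EndStructure.isSubtree_singleton (S := S) v).union_edge (S.isEdge_up v) (v := v)
          (by simp [S.mem_up v])
        rwa [Finset.union_eq_right.2 (by simpa using S.mem_up v)] at this
      rw [Finset.biUnion_empty, Finset.union_empty,
        cylMass_edge_empty S hind hp (S.isEdge_up v) (S.mem_up v)]
      refine ⟨hup, ?_⟩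
      rw [Finset.card_empty, zero_add, pow_one]
      field_simp
    | insert i s his ih =>
      have hev : S.edge v i ∩ (S.up v ∪ s.biUnion (S.edge v)) = {v} := by
        ext x
        simp only [Finset.mem_inter, Finset.mem_union, Finset.mem_biUnion, Finset.mem_singleton]
        constructor
        · rintro ⟨hx, hx'⟩
          by_contra hxv
          have heq : ∀ f, H.IsEdge f → x ∈ f → v ∈ f → S.edge v i = f := fun f hf h1 h2 =>
            S.isEdge_eq_of_mem (S.isEdge_edge v i) hf hxv hx (S.mem_edge.2 (Or.inl rfl)) h1 h2
          rcases hx' with hx' | ⟨j, hj, hx'⟩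
          · have := heq _ (S.isEdge_up v) hx' (S.mem_up v)
            exact S.par_ne v (S.edge_inj hk this).1.symm
          · have := heq _ (S.isEdge_edge v j) hx' (S.mem_edge.2 (Or.inl rfl))
            exact his ((S.edge_inj hk this).2 ▸ hj)
        · rintro rfl
          exact ⟨S.mem_edge.2 (Or.inl rfl), Or.inl (S.mem_up x)⟩
      have hT : S.up v ∪ (insert i s).biUnion (S.edge v) =
          S.up v ∪ s.biUnion (S.edge v) ∪ S.edge v i := by
        rw [Finset.biUnion_insert, Finset.union_comm (S.edge v i), Finset.union_assoc]
      rw [hT]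
      refine ⟨ih.1.union_edge (S.isEdge_edge v i) hev, ?_⟩
      have hstep := h.cylMass_union_edge ih.1 hev hpos (Finset.empty_subset _)
      simp only [Finset.empty_inter] at hstep
      rw [hv0, ih.2, cylMass_edge_empty S hind hp (S.isEdge_edge v i)
        (S.mem_edge.2 (Or.inl rfl))] at hstep
      rw [Finset.card_insert_of_notMem his, pow_succ _ (#s + 1), ← mul_assoc, mul_div_assoc',
        eq_div_iff hp1, hstep]
  have hhull : S.hull {v} = S.up v ∪ Finset.univ.biUnion (S.edge v) := by
    ext x
    simp only [EndStructure.hull, EndStructure.edgesAt, Finset.singleton_biUnion, Finset.mem_union,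
      Finset.mem_biUnion, Finset.mem_insert, Finset.mem_image, Finset.mem_univ, true_and, id]
    constructor
    · rintro ⟨e, rfl | ⟨i, rfl⟩, hx⟩
      · exact Or.inl hx
      · exact Or.inr ⟨i, hx⟩
    · rintro (hx | ⟨i, hx⟩)
      · exact ⟨_, Or.inl rfl, hx⟩
      · exact ⟨_, Or.inr ⟨i, rfl⟩, hx⟩
  rw [hhull, (key Finset.univ).2, Finset.card_univ, Fintype.card_fin]

/-- The one-point probabilities of a simple Gibbs measure, if they are all equal. -/
theorem IsGibbs.density_eq (S : H.EndStructure k d) (hk : 1 ≤ k) (hlam : 0 < lam)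
    (hμ : H.IsGibbs lam μ) (h : H.IsSimple μ) (hp : ∀ v, cylMass μ Set.univ {v} {v} = p) (v : V) :
    0 < p ∧ p < 1 ∧ k * (p / (1 - p)) ≤ 1 ∧
      p / (1 - p) = lam * (1 - k * (p / (1 - p))) ^ (d + 1) := by
  have := hμ.isProbabilityMeasure
  have hstar := hμ.cylMass_hull_pos S hlam {v}
  -- The Gibbs identity in the window `{v}`; an occupied `v` has all its neighbours vacant anyway.
  have hpstar : p = lam * cylMass μ Set.univ (S.hull {v}) ∅ := by
    rw [← hp v, ← cylMass_of_star S hμ.ae_isIndep (EndStructure.subset_hull {v} (by simp)),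
      hμ.cylMass_hull S hlam subset_rfl, wt, if_pos, Finset.prod_singleton, mul_comm]
    · rw [S.isIndep_iff]
      simp
    · intro y hy
      obtain ⟨w, hw, e, he, hwe, hye⟩ := EndStructure.mem_hull.1 hy
      rw [Finset.mem_singleton] at hw
      exact ⟨e, he, hw ▸ hwe, hye⟩
  have hp0 : 0 < p := by rw [hpstar]; positivity
  have hp1 : p < 1 := by
    have h1 := cylMass_singleton_empty (μ := μ) v
    have h2 : cylMass μ Set.univ (S.hull {v}) ∅ ≤ cylMass μ Set.univ {v} ∅ := by
      refine measureReal_mono (Set.inter_subset_inter_left _ fun I hI => ?_)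
      have hv := EndStructure.subset_hull (S := S) {v}
      rw [Set.mem_ofPred_eq] at hI ⊢
      rw [← trace_trace hv, hI, Finset.empty_inter]
    rw [hp] at h1
    linarith
  have hp1' : 0 < 1 - p := by linarith
  have he := cylMass_edge_empty S hμ.ae_isIndep hp (S.isEdge_up v) (S.mem_up v)
  have he0 : 0 ≤ 1 - (k + 1) * p := by rw [← he]; exact cylMass_nonneg _ _
  rw [h.cylMass_star_empty hk hμ.ae_isIndep hp hp0.ne' hp1'.ne' v] at hpstar
  have hr : 1 - k * (p / (1 - p)) = (1 - (k + 1) * p) / (1 - p) := by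
    field_simp
    ring
  refine ⟨hp0, hp1, ?_, ?_⟩
  · have : 0 ≤ 1 - k * (p / (1 - p)) := by rw [hr]; positivity
    linarith
  · rw [hr, div_eq_iff hp1'.ne']
    linarith

/-- The density is the unique solution of the equation for the odds. It determines the hyperedge
marginals, where at most one vertex is occupied, and the Markov property at a vertex extends the
agreement to subtrees one hyperedge at a time. -/
theorem IsSimple.unique [Nonempty V] (S : H.EndStructure k d) (hk : 1 ≤ k) (hlam : 0 < lam)
    (hμ : H.IsGibbs lam μ) (hμs : H.IsSimple μ) (hν : H.IsGibbs lam ν) (hνs : H.IsSimple ν)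
    (hμp : ∀ v w, cylMass μ Set.univ {v} {v} = cylMass μ Set.univ {w} {w})
    (hνp : ∀ v w, cylMass ν Set.univ {v} {v} = cylMass ν Set.univ {w} {w}) : μ = ν := by
  obtain ⟨o⟩ := ‹Nonempty V›
  have := hμ.isProbabilityMeasure
  have := hν.isProbabilityMeasure
  obtain ⟨a0, a1, a2, a3⟩ := hμ.density_eq S hk hlam hμs (fun v => hμp v o) o
  obtain ⟨b0, b1, b2, b3⟩ := hν.density_eq S hk hlam hνs (fun v => hνp v o) o
  have hq := HardCoreRecursion.odds_unique hlam a2 b2 a3 b3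
  obtain ⟨p, hp⟩ : ∃ p, p = cylMass μ Set.univ {o} {o} := ⟨_, rfl⟩
  obtain ⟨q, hq'⟩ : ∃ q, q = cylMass ν Set.univ {o} {o} := ⟨_, rfl⟩
  rw [← hp] at a0 a1 hq
  rw [← hq'] at b1 hq
  have hpq : p = q := by
    rw [div_eq_div_iff (by linarith) (by linarith)] at hq
    linarith
  have h1 : ∀ v, cylMass μ Set.univ {v} {v} = p := fun v => (hμp v o).trans hp.symm
  have h2 : ∀ v, cylMass ν Set.univ {v} {v} = p := fun v => (hνp v o).trans (hq'.symm.trans hpq.symm)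
  have hsing : ∀ v, ∀ B ⊆ {v}, cylMass μ Set.univ {v} B ≠ 0 ∧
      cylMass μ Set.univ {v} B = cylMass ν Set.univ {v} B := by
    intro v B hB
    rcases Finset.subset_singleton_iff.1 hB with rfl | rfl
    · rw [cylMass_singleton_empty, cylMass_singleton_empty, h1, h2]
      exact ⟨by linarith, rfl⟩
    · rw [h1, h2]
      exact ⟨a0.ne', rfl⟩
  have hedge : ∀ v i, ∀ A ⊆ S.edge v i,
      cylMass μ Set.univ (S.edge v i) A = cylMass ν Set.univ (S.edge v i) A := by
    intro v i A hA
    have he := S.isEdge_edge v i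
    by_cases hsub : ∃ x ∈ A, ∃ y ∈ A, x ≠ y
    · obtain ⟨x, hx, y, hy, hxy⟩ := hsub
      have hadj : H.Adj x y := ⟨_, he, hA hx, hA hy⟩
      rw [cylMass_eq_zero_of_adj S hμ.ae_isIndep hx hy hxy hadj,
        cylMass_eq_zero_of_adj S hν.ae_isIndep hx hy hxy hadj]
    · push Not at hsub
      rcases A.eq_empty_or_nonempty with rfl | ⟨x, hx⟩
      · rw [cylMass_edge_empty S hμ.ae_isIndep h1 he (S.mem_edge.2 (Or.inl rfl)),
          cylMass_edge_empty S hν.ae_isIndep h2 he (S.mem_edge.2 (Or.inl rfl))]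
      · obtain rfl : A = {x} :=
          Finset.eq_singleton_iff_unique_mem.2 ⟨hx, fun y hy => hsub y hy x hx⟩
        have hxe := hA hx
        rw [cylMass_edge_singleton S hμ.ae_isIndep he hxe,
          cylMass_edge_singleton S hν.ae_isIndep he hxe, h1, h2]
  refine eq_of_cylMass_eq fun F => ?_
  obtain ⟨n, hn⟩ := EndStructure.exists_subset_ballAt (S := S) o F
  obtain ⟨t, ht⟩ := EndStructure.isSubtree_ballAt (S := S) o n
  refine ⟨_, hn, ht.up_induction hk
    (Q := fun T => ∀ A ⊆ T, cylMass μ Set.univ T A = cylMass ν Set.univ T A)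
    (fun A hA => (hsing t A hA).2) ?_⟩
  intro T v i hT hev ih A hA
  have k1 := hμs.cylMass_union_edge hT hev (fun B hB => (hsing v B hB).1) hA
  have k2 := hνs.cylMass_union_edge hT hev
    (fun B hB => (hsing v B hB).2 ▸ (hsing v B hB).1) hA
  have hB := hsing v (A ∩ {v}) Finset.inter_subset_right
  rw [← ih _ Finset.inter_subset_right, ← hedge v i _ Finset.inter_subset_right, ← k1,
    ← hB.2] at k2
  exact (mul_right_cancel₀ hB.1 k2).symm

end Hypergraph

end

/-! ### Existence, uniqueness and non-uniqueness for independent sets. -/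

noncomputable section

open scoped Classical

namespace Hypergraph

variable {V : Type*} {H : Hypergraph V} {k d : ℕ} {S : H.EndStructure k d}
  {μ ν : Measure (Set V)} {lam : ℝ}

theorem IsRegularHypertree.nonempty (hH : H.IsRegularHypertree k d) : Nonempty V := by
  obtain ⟨v | e⟩ := hH.isTree.connected.nonempty
  · exact ⟨v⟩
  · have h := hH.uniform e.1 e.2
    obtain ⟨v, -⟩ := Set.nonempty_of_ncard_ne_zero (by rw [h]; omega)
    exact ⟨v⟩

theorem IsInvariant.mono {G G' : Subgroup (Equiv.Perm V)} (h : IsInvariant G μ) (hG : G' ≤ G) :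
    IsInvariant G' μ := fun g hg => h g (hG hg)

theorem IsInvariant.cylMass_singleton {G : Subgroup (Equiv.Perm V)} (h : IsInvariant G μ)
    {g : Equiv.Perm V} (hg : g ∈ G) (v : V) :
    cylMass μ Set.univ {g v} {g v} = cylMass μ Set.univ {v} {v} := by
  rw [cylMass, cylMass, Set.inter_univ, Set.inter_univ]
  conv_lhs => rw [← h g hg]
  rw [measureReal_def, measureReal_def, Measure.map_apply (measurable_image g)
    (measurableSet_trace _ (· = _))]
  congr 2
  ext I
  simp [trace_eq_iff]

theorem exists_simple_gibbs (S : H.EndStructure k d) [Nonempty V] (hk : 1 ≤ k) (hlam : 0 < lam) :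
    ∃ t, 0 < t ∧ t * (1 + k * lam * t ^ d) = 1 ∧ ∃ μ, IsProbabilityMeasure μ ∧
      HasLaw S lam (fun _ _ => lam * t ^ d) μ ∧ H.IsGibbs lam μ ∧ H.IsSimple μ ∧
      IsInvariant H.aut μ := by
  obtain ⟨t, ht, hfix⟩ := exists_fixed_vacancy hk d hlam
  have hm := isBoundaryLaw_const S hk hlam ht hfix
  obtain ⟨μ, hμ, h⟩ := hm.exists_hasLaw hk hlam
  exact ⟨t, ht, hfix, μ, hμ, h, h.isGibbs hlam hm, h.isSimple,
    h.isInvariant hk le_rfl fun _ _ _ _ => rfl⟩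

theorem existsUnique_simple_gibbs (S : H.EndStructure k d) [Nonempty V] (hk : 1 ≤ k)
    (hlam : 0 < lam) :
    ∃! μ : Measure (Set V), H.IsGibbs lam μ ∧ H.IsSimple μ ∧ IsInvariant H.aut μ := by
  obtain ⟨_, _, _, μ, _, _, hμ⟩ := exists_simple_gibbs S hk hlam
  have hp : ∀ ν : Measure (Set V), IsInvariant H.aut ν → ∀ v w,
      cylMass ν Set.univ {v} {v} = cylMass ν Set.univ {w} {w} := by
    intro ν hν v w
    obtain ⟨g, hg, rfl, -⟩ := S.exists_translation w v
    exact hν.cylMass_singleton hg w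
  exact ⟨μ, hμ, fun ν hν =>
    IsSimple.unique S hk hlam hν.1 hν.2.1 hμ.1 hμ.2.1 (hp ν hν.2.2) (hp μ hμ.2.2)⟩

theorem exists_forall_gibbs_eq (S : H.EndStructure k d) [Nonempty V] (hk : 1 ≤ k) (hd : 1 ≤ d)
    (hlam : 0 < lam) (hcrit : ENNReal.ofReal lam ≤ criticalActivity k d) :
    ∃ μ : Measure (Set V), H.IsGibbs lam μ ∧ IsInvariant H.aut μ ∧
      ∀ ν, H.IsGibbs lam ν → ν = μ := by
  rw [ofReal_le_criticalActivity_iff hk hd hlam] at hcrit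
  obtain ⟨t, ht, hfix, μ, hμp, hlaw, hμ, _, hinv⟩ := exists_simple_gibbs S hk hlam
  refine ⟨μ, hμ, hinv, fun ν hν => ?_⟩
  have := hν.isProbabilityMeasure
  exact (IsGibbs.hasLaw_const S hk hd hν hlam hcrit ht hfix).unique hlaw

/-- The activity on a one-vertex subtree is the odds of occupation there, a quantity read off from
the measure alone. -/
theorem HasLaw.lawWeight_eq [IsProbabilityMeasure μ] {m m' : V → Finset V → ℝ} (hlam : 0 < lam)
    (hm : IsBoundaryLaw H S lam m) (h : HasLaw S lam m μ) (h' : HasLaw S lam m' μ) (v : V) :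
    lawWeight S lam m {v} v = lawWeight S lam m' {v} v := by
  have hv := EndStructure.isSubtree_singleton (S := S) v
  have hi : H.IsIndep (({v} : Finset V) : Set V) := by
    rw [S.isIndep_iff]
    simp
  have h1 := h _ hv _ subset_rfl
  have h2 := h' _ hv _ subset_rfl
  rw [wt, if_pos hi, Finset.prod_singleton] at h1 h2
  have hpos : 0 < cylMass μ Set.univ {v} ∅ := by
    rw [(h _ hv).cylMass_eq (Finset.empty_subset _), wt_empty S, mul_one]
    exact inv_pos.2 (sum_wt_pos S (lawWeight_nonneg hlam hm _))
  exact mul_left_cancel₀ hpos.ne' (h1.symm.trans h2)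

/-- A proper cycle for `L = k * lam`, divided by `k`, gives two boundary laws by exchanging its
values. Both are preserved by the parity group, and their one-vertex odds differ. -/
theorem exists_gibbs_ne (S : H.EndStructure k d) [Nonempty V] (hk : 1 ≤ k) (hd : 1 ≤ d)
    (hlam : 0 < lam) (hcrit : ¬ ENNReal.ofReal lam ≤ criticalActivity k d) :
    ∃ μ ν : Measure (Set V), μ ≠ ν ∧ (H.IsGibbs lam μ ∧ IsInvariant S.parityGroup μ) ∧
      H.IsGibbs lam ν ∧ IsInvariant S.parityGroup ν := by
  rw [ofReal_le_criticalActivity_iff hk hd hlam, not_le] at hcrit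
  have hk0 : (0 : ℝ) < k := by exact_mod_cast hk
  obtain ⟨x, y, hx, hy, hxy, hx', hy'⟩ :=
    HardCoreRecursion.exists_cycle hd (mul_pos hk0 hlam) hcrit
  have ha : 0 < x / k := div_pos hx hk0
  have hb : 0 < y / k := div_pos hy hk0
  have hab : x / k * (1 + k * (y / k)) ^ d = lam := by
    rw [mul_div_cancel₀ _ hk0.ne', div_mul_eq_mul_div, hx', mul_div_cancel_left₀ _ hk0.ne']
  have hba : y / k * (1 + k * (x / k)) ^ d = lam := by
    rw [mul_div_cancel₀ _ hk0.ne', div_mul_eq_mul_div, hy', mul_div_cancel_left₀ _ hk0.ne']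
  have hne : x / k ≠ y / k := fun h => hxy ((div_left_inj' hk0.ne').1 h)
  obtain ⟨hm₁, hw₁⟩ := isBoundaryLaw_cycleLaw S hk ha hb hab hba
  obtain ⟨hm₂, hw₂⟩ := isBoundaryLaw_cycleLaw S hk hb ha hba hab
  obtain ⟨μ, _, hμ⟩ := hm₁.exists_hasLaw hk hlam
  obtain ⟨ν, _, hν⟩ := hm₂.exists_hasLaw hk hlam
  have hG := S.parityGroup_le
  refine ⟨μ, ν, ?_, ⟨hμ.isGibbs hlam hm₁, hμ.isInvariant hk hG
    fun g hg v e => cycleLaw_image hg _ _ v e⟩, hν.isGibbs hlam hm₂, hν.isInvariant hk hG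
    fun g hg v e => cycleLaw_image hg _ _ v e⟩
  rintro rfl
  obtain ⟨v⟩ := ‹Nonempty V›
  have h := hμ.lawWeight_eq hlam hm₁ hν v
  rw [hw₁, hw₂] at h
  have hodds := HardCoreRecursion.cycle_odds_ne hk ha hb hne
  split_ifs at h
  · exact hodds h
  · exact hodds h.symm

theorem existsUnique_gibbs_iff (S : H.EndStructure k d) [Nonempty V] (hk : 1 ≤ k) (hd : 1 ≤ d)
    (hlam : 0 < lam) : (∃! μ : Measure (Set V), H.IsGibbs lam μ) ↔
      ENNReal.ofReal lam ≤ criticalActivity k d := by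
  constructor
  · intro h
    by_contra hcrit
    obtain ⟨μ, ν, hne, hμ, hν⟩ := exists_gibbs_ne S hk hd hlam hcrit
    exact hne (h.unique hμ.1 hν.1)
  · intro hcrit
    obtain ⟨μ, hμ, -, h⟩ := exists_forall_gibbs_eq S hk hd hlam hcrit
    exact ⟨μ, hμ, h⟩

theorem existsUnique_parityGroup_invariant_gibbs_iff (S : H.EndStructure k d) [Nonempty V]
    (hk : 1 ≤ k) (hd : 1 ≤ d) (hlam : 0 < lam) :
    (∃! μ : Measure (Set V), H.IsGibbs lam μ ∧ IsInvariant S.parityGroup μ) ↔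
      ENNReal.ofReal lam ≤ criticalActivity k d := by
  constructor
  · intro h
    by_contra hcrit
    obtain ⟨μ, ν, hne, hμ, hν⟩ := exists_gibbs_ne S hk hd hlam hcrit
    exact hne (h.unique hμ hν)
  · intro hcrit
    obtain ⟨μ, hμ, hinv, h⟩ := exists_forall_gibbs_eq S hk hd hlam hcrit
    exact ⟨μ, ⟨hμ, hinv.mono S.parityGroup_le⟩, fun ν hν => h ν hν.1⟩

end Hypergraph

end

/-! ### Duality with matchings. -/

noncomputable section

namespace Hypergraph

variable {W : Type*} {K : Hypergraph W} {k d : ℕ} {lam : ℝ}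

/-- Every vertex lies in at least two hyperedges, whereas two distinct vertices share at most one.
-/
theorem IsRegularHypertree.injective_star (hK : K.IsRegularHypertree d k) (hk : 1 ≤ k)
    (hd : 1 ≤ d) : Function.Injective fun v : W => {e : K.edgeSet | v ∈ (e : Set W)} := by
  obtain ⟨S⟩ := hK.nonempty_endStructure hd hk
  intro v w hvw
  by_contra hne
  have hw : ∀ e : Finset W, K.IsEdge e → v ∈ e → w ∈ e := by
    intro e he hv
    have : (⟨e, he⟩ : K.edgeSet) ∈ {e : K.edgeSet | v ∈ (e : Set W)} := hv
    exact (Set.ext_iff.1 hvw _).1 this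
  have h1 := S.isEdge_edge v ⟨0, hk⟩
  have hv1 : v ∈ S.edge v ⟨0, hk⟩ := S.mem_edge.2 (Or.inl rfl)
  have h2 := S.isEdge_eq_of_mem h1 (S.isEdge_up v) hne hv1 (hw _ h1 hv1) (S.mem_up v)
    (hw _ (S.isEdge_up v) (S.mem_up v))
  exact S.par_ne v (S.edge_inj hd h2).1.symm

/-- The dual has the same incidence graph with its sides exchanged. Its hyperedges are sets, so
`injective_star` is needed to identify them with the vertices of `K`. -/
theorem IsRegularHypertree.dual (hK : K.IsRegularHypertree d k) (hk : 1 ≤ k) (hd : 1 ≤ d) :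
    K.dual.IsRegularHypertree k d := by
  have hinj := hK.injective_star hk hd
  have hmem : ∀ v, v ∈ K.vertexSet := fun v => by rw [hK.vertexSet_eq]; trivial
  refine ⟨rfl, ?_, ?_, ?_⟩
  · let φ : W ≃ K.dual.edgeSet := Equiv.ofBijective
      (fun v => ⟨{e : K.edgeSet | v ∈ (e : Set W)}, v, hmem v, rfl⟩)
      ⟨fun v w h => hinj (congrArg Subtype.val h), by
        rintro ⟨_, v, -, rfl⟩
        exact ⟨v, rfl⟩⟩
    have hφ : ∀ v (e : K.edgeSet), e ∈ (φ v : Set K.edgeSet) ↔ v ∈ (e : Set W) :=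
      fun _ _ => Iff.rfl
    let ψ : K.incidenceGraph ≃g K.dual.incidenceGraph :=
      { toEquiv := (Equiv.sumComm _ _).trans (Equiv.sumCongr (Equiv.refl _) φ)
        map_rel_iff' := by
          rintro (v | e) (w | f)
          · exact Iff.rfl
          · exact hφ v f
          · exact hφ w e
          · exact Iff.rfl }
    exact ψ.isTree_iff.1 hK.isTree
  · rintro _ ⟨v, -, rfl⟩
    rw [← hK.regular v, ← Set.ncard_image_of_injective _ Subtype.val_injective]
    congr 1
    ext e
    constructor
    · rintro ⟨e, he, rfl⟩
      exact ⟨e.2, he⟩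
    · rintro ⟨he, hv⟩
      exact ⟨⟨e, he⟩, hv, rfl⟩
  · intro e
    rw [← hK.uniform e.1 e.2, ← Set.ncard_image_of_injective _ hinj]
    congr 1
    ext s
    constructor
    · rintro ⟨⟨v, -, rfl⟩, hv⟩
      exact ⟨v, hv, rfl⟩
    · rintro ⟨v, hv, rfl⟩
      exact ⟨⟨v, hmem v, rfl⟩, hv⟩

theorem isMatching_iff_isIndep_dual (hK : K.vertexSet = Set.univ) {M : Set K.edgeSet} :
    K.IsMatching M ↔ K.dual.IsIndep M := by
  constructor
  · intro h
    refine ⟨Set.subset_univ _, ?_⟩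
    rintro _ ⟨v, -, rfl⟩ e ⟨he, hve⟩ f ⟨hf, hvf⟩
    by_contra hne
    exact Set.disjoint_left.1 (h he hf hne) hve hvf
  · rintro ⟨-, h⟩ e he f hf hne
    refine Set.disjoint_left.2 ?_
    intro v hve hvf
    exact hne (h _ ⟨v, by rw [hK]; trivial, rfl⟩ ⟨he, hve⟩ ⟨hf, hvf⟩)

theorem edgeBoundary_eq_outerBoundary_dual (hK : K.vertexSet = Set.univ) (F : Set K.edgeSet) :
    K.edgeBoundary F = K.dual.outerBoundary F := by
  ext f
  refine and_congr_right fun _ => exists_congr fun e => and_congr_right fun _ => ?_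
  rw [Set.not_disjoint_iff]
  constructor
  · rintro ⟨v, hve, hvf⟩
    exact ⟨_, ⟨v, by rw [hK]; trivial, rfl⟩, hvf, hve⟩
  · rintro ⟨_, ⟨v, -, rfl⟩, hvf, hve⟩
    exact ⟨v, hve, hvf⟩

open scoped Classical in
theorem matchingPartition_eq_indepPartition_dual (hK : K.vertexSet = Set.univ)
    (F : Finset K.edgeSet) : K.matchingPartition lam F = K.dual.indepPartition lam F := by
  rw [matchingPartition, indepPartition]
  exact Finset.sum_congr (Finset.filter_congr fun A _ => isMatching_iff_isIndep_dual hK)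
    fun _ _ => rfl

theorem isMatchingGibbs_iff_isGibbs_dual (hK : K.vertexSet = Set.univ)
    {μ : Measure (Set K.edgeSet)} : K.IsMatchingGibbs lam μ ↔ K.dual.IsGibbs lam μ := by
  constructor
  · rintro ⟨h1, h2, h3⟩
    simp only [isMatching_iff_isIndep_dual hK, edgeBoundary_eq_outerBoundary_dual hK,
      matchingPartition_eq_indepPartition_dual hK] at h2 h3
    exact ⟨h1, h2, h3⟩
  · rintro ⟨h1, h2, h3⟩
    simp only [← isMatching_iff_isIndep_dual hK, ← edgeBoundary_eq_outerBoundary_dual hK,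
      ← matchingPartition_eq_indepPartition_dual hK] at h2 h3
    exact ⟨h1, h2, h3⟩

end Hypergraph

end

theorem mainTheorem2 (k d : ℕ) (hk : 1 ≤ k) (hd : 1 ≤ d) :
    -- independent sets of the `(k+1)`-uniform `(d+1)`-regular hypertree
    (∀ (V : Type u) (H : Hypergraph V), H.IsRegularHypertree k d →
      (∀ lam : ℝ, 0 < lam →
        ∃! μ : Measure (Set V), H.IsGibbs lam μ ∧ H.IsSimple μ ∧ Hypergraph.IsInvariant H.aut μ) ∧
      (∀ lam : ℝ, 0 < lam →
        ((∃! μ : Measure (Set V), H.IsGibbs lam μ) ↔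
          ENNReal.ofReal lam ≤ criticalActivity k d)) ∧
      (∃ G : Subgroup (Equiv.Perm V), G ≤ H.aut ∧
        Nat.card (MulAction.orbitRel.Quotient G V) = 2 ∧
        ∀ lam : ℝ, 0 < lam →
          ((∃! μ : Measure (Set V), H.IsGibbs lam μ ∧ Hypergraph.IsInvariant G μ) ↔
            ENNReal.ofReal lam ≤ criticalActivity k d))) ∧
    -- the equivalent formulation for matchings of the `(d+1)`-uniform `(k+1)`-regular hypertree
    (∀ (W : Type u) (K : Hypergraph W), K.IsRegularHypertree d k →
      K.dual.IsRegularHypertree k d ∧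
      ∀ lam : ℝ, 0 < lam →
        (∀ μ : Measure (Set K.edgeSet), K.IsMatchingGibbs lam μ ↔ K.dual.IsGibbs lam μ) ∧
        ((∃! μ : Measure (Set K.edgeSet), K.IsMatchingGibbs lam μ) ↔
          ENNReal.ofReal lam ≤ criticalActivity k d)) := by
  refine ⟨fun V H hH => ?_, fun W K hK => ?_⟩
  · obtain ⟨S⟩ := hH.nonempty_endStructure hk hd
    have := hH.nonempty
    exact ⟨fun lam hlam => Hypergraph.existsUnique_simple_gibbs S hk hlam,
      fun lam hlam => Hypergraph.existsUnique_gibbs_iff S hk hd hlam,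
      S.parityGroup, S.parityGroup_le, S.card_orbits_parityGroup, fun lam hlam =>
        Hypergraph.existsUnique_parityGroup_invariant_gibbs_iff S hk hd hlam⟩
  · have hD := hK.dual hk hd
    obtain ⟨S⟩ := hD.nonempty_endStructure hk hd
    have := hD.nonempty
    have hiff := fun (lam : ℝ) (μ : Measure (Set K.edgeSet)) =>
      Hypergraph.isMatchingGibbs_iff_isGibbs_dual (lam := lam) (μ := μ) hK.vertexSet_eq
    refine ⟨hD, fun lam hlam => ⟨hiff lam, ?_⟩⟩
    simp only [hiff]
    exact Hypergraph.existsUnique_gibbs_iff S hk hd hlam
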